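/- Let $k\ge 0$ and $n\in\mathbb{C}$. A diagram is a set partition of the vertices $1,\dots,k$ (top row) and $1',\dots,k'$ (bottom row). For diagrams $d_1,d_2$, let $d_1\circ d_2$ be their concatenation ($d_1$ above $d_2$), $\ell(d_1,d_2)$ the number of connected components removed from the middle row, and $d^T$ the reflection of $d$ in the horizontal axis. The partition algebra $\mathbf{P}_k(n)$ has the diagrams as a $\mathbb{C}$-basis, with $d_1d_2=n^{\ell(d_1,d_2)}\,d_1\circ d_2$. The rank of $d$ is the number of its propagating blocks, that is, blocks meeting both rows. Let $\mathbf{A}_k\subseteq\mathbf{P}_k(n)$ be the span of the set $\mathcal{A}_k$ of all diagrams (partition algebra), of those with all blocks of size $2$ (Brauer), with all blocks of size $1$ or $2$ (rook-Brauer), with all blocks having at most one vertex in each row (rook monoid), or of the planar diagrams of these last three kinds (Temperley-Lieb, Motzkin, planar rook monoid, respectively). The last three algebras are called planar. Let $\Lambda^{\mathbf{A}_k}$ be the set of all partitions $\mu\vdash m$ with $0\le m\le k$, with $k-m$ even in the Brauer and Temperley-Lieb cases, and with $\mu=[m]$ if $\mathbf{A}_k$ is planar. Let $\lambda$ be a partition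 such that $\lambda^*\in\Lambda^{\mathbf{A}_k}$, where $\lambda^*$ is $\lambda$ with its first part removed, and let $m=|\lambda^*|$. (If $n$ is a positive integer one usually takes $\lambda\vdash n$; everything below depends only on $\lambda^*$.) For $\mu=\lambda^*$ let $t_c$ be the column-reading tableau and $p_\mu=\sum_{\gamma}\sum_{\rho}\operatorname{sign}(\gamma)\,\gamma\rho\in\mathbb{C}S_m$, where $\gamma$ runs over the permutations preserving the columns of $t_c$ and $\rho$ over those preserving the rows. Let $S_m^{\mu}=(\mathbb{C}S_m)p_{\mu}$ and $n_t=\sigma_tp_{\mu}$ for each standard tableau $t$ of shape $\mu$, where $\sigma_t(t_c)=t$. A permutation $\sigma\in S_m$ is identified with the diagram joining $j'$ to $\sigma(j)$ for $j\le m$ and $j'$ to $j$ for $j>m$. Let $\mathbf{J}_{m-1}$ be the span of the diagrams in $\mathcal{A}_k$ of rank less than $m$. In the Brauer and Temperley-Lieb cases let $e_m$ be $n^{-(k-m)/2}$ times the diagram with blocks $\{i,i'\}$ for $i\le m$ in which the last $k-m$ vertices of each row are paired with their neighbours ($m+1$ with $m+2$, and so on); in the other cases let $e_m$ be $n^{-(k-m)}$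 times the diagram with blocks $\{i,i'\}$ for $i\le m$ and all other vertices isolated. Assume $n\ne 0$ if $m<k$, so that $e_m$ is defined. Put $e_\lambda=p\,e_m\in\mathbf{A}_k$, where $p=p_{\lambda^*}$ if $\mathbf{A}_k$ is not planar and $p=1$ if it is planar. Let $(\mathbf{A}_ke_\lambda)/\mathbf{J}_{m-1}$ be the image of the left ideal $\mathbf{A}_ke_\lambda$ in $\mathbf{A}_k/\mathbf{J}_{m-1}$. A symmetric $m$-diagram is a $w\in\mathcal{A}_k$ with $w=w^T$, of rank $m$, such that every propagating block joins its top part to the mirror image of that part. Order its propagating blocks by their maximal top entries. Let $\mathbf{W}^m$ be the vector space with the symmetric $m$-diagrams as basis, and $\mathbf{A}_k^\lambda=\mathbf{W}^m\otimes S_m^{\lambda^*}$. For $d\in\mathcal{A}_k$ put $$d\cdot(w\otimes v)=\begin{cases}n^{\ell(d,w)}\,(d\circ w\circ d^T)\otimes\sigma_{d,w}v&\text{if } d\circ w\circ d^T\text{ has rank }m,\\0&\text{otherwise,}\end{cases}$$ where $\sigma_{d,w}\in S_m$ is the permutation such that $d$ sends the $i$-th propagating block of $w$ to the $\sigma_{d,w}(i)$-th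 propagating block of $d\circ w\circ d^T$. A noncrossing $m$-factor is an $\omega\in\mathcal{A}_k$ of rank $m$ whose first $m$ bottom vertices propagate, whose last $k-m$ bottom vertices are isolated (in the Brauer and Temperley-Lieb cases: paired with their neighbours), and whose propagating edges do not cross when drawn from the bottom vertices $1',\dots,m'$ to the rightmost vertices of their blocks in the top row. **Proposition.** Suppose that $\mathbf{A}_k$ is semisimple. Then the formula above makes $\mathbf{A}_k^\lambda$ an $\mathbf{A}_k$-module, and $\mathbf{A}_k^\lambda\cong(\mathbf{A}_ke_\lambda)/\mathbf{J}_{m-1}$ as $\mathbf{A}_k$-modules. More precisely, there is a bijection $\omega\mapsto w$ from the noncrossing $m$-factors onto the symmetric $m$-diagrams such that $\omega$ and $w$ have the same set partition and the same propagating blocks on the top row, and there is an isomorphism of $\mathbf{A}_k$-modules that sends $w\otimes n_t$ to $\omega\,\sigma_t\,p+\mathbf{J}_{m-1}$ for all such pairs $(\omega,w)$ and all standard tableaux $t$ of shape $\lambda^*$. -/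

import Mathlib

open scoped TensorProduct

namespace DiagramAlgebras

/-- A set-partition diagram: a set partition (equivalence relation) of the `2k` vertices, where
`Sum.inl i` is the vertex `i` of the top row and `Sum.inr i` is the vertex `i'` of the bottom row
(vertices are numbered from `0`). -/
abbrev Diagram (k : ℕ) := Setoid (Fin k ⊕ Fin k)

variable {k : ℕ}

/-! ### Concatenation -/

/-- Vertices of the upper diagram of a stack, inside the three rows (top, middle, bottom). -/
def upper : Fin k ⊕ Fin k → Fin k ⊕ (Fin k ⊕ Fin k) := Sum.map id Sum.inl

/-- The first and the last of three rows. -/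
def outer : Fin k ⊕ Fin k → Fin k ⊕ (Fin k ⊕ Fin k) := Sum.map id Sum.inr

/-- The connected components of the graph on three rows obtained by placing `d₁` above `d₂` and
identifying the bottom row of `d₁` with the top row of `d₂`. -/
@[reducible] def stack (d₁ d₂ : Diagram k) : Setoid (Fin k ⊕ (Fin k ⊕ Fin k)) :=
  Relation.EqvGen.setoid fun x y =>
    (∃ a b, d₁ a b ∧ x = upper a ∧ y = upper b) ∨
    (∃ a b, d₂ a b ∧ x = Sum.inr a ∧ y = Sum.inr b)

/-- The concatenation `d₁ ∘ d₂`, with `d₁` placed above `d₂`. -/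
@[reducible] def comp (d₁ d₂ : Diagram k) : Diagram k := (stack d₁ d₂).comap outer

/-- `ℓ(d₁, d₂)`: the number of connected components of the stack that lie entirely in the middle
row. -/
noncomputable def loops (d₁ d₂ : Diagram k) : ℕ :=
  Nat.card {c : Quotient (stack d₁ d₂) // ∀ x, Quotient.mk _ x = c → ∃ j, x = Sum.inr (Sum.inl j)}

/-- The identity diagram, with blocks `{i, i'}`. -/
@[reducible] def idDiagram (k : ℕ) : Diagram k := Setoid.ker (Sum.elim id id)

/-- The reflection `d ↦ dᵀ` over the horizontal axis. -/
@[reducible] def transpose (d : Diagram k) : Diagram k := d.comap Sum.swap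

theorem stack_upper {d₁ d₂ : Diagram k} {a b} (h : d₁ a b) : stack d₁ d₂ (upper a) (upper b) :=
  Relation.EqvGen.rel _ _ (Or.inl ⟨a, b, h, rfl, rfl⟩)

theorem stack_lower {d₁ d₂ : Diagram k} {a b} (h : d₂ a b) :
    stack d₁ d₂ (Sum.inr a) (Sum.inr b) :=
  Relation.EqvGen.rel _ _ (Or.inr ⟨a, b, h, rfl, rfl⟩)

theorem stack_le {d₁ d₂ : Diagram k} {s : Setoid (Fin k ⊕ (Fin k ⊕ Fin k))}
    (h₁ : ∀ a b, d₁ a b → s (upper a) (upper b))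
    (h₂ : ∀ a b, d₂ a b → s (Sum.inr a) (Sum.inr b)) {x y} (h : stack d₁ d₂ x y) : s x y := by
  refine Setoid.eqvGen_le ?_ h
  rintro x y (⟨a, b, h, rfl, rfl⟩ | ⟨a, b, h, rfl, rfl⟩)
  exacts [h₁ _ _ h, h₂ _ _ h]

/-- Two-colourings of the top and bottom row that are constant on blocks, as a matrix. -/
noncomputable def colouring (d : Diagram k) (f g : Fin k → Bool) : ℕ :=
  open Classical in if ∀ x y, d x y → Sum.elim f g x = Sum.elim f g y then 1 else 0

theorem colouring_injective {d d' : Diagram k} (h : ∀ f g, colouring d f g = colouring d' f g) :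
    d = d' := by
  classical
  have key : ∀ d d' : Diagram k, (∀ f g, colouring d f g = colouring d' f g) →
      ∀ x y, d' x y → d x y := by
    intro d d' h x y hxy
    have h1 := h (fun i => decide (d x (Sum.inl i))) (fun i => decide (d x (Sum.inr i)))
    have h2 : ∀ z, Sum.elim (fun i => decide (d x (Sum.inl i)))
        (fun i => decide (d x (Sum.inr i))) z = decide (d x z) := by rintro (z | z) <;> rfl
    simp only [colouring, h2] at h1
    rw [if_pos] at h1
    · by_contra hn
      rw [if_neg] at h1
      · omega
      · intro h3
        have := h3 x y hxy
        simp only [decide_eq_decide] at this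
        exact hn (this.1 (d.refl _))
    · intro a b hab
      simp only [decide_eq_decide]
      exact ⟨fun h => d.trans h hab, fun h => d.trans h (d.symm hab)⟩
  ext x y
  exact ⟨key d' d (fun f g => (h f g).symm) x y, key d d' h x y⟩

theorem sum_colouring (d₁ d₂ : Diagram k) (f g : Fin k → Bool) :
    ∑ h : Fin k → Bool, colouring d₁ f h * colouring d₂ h g
      = 2 ^ loops d₁ d₂ * colouring (comp d₁ d₂) f g := by
  classical
  have hup : ∀ (h : Fin k → Bool) a, Sum.elim f (Sum.elim h g) (upper a) = Sum.elim f h a := by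
    rintro h (a | a) <;> rfl
  have hcompat : ∀ h : Fin k → Bool, ((∀ x y, d₁ x y → Sum.elim f h x = Sum.elim f h y) ∧
      (∀ x y, d₂ x y → Sum.elim h g x = Sum.elim h g y)) ↔
      ∀ x y, stack d₁ d₂ x y → Sum.elim f (Sum.elim h g) x = Sum.elim f (Sum.elim h g) y := by
    intro h
    constructor
    · rintro ⟨h1, h2⟩ x y hxy
      refine stack_le (s := Setoid.ker (Sum.elim f (Sum.elim h g))) ?_ ?_ hxy
      · intro a b hab
        simp only [Setoid.ker_def, hup]
        exact h1 a b hab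
      · intro a b hab
        exact h2 a b hab
    · intro H
      constructor
      · intro x y hxy
        have := H _ _ (stack_upper hxy)
        simpa only [hup] using this
      · intro x y hxy
        exact H _ _ (stack_lower hxy)
  have hout : ∀ (h : Fin k → Bool) a, Sum.elim f (Sum.elim h g) (outer a) = Sum.elim f g a := by
    rintro h (a | a) <;> rfl
  have hprod : ∀ h : Fin k → Bool, colouring d₁ f h * colouring d₂ h g =
      if ∀ x y, stack d₁ d₂ x y → Sum.elim f (Sum.elim h g) x = Sum.elim f (Sum.elim h g) y
      then 1 else 0 := by
    intro h
    rw [← if_congr (hcompat h) rfl rfl]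
    rw [colouring, colouring]
    by_cases h1 : ∀ x y, d₁ x y → Sum.elim f h x = Sum.elim f h y
    · by_cases h2 : ∀ x y, d₂ x y → Sum.elim h g x = Sum.elim h g y
      · rw [if_pos h1, if_pos h2, if_pos ⟨h1, h2⟩]
      · rw [if_neg h2, mul_zero, if_neg fun H => h2 H.2]
    · rw [if_neg h1, zero_mul, if_neg fun H => h1 H.1]
  simp only [hprod, Finset.sum_boole, Nat.cast_id]
  by_cases hfg : ∀ x y, comp d₁ d₂ x y → Sum.elim f g x = Sum.elim f g y
  · have : colouring (comp d₁ d₂) f g = 1 := by rw [colouring, if_pos hfg]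
    rw [this, mul_one, loops]
    rw [← Fintype.card_subtype, ← Nat.card_eq_fintype_card]
    have e2 : (2 : ℕ) = Nat.card Bool := by simp
    conv_rhs => rw [e2]
    rw [← Nat.card_fun]
    refine Nat.card_congr ?_
    let L := {c : Quotient (stack d₁ d₂) //
      ∀ x, Quotient.mk _ x = c → ∃ j, x = Sum.inr (Sum.inl j)}
    let S := stack d₁ d₂
    -- the forced colour of a vertex, given the colours of the loops
    let F : (L → Bool) → (Fin k ⊕ (Fin k ⊕ Fin k)) → Bool := fun u x =>
      if hx : ∀ y, Quotient.mk S y = Quotient.mk S x → ∃ j, y = Sum.inr (Sum.inl j) then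
        u ⟨Quotient.mk S x, hx⟩
      else decide (∃ a, S (outer a) x ∧ Sum.elim f g a = true)
    have hF : ∀ u x y, S x y → F u x = F u y := by
      intro u x y hxy
      have hq : Quotient.mk S x = Quotient.mk S y := Quotient.sound hxy
      by_cases hx : ∀ z, Quotient.mk S z = Quotient.mk S x → ∃ j, z = Sum.inr (Sum.inl j)
      · have hy : ∀ z, Quotient.mk S z = Quotient.mk S y → ∃ j, z = Sum.inr (Sum.inl j) := by
          intro z hz
          exact hx z (hz.trans hq.symm)
        simp only [F]
        rw [dif_pos hx, dif_pos hy]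
        congr 1
        exact Subtype.ext hq
      · have hy : ¬ ∀ z, Quotient.mk S z = Quotient.mk S y → ∃ j, z = Sum.inr (Sum.inl j) := by
          intro hy
          exact hx fun z hz => hy z (hz.trans hq)
        simp only [F]
        rw [dif_neg hx, dif_neg hy, decide_eq_decide]
        exact ⟨fun ⟨a, h, h'⟩ => ⟨a, S.trans h hxy, h'⟩,
          fun ⟨a, h, h'⟩ => ⟨a, S.trans h (S.symm hxy), h'⟩⟩
    have hFout : ∀ u a, F u (outer a) = Sum.elim f g a := by
      intro u a
      have hx : ¬ ∀ z, Quotient.mk S z = Quotient.mk S (outer a) →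
          ∃ j, z = Sum.inr (Sum.inl j) := by
        intro H
        obtain ⟨j, hj⟩ := H _ rfl
        rcases a with a | a <;> simp [outer] at hj
      simp only [F]
      rw [dif_neg hx]
      rw [Bool.eq_iff_iff, decide_eq_true_iff]
      exact ⟨fun ⟨b, hb, hb'⟩ => (hfg b a hb) ▸ hb', fun h => ⟨a, S.refl _, h⟩⟩
    have hFelim : ∀ u, Sum.elim f (Sum.elim (fun j => F u (Sum.inr (Sum.inl j))) g) = F u := by
      intro u
      funext x
      rcases x with x | x | x
      · exact (hFout u (Sum.inl x)).symm
      · rfl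
      · exact (hFout u (Sum.inr x)).symm
    have hLex : ∀ c : L, ∃ j, Quotient.mk S (Sum.inr (Sum.inl j)) = c.1 := by
      rintro ⟨c, hc⟩
      obtain ⟨x, rfl⟩ := Quotient.exists_rep c
      obtain ⟨j, rfl⟩ := hc x rfl
      exact ⟨j, rfl⟩
    refine
      { toFun := fun h c => h.1 (hLex c).choose
        invFun := fun u => ⟨fun j => F u (Sum.inr (Sum.inl j)), ?_⟩
        left_inv := ?_
        right_inv := ?_ }
    · rw [hFelim]
      exact hF u
    · rintro ⟨h, hh⟩
      apply Subtype.ext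
      funext j
      simp only [F]
      split_ifs with hx
      · have := (hLex ⟨_, hx⟩).choose_spec
        exact hh _ _ (Quotient.exact this)
      · rw [Bool.eq_iff_iff, decide_eq_true_iff]
        constructor
        · rintro ⟨a, ha, ha'⟩
          have := hh _ _ ha
          rw [hout, ha'] at this
          exact this.symm
        · intro hj
          push Not at hx
          obtain ⟨y, hy, hy'⟩ := hx
          have hy1 := Quotient.exact hy
          rcases y with y | y | y
          · refine ⟨Sum.inl y, hy1, ?_⟩
            exact (hh _ _ hy1).trans hj
          · exact absurd rfl (hy' y)
          · refine ⟨Sum.inr y, hy1, ?_⟩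
            exact (hh _ _ hy1).trans hj
    · intro u
      funext c
      have hs := (hLex c).choose_spec
      simp only [F]
      rw [dif_pos]
      · congr 1
        exact Subtype.ext hs
      · intro y hy
        exact c.2 y (hy.trans hs)
  · have : colouring (comp d₁ d₂) f g = 0 := by rw [colouring, if_neg hfg]
    rw [this, mul_zero, Finset.card_eq_zero, Finset.filter_eq_empty_iff]
    intro h _ H
    apply hfg
    intro x y hxy
    have := H _ _ hxy
    rwa [hout, hout] at this

theorem colouring_const (d : Diagram k) : colouring d (fun _ => true) (fun _ => true) = 1 := by
  rw [colouring, if_pos]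
  rintro (x | x) (y | y) _ <;> rfl

theorem comp_assoc_aux (d₁ d₂ d₃ : Diagram k) (f g : Fin k → Bool) :
    2 ^ (loops d₁ d₂ + loops (comp d₁ d₂) d₃) * colouring (comp (comp d₁ d₂) d₃) f g =
    2 ^ (loops d₂ d₃ + loops d₁ (comp d₂ d₃)) * colouring (comp d₁ (comp d₂ d₃)) f g := by
  have h1 : ∑ h : Fin k → Bool, (∑ h' : Fin k → Bool, colouring d₁ f h' * colouring d₂ h' h) *
      colouring d₃ h g = ∑ h' : Fin k → Bool, colouring d₁ f h' *
        ∑ h : Fin k → Bool, colouring d₂ h' h * colouring d₃ h g := by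
    simp_rw [Finset.sum_mul, Finset.mul_sum]
    rw [Finset.sum_comm]
    simp only [mul_assoc]
  simp only [sum_colouring] at h1
  simp only [mul_assoc, mul_left_comm (colouring d₁ _ _), ← Finset.mul_sum, sum_colouring] at h1
  rw [pow_add, pow_add, mul_assoc, mul_assoc]
  exact h1

theorem loops_assoc (d₁ d₂ d₃ : Diagram k) :
    loops d₁ d₂ + loops (comp d₁ d₂) d₃ = loops d₂ d₃ + loops d₁ (comp d₂ d₃) := by
  have h := comp_assoc_aux d₁ d₂ d₃ (fun _ => true) (fun _ => true)
  rw [colouring_const, colouring_const, mul_one, mul_one] at h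
  exact Nat.pow_right_injective le_rfl h

theorem comp_assoc (d₁ d₂ d₃ : Diagram k) :
    comp (comp d₁ d₂) d₃ = comp d₁ (comp d₂ d₃) := by
  apply colouring_injective
  intro f g
  have h := comp_assoc_aux d₁ d₂ d₃ f g
  rw [loops_assoc] at h
  exact Nat.eq_of_mul_eq_mul_left (by positivity) h

theorem idDiagram_comp (d : Diagram k) : comp (idDiagram k) d = d := by
  ext x y
  constructor
  · intro h
    have := stack_le (s := d.comap (Sum.elim Sum.inl id)) (d₁ := idDiagram k) (d₂ := d) ?_ ?_ h
    · rcases x with x | x <;> rcases y with y | y <;> exact this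
    · rintro (a | a) (b | b) hab <;>
      · have : a = b := hab
        subst this
        exact d.refl _
    · intro a b hab
      exact hab
  · intro h
    have h0 : ∀ a, stack (idDiagram k) d (outer a) (Sum.inr a) := by
      rintro (a | a)
      · exact stack_upper (a := Sum.inl a) (b := Sum.inr a) rfl
      · exact Setoid.refl' _ _
    exact (stack (idDiagram k) d).trans' (h0 x) ((stack (idDiagram k) d).trans' (stack_lower h) ((stack (idDiagram k) d).symm' (h0 y)))

theorem comp_idDiagram (d : Diagram k) : comp d (idDiagram k) = d := by
  ext x y
  constructor
  · intro h
    have := stack_le (s := d.comap (Sum.elim Sum.inl (Sum.elim Sum.inr Sum.inr)))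
      (d₁ := d) (d₂ := idDiagram k) ?_ ?_ h
    · rcases x with x | x <;> rcases y with y | y <;> exact this
    · rintro (a | a) (b | b) hab <;> exact hab
    · rintro (a | a) (b | b) hab <;>
      · have : a = b := hab
        subst this
        exact d.refl _
  · intro h
    have h0 : ∀ a, stack d (idDiagram k) (outer a) (upper a) := by
      rintro (a | a)
      · exact Setoid.refl' _ _
      · exact stack_lower (a := Sum.inr a) (b := Sum.inl a) rfl
    exact (stack d (idDiagram k)).trans' (h0 x) ((stack d (idDiagram k)).trans' (stack_upper h) ((stack d (idDiagram k)).symm' (h0 y)))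

theorem loops_idDiagram_left (d : Diagram k) : loops (idDiagram k) d = 0 := by
  rw [loops, Nat.card_eq_zero]
  left
  constructor
  rintro ⟨c, hc⟩
  obtain ⟨x, rfl⟩ := Quotient.exists_rep c
  obtain ⟨j, rfl⟩ := hc x rfl
  obtain ⟨i, hi⟩ := hc (Sum.inl j) (Quotient.sound
    (stack_upper (a := Sum.inl j) (b := Sum.inr j) rfl))
  simp at hi

theorem loops_idDiagram_right (d : Diagram k) : loops d (idDiagram k) = 0 := by
  rw [loops, Nat.card_eq_zero]
  left
  constructor
  rintro ⟨c, hc⟩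
  obtain ⟨x, rfl⟩ := Quotient.exists_rep c
  obtain ⟨j, rfl⟩ := hc x rfl
  obtain ⟨i, hi⟩ := hc (Sum.inr (Sum.inr j)) (Quotient.sound
    (stack_lower (a := Sum.inr j) (b := Sum.inl j) rfl))
  simp at hi

/-! ### The partition algebra -/

/-- The partition algebra `P_k(n)`: formal complex linear combinations of diagrams, with
multiplication determined by `d₁ d₂ = n ^ ℓ(d₁, d₂) • (d₁ ∘ d₂)`. -/
def PartitionAlgebra (k : ℕ) (_n : ℂ) : Type := Diagram k →₀ ℂ

variable {n : ℂ}

noncomputable instance : AddCommGroup (PartitionAlgebra k n) :=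
  inferInstanceAs (AddCommGroup (Diagram k →₀ ℂ))

noncomputable instance : Module ℂ (PartitionAlgebra k n) :=
  inferInstanceAs (Module ℂ (Diagram k →₀ ℂ))

/-- A diagram, as a basis element of the partition algebra. -/
noncomputable def diag (n : ℂ) (d : Diagram k) : PartitionAlgebra k n :=
  (Finsupp.single d 1 : Diagram k →₀ ℂ)

/-- The diagram basis of the partition algebra. -/
noncomputable def diagBasis (k : ℕ) (n : ℂ) : Module.Basis (Diagram k) ℂ (PartitionAlgebra k n) :=
  Module.Basis.ofRepr (LinearEquiv.refl ℂ (Diagram k →₀ ℂ))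

theorem diagBasis_apply (d : Diagram k) : diagBasis k n d = diag n d := rfl

/-- The multiplication of the partition algebra, as a bilinear map. -/
noncomputable def mulMap (k : ℕ) (n : ℂ) :
    PartitionAlgebra k n →ₗ[ℂ] PartitionAlgebra k n →ₗ[ℂ] PartitionAlgebra k n :=
  (diagBasis k n).constr ℂ fun d₁ => (diagBasis k n).constr ℂ fun d₂ =>
    n ^ loops d₁ d₂ • diag n (comp d₁ d₂)

theorem mulMap_diag (d₁ d₂ : Diagram k) :
    mulMap k n (diag n d₁) (diag n d₂) = n ^ loops d₁ d₂ • diag n (comp d₁ d₂) := by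
  simp only [← diagBasis_apply, mulMap, Module.Basis.constr_basis]

noncomputable instance : Mul (PartitionAlgebra k n) := ⟨fun a b => mulMap k n a b⟩

noncomputable instance : One (PartitionAlgebra k n) := ⟨diag n (idDiagram k)⟩

theorem mul_eq (a b : PartitionAlgebra k n) : a * b = mulMap k n a b := rfl

theorem one_eq : (1 : PartitionAlgebra k n) = diag n (idDiagram k) := rfl

theorem diag_mul_diag (d₁ d₂ : Diagram k) :
    diag n d₁ * diag n d₂ = n ^ loops d₁ d₂ • diag n (comp d₁ d₂) := mulMap_diag d₁ d₂

theorem mulMap_assoc (a b c : PartitionAlgebra k n) :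
    mulMap k n (mulMap k n a b) c = mulMap k n a (mulMap k n b c) := by
  have h : (LinearMap.llcomp ℂ _ _ _ (mulMap k n)).comp (mulMap k n) =
      ((LinearMap.llcomp ℂ _ _ _).flip (mulMap k n)).comp
        ((LinearMap.llcomp ℂ _ _ _).comp (mulMap k n)) := by
    refine (diagBasis k n).ext fun d₁ => (diagBasis k n).ext fun d₂ =>
      (diagBasis k n).ext fun d₃ => ?_
    simp only [diagBasis_apply, LinearMap.comp_apply, LinearMap.llcomp_apply,
      LinearMap.flip_apply, mulMap_diag, map_smul, LinearMap.smul_apply, smul_smul,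
      ← pow_add, comp_assoc]
    rw [loops_assoc]
  exact congrArg (fun f => f a b c) h

noncomputable instance : Ring (PartitionAlgebra k n) :=
  { (inferInstance : AddCommGroup (PartitionAlgebra k n)),
    (inferInstance : Mul (PartitionAlgebra k n)),
    (inferInstance : One (PartitionAlgebra k n)) with
    left_distrib := fun a b c => by simp only [mul_eq, map_add]
    right_distrib := fun a b c => by simp only [mul_eq, map_add, LinearMap.add_apply]
    zero_mul := fun a => by simp only [mul_eq, map_zero, LinearMap.zero_apply]
    mul_zero := fun a => by simp only [mul_eq, map_zero]
    mul_assoc := fun a b c => mulMap_assoc a b c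
    one_mul := fun a => by
      have h : mulMap k n (diag n (idDiagram k)) = LinearMap.id := by
        refine (diagBasis k n).ext fun d => ?_
        simp [diagBasis_apply, mulMap_diag, idDiagram_comp, loops_idDiagram_left]
      rw [mul_eq, one_eq, h, LinearMap.id_apply]
    mul_one := fun a => by
      have h : (mulMap k n).flip (diag n (idDiagram k)) = LinearMap.id := by
        refine (diagBasis k n).ext fun d => ?_
        simp [diagBasis_apply, mulMap_diag, comp_idDiagram, loops_idDiagram_right]
      rw [mul_eq, one_eq, ← LinearMap.flip_apply, h, LinearMap.id_apply] }

noncomputable instance : Algebra ℂ (PartitionAlgebra k n) :=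
  Algebra.ofModule
    (fun r a b => by simp only [mul_eq, map_smul, LinearMap.smul_apply])
    (fun r a b => by simp only [mul_eq, map_smul])

end DiagramAlgebras

namespace DiagramAlgebras

variable {k : ℕ} {n : ℂ}

/-! ### The seven families of diagrams -/

/-- The position of a vertex on the boundary of the rectangle, read clockwise from the top left
corner: `1, …, k, k', …, 1'`. -/
def pos : Fin k ⊕ Fin k → ℕ := Sum.elim (fun i => i) (fun i => 2 * k - 1 - i)

/-- A diagram is planar if it can be drawn in the rectangle without crossings, that is, if no two
different blocks interlace on the boundary. -/
def IsPlanar (d : Diagram k) : Prop :=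
  ∀ a b c e, pos a < pos b → pos b < pos c → pos c < pos e → d a c → d b e → d a b

/-- All blocks have size 2. -/
def IsBrauer (d : Diagram k) : Prop := ∀ x, {y | d x y}.ncard = 2

/-- All blocks have size 1 or 2. -/
def IsRookBrauer (d : Diagram k) : Prop := ∀ x, {y | d x y}.ncard = 1 ∨ {y | d x y}.ncard = 2

/-- All blocks have at most one vertex in the top row and at most one in the bottom row. -/
def IsRook (d : Diagram k) : Prop :=
  ∀ x, {i | d x (Sum.inl i)}.ncard ≤ 1 ∧ {i | d x (Sum.inr i)}.ncard ≤ 1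

/-- The diagram algebras considered: the partition, Brauer, rook-Brauer, rook monoid,
Temperley-Lieb, Motzkin and planar rook monoid algebras. -/
inductive Kind
  | partition | brauer | rookBrauer | rook | temperleyLieb | motzkin | planarRook

/-- The planar algebras among them. -/
def Kind.planar : Kind → Bool
  | .temperleyLieb | .motzkin | .planarRook => true
  | .partition | .brauer | .rookBrauer | .rook => false

/-- The algebras spanned by perfect matchings: the Brauer and the Temperley-Lieb algebra. -/
def Kind.matching : Kind → Bool
  | .brauer | .temperleyLieb => true
  | .partition | .rookBrauer | .rook | .motzkin | .planarRook => false

/-- The set `𝒜_k` of diagrams spanning the algebra `A_k`. -/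
def Kind.diagrams (X : Kind) (k : ℕ) : Set (Diagram k) :=
  match X with
  | .partition => Set.univ
  | .brauer => {d | IsBrauer d}
  | .rookBrauer => {d | IsRookBrauer d}
  | .rook => {d | IsRook d}
  | .temperleyLieb => {d | IsBrauer d ∧ IsPlanar d}
  | .motzkin => {d | IsRookBrauer d ∧ IsPlanar d}
  | .planarRook => {d | IsRook d ∧ IsPlanar d}

theorem isRookBrauer_iff {d : Diagram k} :
    IsRookBrauer d ↔ ∀ x y z, d x y → d x z → x ≠ y → x ≠ z → y = z := by
  constructor
  · intro h x y z hy hz hxy hxz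
    by_contra hyz
    have h3 : ({x, y, z} : Set (Fin k ⊕ Fin k)) ⊆ {y | d x y} := by
      rintro w (rfl | rfl | rfl)
      exacts [d.refl _, hy, hz]
    have h4 := Set.ncard_le_ncard h3 (Set.toFinite _)
    have h5 : ({x, y, z} : Set (Fin k ⊕ Fin k)).ncard = 3 :=
      Set.ncard_eq_three.2 ⟨x, y, z, hxy, hxz, hyz, rfl⟩
    rcases h x with h | h <;> omega
  · intro h x
    by_cases hx : ∃ y, d x y ∧ x ≠ y
    · obtain ⟨y, hy, hxy⟩ := hx
      right
      rw [Set.ncard_eq_two]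
      refine ⟨x, y, hxy, ?_⟩
      ext z
      constructor
      · intro hz
        by_cases hxz : x = z
        · exact Or.inl hxz.symm
        · exact Or.inr (h x z y hz hy hxz hxy)
      · rintro (rfl | rfl)
        exacts [d.refl _, hy]
    · left
      rw [Set.ncard_eq_one]
      refine ⟨x, ?_⟩
      ext z
      constructor
      · intro hz
        by_contra hxz
        exact hx ⟨z, hz, fun h => hxz h.symm⟩
      · rintro rfl
        exact d.refl _

theorem isBrauer_iff {d : Diagram k} :
    IsBrauer d ↔ (∀ x y z, d x y → d x z → x ≠ y → x ≠ z → y = z) ∧ ∀ x, ∃ y, x ≠ y ∧ d x y := by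
  rw [← isRookBrauer_iff]
  constructor
  · refine fun h => ⟨fun x => Or.inr (h x), fun x => ?_⟩
    have hx : x ∈ {y | d x y} := d.refl _
    obtain ⟨y, hy, hxy⟩ := Set.exists_ne_of_one_lt_ncard (by rw [h x]; omega) x
    exact ⟨y, hxy.symm, hy⟩
  · rintro ⟨h, h'⟩ x
    rcases h x with h1 | h1
    · obtain ⟨y, hxy, hy⟩ := h' x
      obtain ⟨z, hz⟩ := Set.ncard_eq_one.1 h1
      have hx' : x ∈ ({z} : Set _) := hz ▸ (d.refl x : d x x)
      have hy' : y ∈ ({z} : Set _) := hz ▸ hy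
      exact absurd (hx'.trans hy'.symm) hxy
    · exact h1

theorem isRook_iff {d : Diagram k} :
    IsRook d ↔ (∀ i j, d (Sum.inl i) (Sum.inl j) → i = j) ∧
      ∀ i j, d (Sum.inr i) (Sum.inr j) → i = j := by
  constructor
  · intro h
    refine ⟨fun i j hij => ?_, fun i j hij => ?_⟩
    · exact (Set.ncard_le_one (Set.toFinite _)).1 (h (Sum.inl i)).1 i (d.refl _) j hij
    · exact (Set.ncard_le_one (Set.toFinite _)).1 (h (Sum.inr i)).2 i (d.refl _) j hij
  · rintro ⟨h1, h2⟩ x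
    exact ⟨(Set.ncard_le_one (Set.toFinite _)).2 fun i hi j hj => h1 i j (d.trans (d.symm hi) hj),
      (Set.ncard_le_one (Set.toFinite _)).2 fun i hi j hj => h2 i j (d.trans (d.symm hi) hj)⟩

/-! ### Each family is closed under concatenation

The middle rows of two diagrams, placed side by side, are glued one vertex at a time. -/

/-- Identify the vertices `p` and `q`. -/
def glue {V : Type*} (s : Setoid V) (p q : V) : Setoid V where
  r x y := s x y ∨ (s x p ∧ s q y) ∨ (s x q ∧ s p y)
  iseqv := by
    have ht : ∀ {x y z}, s x y → s y z → s x z := fun h h' => s.trans' h h'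
    have hs : ∀ {x y}, s x y → s y x := fun h => s.symm' h
    refine ⟨fun x => Or.inl (s.refl' x), ?_, ?_⟩
    · rintro x y (h | ⟨h, h'⟩ | ⟨h, h'⟩)
      · exact Or.inl (hs h)
      · exact Or.inr (Or.inr ⟨hs h', hs h⟩)
      · exact Or.inr (Or.inl ⟨hs h', hs h⟩)
    · rintro x y z (h | ⟨h, h'⟩ | ⟨h, h'⟩) (g | ⟨g, g'⟩ | ⟨g, g'⟩)
      · exact Or.inl (ht h g)
      · exact Or.inr (Or.inl ⟨ht h g, g'⟩)
      · exact Or.inr (Or.inr ⟨ht h g, g'⟩)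
      · exact Or.inr (Or.inl ⟨h, ht h' g⟩)
      · exact Or.inr (Or.inl ⟨h, g'⟩)
      · exact Or.inl (ht h g')
      · exact Or.inr (Or.inr ⟨h, ht h' g⟩)
      · exact Or.inl (ht h g')
      · exact Or.inr (Or.inr ⟨h, g'⟩)

theorem glue_iff {V : Type*} {s : Setoid V} {p q x y : V} :
    glue s p q x y ↔ s x y ∨ (s x p ∧ s q y) ∨ (s x q ∧ s p y) := Iff.rfl

/-- Two diagrams side by side. -/
def sideBySide (d₁ d₂ : Diagram k) : Setoid ((Fin k ⊕ Fin k) ⊕ (Fin k ⊕ Fin k)) where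
  r := Sum.LiftRel d₁ d₂
  iseqv := by
    refine ⟨?_, ?_, ?_⟩
    · rintro (x | x)
      exacts [Sum.LiftRel.inl (d₁.refl' x), Sum.LiftRel.inr (d₂.refl' x)]
    · rintro _ _ (⟨h⟩ | ⟨h⟩)
      exacts [Sum.LiftRel.inl (d₁.symm' h), Sum.LiftRel.inr (d₂.symm' h)]
    · rintro _ _ _ (⟨h⟩ | ⟨h⟩) (⟨h'⟩ | ⟨h'⟩)
      exacts [Sum.LiftRel.inl (d₁.trans' h h'), Sum.LiftRel.inr (d₂.trans' h h')]

/-- The first `j` middle vertices of two diagrams glued. -/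
def gluing (d₁ d₂ : Diagram k) : ℕ → Setoid ((Fin k ⊕ Fin k) ⊕ (Fin k ⊕ Fin k))
  | 0 => sideBySide d₁ d₂
  | j + 1 => if h : j < k then
      glue (gluing d₁ d₂ j) (Sum.inl (Sum.inr ⟨j, h⟩)) (Sum.inr (Sum.inl ⟨j, h⟩))
    else gluing d₁ d₂ j

/-- The vertices that remain after gluing `j` middle vertices. -/
def remaining (k j : ℕ) : Set ((Fin k ⊕ Fin k) ⊕ (Fin k ⊕ Fin k)) :=
  {x | ∀ i : Fin k, (i : ℕ) < j → x ≠ Sum.inl (Sum.inr i) ∧ x ≠ Sum.inr (Sum.inl i)}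

theorem gluing_induction {d₁ d₂ : Diagram k}
    {Q : Set ((Fin k ⊕ Fin k) ⊕ (Fin k ⊕ Fin k)) →
      Setoid ((Fin k ⊕ Fin k) ⊕ (Fin k ⊕ Fin k)) → Prop}
    (h0 : Q Set.univ (sideBySide d₁ d₂))
    (hstep : ∀ (j : Fin k) s, Q (remaining k j) s →
      Q (remaining k (j + 1)) (glue s (Sum.inl (Sum.inr j)) (Sum.inr (Sum.inl j)))) :
    Q (remaining k k) (gluing d₁ d₂ k) := by
  have : ∀ j, j ≤ k → Q (remaining k j) (gluing d₁ d₂ j) := by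
    intro j
    induction j with
    | zero =>
      intro _
      have : remaining k 0 = Set.univ := by
        ext x
        simp [remaining]
      rw [this]
      exact h0
    | succ j ih =>
      intro hj
      have hj' : j < k := hj
      rw [gluing, dif_pos hj']
      exact hstep ⟨j, hj'⟩ _ (ih hj'.le)
  exact this k le_rfl

/-- The vertices of the concatenation, inside two diagrams placed side by side. -/
def ends : Fin k ⊕ Fin k → (Fin k ⊕ Fin k) ⊕ (Fin k ⊕ Fin k) := Sum.map Sum.inl Sum.inr

theorem mem_remaining {x : (Fin k ⊕ Fin k) ⊕ (Fin k ⊕ Fin k)} :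
    x ∈ remaining k k ↔ ∃ a, ends a = x := by
  constructor
  · intro h
    rcases x with (x | x) | (x | x)
    · exact ⟨Sum.inl x, rfl⟩
    · exact absurd rfl (h x x.2).1
    · exact absurd rfl (h x x.2).2
    · exact ⟨Sum.inr x, rfl⟩
  · rintro ⟨a | a, rfl⟩ i _ <;> simp [ends]

theorem ends_mem (a : Fin k ⊕ Fin k) : ends a ∈ remaining k k := mem_remaining.2 ⟨a, rfl⟩

theorem ends_injective : Function.Injective (ends (k := k)) :=
  Function.Injective.sumMap Sum.inl_injective Sum.inr_injective

theorem gluing_mono (d₁ d₂ : Diagram k) {i j : ℕ} (hij : i ≤ j) {x y}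
    (h : gluing d₁ d₂ i x y) : gluing d₁ d₂ j x y := by
  induction j, hij using Nat.le_induction with
  | base => exact h
  | succ j _ ih =>
    rw [gluing]
    by_cases hj : j < k
    · rw [dif_pos hj]
      exact Or.inl ih
    · rw [dif_neg hj]
      exact ih

theorem comp_iff_gluing {d₁ d₂ : Diagram k} {a b : Fin k ⊕ Fin k} :
    comp d₁ d₂ a b ↔ gluing d₁ d₂ k (ends a) (ends b) := by
  constructor
  · intro h
    have hm : ∀ j : Fin k, gluing d₁ d₂ k (Sum.inl (Sum.inr j)) (Sum.inr (Sum.inl j)) := by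
      intro j
      refine gluing_mono d₁ d₂ (i := j + 1) j.2 ?_
      rw [gluing, dif_pos j.2]
      exact Or.inr (Or.inl ⟨Setoid.refl' _ _, Setoid.refl' _ _⟩)
    have h0 : ∀ x y, sideBySide d₁ d₂ x y → gluing d₁ d₂ k x y :=
      fun x y hxy => gluing_mono d₁ d₂ (i := 0) (Nat.zero_le _) hxy
    have := stack_le (s := (gluing d₁ d₂ k).comap
      (Sum.elim (fun i => Sum.inl (Sum.inl i)) (Sum.elim (fun i => Sum.inl (Sum.inr i))
        (fun i => Sum.inr (Sum.inr i))))) (d₁ := d₁) (d₂ := d₂) ?_ ?_ h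
    · rcases a with a | a <;> rcases b with b | b <;> exact this
    · rintro (x | x) (y | y) hxy <;> exact h0 _ _ (Sum.LiftRel.inl hxy)
    · have h1 : ∀ x : Fin k ⊕ Fin k, gluing d₁ d₂ k (Sum.elim (fun i => Sum.inl (Sum.inr i))
        (fun i => Sum.inr (Sum.inr i)) x) (Sum.inr x) := by
        rintro (x | x)
        exacts [hm x, Setoid.refl' _ _]
      intro x y hxy
      have h2 := (gluing d₁ d₂ k).trans' (h1 x) ((gluing d₁ d₂ k).trans'
        (h0 _ _ (Sum.LiftRel.inr hxy)) ((gluing d₁ d₂ k).symm' (h1 y)))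
      rcases x with x | x <;> rcases y with y | y <;> exact h2
  · intro h
    have key : ∀ j, gluing d₁ d₂ j ≤ (stack d₁ d₂).comap (Sum.elim upper Sum.inr) := by
      intro j
      induction j with
      | zero =>
        rintro _ _ (⟨h⟩ | ⟨h⟩)
        exacts [stack_upper h, stack_lower h]
      | succ j ih =>
        rw [gluing]
        split_ifs with hj
        · have ih' : ∀ {x y}, gluing d₁ d₂ j x y →
            stack d₁ d₂ (Sum.elim upper Sum.inr x) (Sum.elim upper Sum.inr y) := fun h => ih h
          rintro x y (h | ⟨h, h'⟩ | ⟨h, h'⟩)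
          · exact ih' h
          · have h1 := ih' h
            have h2 := ih' h'
            exact (stack d₁ d₂).trans' h1 h2
          · have h1 := ih' h
            have h2 := ih' h'
            exact (stack d₁ d₂).trans' h1 h2
        · exact ih
    have := key k h
    rcases a with a | a <;> rcases b with b | b <;> exact this

theorem remaining_succ {j : Fin k} {x : (Fin k ⊕ Fin k) ⊕ (Fin k ⊕ Fin k)}
    (h : x ∈ remaining k (j + 1)) :
    x ∈ remaining k j ∧ x ≠ Sum.inl (Sum.inr j) ∧ x ≠ Sum.inr (Sum.inl j) :=
  ⟨fun i hi => h i (Nat.lt_succ_of_lt hi), h j (Nat.lt_succ_self _)⟩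

theorem mem_remaining_succ {j : Fin k} {x : (Fin k ⊕ Fin k) ⊕ (Fin k ⊕ Fin k)}
    (h : x ∈ remaining k j) (h1 : x ≠ Sum.inl (Sum.inr j)) (h2 : x ≠ Sum.inr (Sum.inl j)) :
    x ∈ remaining k (j + 1) := by
  intro i hi
  rcases Nat.lt_succ_iff_lt_or_eq.1 hi with hi | hi
  · exact h i hi
  · have : i = j := Fin.ext hi
    subst this
    exact ⟨h1, h2⟩

theorem left_mem_remaining (j : Fin k) : Sum.inl (Sum.inr j) ∈ remaining k j := by
  intro i hi
  have : j ≠ i := fun h => by subst h; exact lt_irrefl _ hi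
  simp [this]

theorem right_mem_remaining (j : Fin k) : Sum.inr (Sum.inl j) ∈ remaining k j := by
  intro i hi
  have : j ≠ i := fun h => by subst h; exact lt_irrefl _ hi
  simp [this]

theorem IsRookBrauer.comp {d₁ d₂ : Diagram k} (h₁ : IsRookBrauer d₁) (h₂ : IsRookBrauer d₂) :
    IsRookBrauer (comp d₁ d₂) := by
  rw [isRookBrauer_iff] at h₁ h₂ ⊢
  have key := gluing_induction (d₁ := d₁) (d₂ := d₂)
    (Q := fun R s => ∀ x ∈ R, ∀ y ∈ R, ∀ z ∈ R, s x y → s x z → x ≠ y → x ≠ z → y = z) ?_ ?_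
  · intro x y z hxy hxz hy hz
    exact ends_injective (key _ (ends_mem x) _ (ends_mem y) _ (ends_mem z)
      (comp_iff_gluing.1 hxy) (comp_iff_gluing.1 hxz) (ends_injective.ne hy)
      (ends_injective.ne hz))
  · rintro _ - _ - _ - (⟨hxy⟩ | ⟨hxy⟩) (⟨hxz⟩ | ⟨hxz⟩) hy hz
    · rw [h₁ _ _ _ hxy hxz (fun h => hy (congrArg _ h)) (fun h => hz (congrArg _ h))]
    · rw [h₂ _ _ _ hxy hxz (fun h => hy (congrArg _ h)) (fun h => hz (congrArg _ h))]
  · intro j s ih x hx y hy z hz hxy hxz hnxy hnxz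
    obtain ⟨hx, hxp, hxq⟩ := remaining_succ hx
    obtain ⟨hy, hyp, hyq⟩ := remaining_succ hy
    obtain ⟨hz, hzp, hzq⟩ := remaining_succ hz
    have hp := left_mem_remaining j
    have hq := right_mem_remaining j
    rw [glue_iff] at hxy hxz
    generalize Sum.inl (Sum.inr j) = p at *
    generalize Sum.inr (Sum.inl j) = q at *
    have ht : ∀ {x y z}, s x y → s y z → s x z := fun h h' => s.trans' h h'
    have hs : ∀ {x y}, s x y → s y x := fun h => s.symm' h
    rcases hxy with h | ⟨h, h'⟩ | ⟨h, h'⟩ <;> rcases hxz with g | ⟨g, g'⟩ | ⟨g, g'⟩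
    · exact ih x hx y hy z hz h g hnxy hnxz
    · exact absurd (ih x hx y hy p hp h g hnxy hxp) hyp
    · exact absurd (ih x hx y hy q hq h g hnxy hxq) hyq
    · exact absurd (ih x hx z hz p hp g h hnxz hxp) hzp
    · exact ih q hq y hy z hz h' g' hyq.symm hzq.symm
    · by_cases hpq : p = q
      · subst hpq
        exact ih p hp y hy z hz h' g' hyp.symm hzp.symm
      · exact absurd (ih x hx p hp q hq h g hxp hxq) hpq
    · exact absurd (ih x hx z hz q hq g h hnxz hxq) hzq
    · by_cases hpq : p = q
      · subst hpq
        exact ih p hp y hy z hz h' g' hyp.symm hzp.symm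
      · exact absurd (ih x hx p hp q hq g h hxp hxq) hpq
    · exact ih p hp y hy z hz h' g' hyp.symm hzp.symm

theorem IsBrauer.isRookBrauer {d : Diagram k} (h : IsBrauer d) : IsRookBrauer d :=
  fun x => Or.inr (h x)

theorem IsBrauer.comp {d₁ d₂ : Diagram k} (h₁ : IsBrauer d₁) (h₂ : IsBrauer d₂) :
    IsBrauer (comp d₁ d₂) := by
  have hrb := h₁.isRookBrauer.comp h₂.isRookBrauer
  rw [isRookBrauer_iff] at hrb
  rw [isBrauer_iff] at h₁ h₂ ⊢
  refine ⟨hrb, ?_⟩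
  have key := gluing_induction (d₁ := d₁) (d₂ := d₂)
    (Q := fun R s => (∀ x ∈ R, ∀ y ∈ R, ∀ z ∈ R, s x y → s x z → x ≠ y → x ≠ z → y = z) ∧
      ∀ x ∈ R, ∃ y ∈ R, x ≠ y ∧ s x y) ?_ ?_
  · intro x
    obtain ⟨y, hy, hxy, h⟩ := key.2 _ (ends_mem x)
    obtain ⟨y, rfl⟩ := mem_remaining.1 hy
    exact ⟨y, fun h => hxy (congrArg _ h), comp_iff_gluing.2 h⟩
  · refine ⟨?_, ?_⟩
    · rintro _ - _ - _ - (⟨hxy⟩ | ⟨hxy⟩) (⟨hxz⟩ | ⟨hxz⟩) hy hz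
      · rw [h₁.1 _ _ _ hxy hxz (fun h => hy (congrArg _ h)) (fun h => hz (congrArg _ h))]
      · rw [h₂.1 _ _ _ hxy hxz (fun h => hy (congrArg _ h)) (fun h => hz (congrArg _ h))]
    · rintro (x | x) -
      · obtain ⟨y, hxy, h⟩ := h₁.2 x
        exact ⟨Sum.inl y, trivial, fun h => hxy (Sum.inl_injective h), Sum.LiftRel.inl h⟩
      · obtain ⟨y, hxy, h⟩ := h₂.2 x
        exact ⟨Sum.inr y, trivial, fun h => hxy (Sum.inr_injective h), Sum.LiftRel.inr h⟩
  · rintro j s ⟨ih, ih'⟩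
    have hp := left_mem_remaining j
    have hq := right_mem_remaining j
    have hpq : (Sum.inl (Sum.inr j) : (Fin k ⊕ Fin k) ⊕ (Fin k ⊕ Fin k)) ≠ Sum.inr (Sum.inl j) :=
      by simp
    have hsucc := fun x => remaining_succ (j := j) (x := x)
    have hsucc' := fun x => mem_remaining_succ (j := j) (x := x)
    generalize Sum.inl (Sum.inr j) = p at *
    generalize Sum.inr (Sum.inl j) = q at *
    generalize remaining k (j + 1) = R' at *
    generalize remaining k j = R at *
    have ht : ∀ {x y z}, s x y → s y z → s x z := fun h h' => s.trans' h h'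
    have hs : ∀ {x y}, s x y → s y x := fun h => s.symm' h
    refine ⟨?_, ?_⟩
    · intro x hx y hy z hz hxy hxz hnxy hnxz
      obtain ⟨hx, hxp, hxq⟩ := hsucc _ hx
      obtain ⟨hy, hyp, hyq⟩ := hsucc _ hy
      obtain ⟨hz, hzp, hzq⟩ := hsucc _ hz
      rw [glue_iff] at hxy hxz
      rcases hxy with h | ⟨h, h'⟩ | ⟨h, h'⟩ <;> rcases hxz with g | ⟨g, g'⟩ | ⟨g, g'⟩
      · exact ih x hx y hy z hz h g hnxy hnxz
      · exact absurd (ih x hx y hy p hp h g hnxy hxp) hyp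
      · exact absurd (ih x hx y hy q hq h g hnxy hxq) hyq
      · exact absurd (ih x hx z hz p hp g h hnxz hxp) hzp
      · exact ih q hq y hy z hz h' g' hyq.symm hzq.symm
      · exact absurd (ih x hx p hp q hq h g hxp hxq) hpq
      · exact absurd (ih x hx z hz q hq g h hnxz hxq) hzq
      · exact absurd (ih x hx p hp q hq g h hxp hxq) hpq
      · exact ih p hp y hy z hz h' g' hyp.symm hzp.symm
    · intro x hx
      obtain ⟨hx, hxp, hxq⟩ := hsucc _ hx
      obtain ⟨y, hy, hxy, h⟩ := ih' x hx
      by_cases hyp : y = p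
      · subst hyp
        obtain ⟨z, hz, hqz, h'⟩ := ih' q hq
        have hzp : z ≠ y := by
          rintro rfl
          exact hxq (ih z hz x hx q hq (hs h) (hs h') hxy.symm hpq)
        have hzx : x ≠ z := by
          rintro rfl
          exact hpq (ih x hx y hy q hq h (hs h') hxy hxq)
        exact ⟨z, hsucc' z hz hzp hqz.symm, hzx, Or.inr (Or.inl ⟨h, h'⟩)⟩
      · by_cases hyq : y = q
        · subst hyq
          obtain ⟨z, hz, hqz, h'⟩ := ih' p hp
          have hzp : z ≠ y := by
            rintro rfl
            exact hxp (ih z hz x hx p hp (hs h) (hs h') hxy.symm hpq.symm)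
          have hzx : x ≠ z := by
            rintro rfl
            exact hpq (ih x hx y hy p hp h (hs h') hxy hxp).symm
          exact ⟨z, hsucc' z hz hqz.symm hzp, hzx, Or.inr (Or.inr ⟨h, h'⟩)⟩
        · exact ⟨y, hsucc' y hy hyp hyq, hxy, Or.inl h⟩

theorem IsRook.comp {d₁ d₂ : Diagram k} (h₁ : IsRook d₁) (h₂ : IsRook d₂) :
    IsRook (comp d₁ d₂) := by
  rw [isRook_iff] at h₁ h₂ ⊢
  let c : (Fin k ⊕ Fin k) ⊕ (Fin k ⊕ Fin k) → Bool := Sum.elim Sum.isLeft Sum.isLeft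
  have key := gluing_induction (d₁ := d₁) (d₂ := d₂)
    (Q := fun R s => ∀ x ∈ R, ∀ y ∈ R, c x = c y → s x y → x = y) ?_ ?_
  · constructor
    · intro i j h
      exact Sum.inl_injective (ends_injective
        (key _ (ends_mem _) _ (ends_mem _) rfl (comp_iff_gluing.1 h)))
    · intro i j h
      exact Sum.inr_injective (ends_injective
        (key _ (ends_mem _) _ (ends_mem _) rfl (comp_iff_gluing.1 h)))
  · rintro _ - _ - hc (⟨h⟩ | ⟨h⟩)
    · rename_i x y
      rcases x with x | x <;> rcases y with y | y
      · rw [h₁.1 _ _ h]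
      · simp [c] at hc
      · simp [c] at hc
      · rw [h₁.2 _ _ h]
    · rename_i x y
      rcases x with x | x <;> rcases y with y | y
      · rw [h₂.1 _ _ h]
      · simp [c] at hc
      · simp [c] at hc
      · rw [h₂.2 _ _ h]
  · intro j s ih x hx y hy hc hxy
    obtain ⟨hx, hxp, hxq⟩ := remaining_succ hx
    obtain ⟨hy, hyp, hyq⟩ := remaining_succ hy
    have hp := left_mem_remaining j
    have hq := right_mem_remaining j
    have hpc : c (Sum.inl (Sum.inr j)) = false := rfl
    have hqc : c (Sum.inr (Sum.inl j)) = true := rfl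
    have hs : ∀ {x y}, s x y → s y x := fun h => s.symm' h
    rw [glue_iff] at hxy
    rcases hxy with h | ⟨h, h'⟩ | ⟨h, h'⟩
    · exact ih x hx y hy hc h
    · cases hcx : c x
      · exact absurd (ih x hx _ hp (hcx.trans hpc.symm) h) hxp
      · exact absurd (ih y hy _ hq ((hc.symm.trans hcx).trans hqc.symm) (hs h')) hyq
    · cases hcx : c x
      · exact absurd (ih y hy _ hp ((hc.symm.trans hcx).trans hpc.symm) (hs h')) hyp
      · exact absurd (ih x hx _ hq (hcx.trans hqc.symm) h) hxq

theorem noncrossing_glue {V : Type*} {s : Setoid V} {R : Set V} {P : V → ℕ} {p q a b c e : V}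
    (ih : ∀ a b c e, a ∈ R → b ∈ R → c ∈ R → e ∈ R → P a < P b → P b < P c → P c < P e →
      s a c → s b e → s a b)
    (hp : p ∈ R) (hq : q ∈ R) (ha : a ∈ R) (hb : b ∈ R) (hc : c ∈ R) (he : e ∈ R)
    (hpq : P p < P q) (hab : P a < P b) (hbc : P b < P c) (hce : P c < P e)
    (ha' : P a < P p ∨ P q < P a) (hb' : P b < P p ∨ P q < P b)
    (hc' : P c < P p ∨ P q < P c) (he' : P e < P p ∨ P q < P e)
    (hac : glue s p q a c) (hbe : glue s p q b e) : glue s p q a b := by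
  have hf : ∀ x y, s x y ↔ Quotient.mk s x = Quotient.mk s y := fun x y => Quotient.eq.symm
  simp only [glue_iff, hf] at *
  generalize Quotient.mk s = f at *
  have six : ∀ x₁ x₂ x₃ x₄, x₁ ∈ R ∧ x₂ ∈ R ∧ x₃ ∈ R ∧ x₄ ∈ R →
      P x₁ < P x₂ ∧ P x₂ < P x₃ ∧ P x₃ < P x₄ →
      (f x₁ = f x₃ → f x₂ = f x₄ → f x₁ = f x₂) :=
    fun x₁ x₂ x₃ x₄ h h' => ih x₁ x₂ x₃ x₄ h.1 h.2.1 h.2.2.1 h.2.2.2 h'.1 h'.2.1 h'.2.2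
  clear ih hf
  have h1 := six a b c e ⟨ha, hb, hc, he⟩ ⟨hab, hbc, hce⟩
  rcases ha' with ha' | ha'
  · rcases hb' with hb' | hb'
    · rcases hc' with hc' | hc'
      · rcases he' with he' | he'
        · have g1 := six a b c p ⟨ha, hb, hc, hp⟩ (by omega)
          have g2 := six a b c q ⟨ha, hb, hc, hq⟩ (by omega)
          have g3 := six a b e p ⟨ha, hb, he, hp⟩ (by omega)
          have g4 := six a b e q ⟨ha, hb, he, hq⟩ (by omega)
          have g5 := six a b p q ⟨ha, hb, hp, hq⟩ (by omega)
          have g6 := six a c e p ⟨ha, hc, he, hp⟩ (by omega)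
          have g7 := six a c e q ⟨ha, hc, he, hq⟩ (by omega)
          have g8 := six a c p q ⟨ha, hc, hp, hq⟩ (by omega)
          have g9 := six a e p q ⟨ha, he, hp, hq⟩ (by omega)
          have g10 := six b c e p ⟨hb, hc, he, hp⟩ (by omega)
          have g11 := six b c e q ⟨hb, hc, he, hq⟩ (by omega)
          have g12 := six b c p q ⟨hb, hc, hp, hq⟩ (by omega)
          have g13 := six b e p q ⟨hb, he, hp, hq⟩ (by omega)
          have g14 := six c e p q ⟨hc, he, hp, hq⟩ (by omega)
          clear six
          grind
        · have g1 := six a b c p ⟨ha, hb, hc, hp⟩ (by omega)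
          have g2 := six a b c q ⟨ha, hb, hc, hq⟩ (by omega)
          have g3 := six a b p q ⟨ha, hb, hp, hq⟩ (by omega)
          have g4 := six a b p e ⟨ha, hb, hp, he⟩ (by omega)
          have g5 := six a b q e ⟨ha, hb, hq, he⟩ (by omega)
          have g6 := six a c p q ⟨ha, hc, hp, hq⟩ (by omega)
          have g7 := six a c p e ⟨ha, hc, hp, he⟩ (by omega)
          have g8 := six a c q e ⟨ha, hc, hq, he⟩ (by omega)
          have g9 := six a p q e ⟨ha, hp, hq, he⟩ (by omega)
          have g10 := six b c p q ⟨hb, hc, hp, hq⟩ (by omega)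
          have g11 := six b c p e ⟨hb, hc, hp, he⟩ (by omega)
          have g12 := six b c q e ⟨hb, hc, hq, he⟩ (by omega)
          have g13 := six b p q e ⟨hb, hp, hq, he⟩ (by omega)
          have g14 := six c p q e ⟨hc, hp, hq, he⟩ (by omega)
          clear six
          grind
      · have g1 := six a b p q ⟨ha, hb, hp, hq⟩ (by omega)
        have g2 := six a b p c ⟨ha, hb, hp, hc⟩ (by omega)
        have g3 := six a b p e ⟨ha, hb, hp, he⟩ (by omega)
        have g4 := six a b q c ⟨ha, hb, hq, hc⟩ (by omega)
        have g5 := six a b q e ⟨ha, hb, hq, he⟩ (by omega)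
        have g6 := six a p q c ⟨ha, hp, hq, hc⟩ (by omega)
        have g7 := six a p q e ⟨ha, hp, hq, he⟩ (by omega)
        have g8 := six a p c e ⟨ha, hp, hc, he⟩ (by omega)
        have g9 := six a q c e ⟨ha, hq, hc, he⟩ (by omega)
        have g10 := six b p q c ⟨hb, hp, hq, hc⟩ (by omega)
        have g11 := six b p q e ⟨hb, hp, hq, he⟩ (by omega)
        have g12 := six b p c e ⟨hb, hp, hc, he⟩ (by omega)
        have g13 := six b q c e ⟨hb, hq, hc, he⟩ (by omega)
        have g14 := six p q c e ⟨hp, hq, hc, he⟩ (by omega)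
        clear six
        grind
    · have g1 := six a p q b ⟨ha, hp, hq, hb⟩ (by omega)
      have g2 := six a p q c ⟨ha, hp, hq, hc⟩ (by omega)
      have g3 := six a p q e ⟨ha, hp, hq, he⟩ (by omega)
      have g4 := six a p b c ⟨ha, hp, hb, hc⟩ (by omega)
      have g5 := six a p b e ⟨ha, hp, hb, he⟩ (by omega)
      have g6 := six a p c e ⟨ha, hp, hc, he⟩ (by omega)
      have g7 := six a q b c ⟨ha, hq, hb, hc⟩ (by omega)
      have g8 := six a q b e ⟨ha, hq, hb, he⟩ (by omega)
      have g9 := six a q c e ⟨ha, hq, hc, he⟩ (by omega)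
      have g10 := six p q b c ⟨hp, hq, hb, hc⟩ (by omega)
      have g11 := six p q b e ⟨hp, hq, hb, he⟩ (by omega)
      have g12 := six p q c e ⟨hp, hq, hc, he⟩ (by omega)
      have g13 := six p b c e ⟨hp, hb, hc, he⟩ (by omega)
      have g14 := six q b c e ⟨hq, hb, hc, he⟩ (by omega)
      clear six
      grind
  · have g1 := six p q a b ⟨hp, hq, ha, hb⟩ (by omega)
    have g2 := six p q a c ⟨hp, hq, ha, hc⟩ (by omega)
    have g3 := six p q a e ⟨hp, hq, ha, he⟩ (by omega)
    have g4 := six p q b c ⟨hp, hq, hb, hc⟩ (by omega)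
    have g5 := six p q b e ⟨hp, hq, hb, he⟩ (by omega)
    have g6 := six p q c e ⟨hp, hq, hc, he⟩ (by omega)
    have g7 := six p a b c ⟨hp, ha, hb, hc⟩ (by omega)
    have g8 := six p a b e ⟨hp, ha, hb, he⟩ (by omega)
    have g9 := six p a c e ⟨hp, ha, hc, he⟩ (by omega)
    have g10 := six p b c e ⟨hp, hb, hc, he⟩ (by omega)
    have g11 := six q a b c ⟨hq, ha, hb, hc⟩ (by omega)
    have g12 := six q a b e ⟨hq, ha, hb, he⟩ (by omega)
    have g13 := six q a c e ⟨hq, ha, hc, he⟩ (by omega)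
    have g14 := six q b c e ⟨hq, hb, hc, he⟩ (by omega)
    clear six
    grind

theorem IsPlanar.comp {d₁ d₂ : Diagram k} (h₁ : IsPlanar d₁) (h₂ : IsPlanar d₂) :
    IsPlanar (comp d₁ d₂) := by
  let P : (Fin k ⊕ Fin k) ⊕ (Fin k ⊕ Fin k) → ℕ := Sum.elim pos (fun x => 2 * k + pos x)
  have hpos : ∀ x : Fin k ⊕ Fin k, pos x < 2 * k := by
    rintro (x | x) <;> simp only [pos, Sum.elim_inl, Sum.elim_inr] <;> omega
  have key := gluing_induction (d₁ := d₁) (d₂ := d₂)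
    (Q := fun R s => ∀ a ∈ R, ∀ b ∈ R, ∀ c ∈ R, ∀ e ∈ R, P a < P b → P b < P c → P c < P e →
      s a c → s b e → s a b) ?_ ?_
  · have hP : ∀ x y : Fin k ⊕ Fin k, pos x < pos y → P (ends x) < P (ends y) := by
      rintro (x | x) (y | y) h <;>
        simp only [P, ends, pos, Sum.map_inl, Sum.map_inr, Sum.elim_inl, Sum.elim_inr] at h ⊢ <;>
        omega
    intro a b c e hab hbc hce hac hbe
    exact comp_iff_gluing.2 (key _ (ends_mem a) _ (ends_mem b) _ (ends_mem c) _ (ends_mem e)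
      (hP _ _ hab) (hP _ _ hbc) (hP _ _ hce) (comp_iff_gluing.1 hac) (comp_iff_gluing.1 hbe))
  · rintro _ - _ - _ - _ - hab hbc hce (⟨hac⟩ | ⟨hac⟩) (⟨hbe⟩ | ⟨hbe⟩)
    · exact Sum.LiftRel.inl (h₁ _ _ _ _ hab hbc hce hac hbe)
    · rename_i a c b e
      have := hpos c
      simp only [P, Sum.elim_inl, Sum.elim_inr] at hbc
      omega
    · rename_i a c b e
      have := hpos e
      simp only [P, Sum.elim_inl, Sum.elim_inr] at hce
      omega
    · simp only [P, Sum.elim_inr] at hab hbc hce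
      exact Sum.LiftRel.inr (h₂ _ _ _ _ (by omega) (by omega) (by omega) hac hbe)
  · intro j s ih a ha b hb c hc e he hab hbc hce hac hbe
    have hadj : ∀ x ∈ remaining k (j + 1),
        P x < P (Sum.inl (Sum.inr j)) ∨ P (Sum.inr (Sum.inl j)) < P x := by
      rintro ((x | x) | (x | x)) hx <;>
        simp only [P, pos, Sum.elim_inl, Sum.elim_inr]
      · left; omega
      · by_cases hxj : (x : ℕ) < j + 1
        · exact absurd rfl (hx x hxj).1
        · left; omega
      · by_cases hxj : (x : ℕ) < j + 1
        · exact absurd rfl (hx x hxj).2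
        · right; omega
      · right; omega
    have hpq : P (Sum.inl (Sum.inr j)) < P (Sum.inr (Sum.inl j)) := by
      simp only [P, pos, Sum.elim_inl, Sum.elim_inr]; omega
    have ha' := hadj a ha
    have hb' := hadj b hb
    have hc' := hadj c hc
    have he' := hadj e he
    replace ha := (remaining_succ ha).1
    replace hb := (remaining_succ hb).1
    replace hc := (remaining_succ hc).1
    replace he := (remaining_succ he).1
    have hp := left_mem_remaining j
    have hq := right_mem_remaining j
    clear hadj
    rw [glue_iff] at hac hbe ⊢
    generalize Sum.inl (Sum.inr j) = p at *
    generalize Sum.inr (Sum.inl j) = q at *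
    exact noncrossing_glue (fun a b c e ha hb hc he => ih a ha b hb c hc e he) hp hq ha hb hc he
      hpq hab hbc hce ha' hb' hc' he' hac hbe

end DiagramAlgebras

namespace DiagramAlgebras

variable {k : ℕ} {n : ℂ}

/-! ### The algebras `A_k` -/

theorem Kind.comp_mem (X : Kind) {d₁ d₂ : Diagram k} (h₁ : d₁ ∈ X.diagrams k)
    (h₂ : d₂ ∈ X.diagrams k) : comp d₁ d₂ ∈ X.diagrams k := by
  cases X
  · trivial
  · exact IsBrauer.comp h₁ h₂
  · exact IsRookBrauer.comp h₁ h₂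
  · exact IsRook.comp h₁ h₂
  · exact ⟨IsBrauer.comp h₁.1 h₂.1, IsPlanar.comp h₁.2 h₂.2⟩
  · exact ⟨IsRookBrauer.comp h₁.1 h₂.1, IsPlanar.comp h₁.2 h₂.2⟩
  · exact ⟨IsRook.comp h₁.1 h₂.1, IsPlanar.comp h₁.2 h₂.2⟩

theorem IsRookBrauer.transpose {d : Diagram k} (h : IsRookBrauer d) :
    IsRookBrauer (transpose d) := by
  rw [isRookBrauer_iff] at h ⊢
  intro x y z hy hz hxy hxz
  have hs := (Sum.swap_leftInverse (α := Fin k) (β := Fin k)).injective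
  exact hs (h _ _ _ hy hz (hs.ne hxy) (hs.ne hxz))

theorem IsBrauer.transpose {d : Diagram k} (h : IsBrauer d) : IsBrauer (transpose d) := by
  have h1 := h.isRookBrauer.transpose
  rw [isRookBrauer_iff] at h1
  rw [isBrauer_iff] at h ⊢
  refine ⟨h1, fun x => ?_⟩
  obtain ⟨y, hy, h2⟩ := h.2 x.swap
  refine ⟨y.swap, fun hxy => hy ?_, ?_⟩
  · rw [hxy, Sum.swap_swap]
  · change d _ _
    rwa [Sum.swap_swap]

theorem IsRook.transpose {d : Diagram k} (h : IsRook d) : IsRook (transpose d) := by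
  rw [isRook_iff] at h ⊢
  exact ⟨fun i j hij => h.2 i j hij, fun i j hij => h.1 i j hij⟩

theorem IsPlanar.transpose {d : Diagram k} (h : IsPlanar d) : IsPlanar (transpose d) := by
  have hp : ∀ x y : Fin k ⊕ Fin k, pos x < pos y → pos y.swap < pos x.swap := by
    rintro (x | x) (y | y) hxy <;>
      simp only [pos, Sum.elim_inl, Sum.elim_inr, Sum.swap_inl, Sum.swap_inr] at hxy ⊢ <;> omega
  intro a b c e hab hbc hce hac hbe
  have h1 := h _ _ _ _ (hp _ _ hce) (hp _ _ hbc) (hp _ _ hab) (d.symm' hbe) (d.symm' hac)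
  exact d.symm' (d.trans' (d.trans' hbe h1) (d.symm' hac))

theorem Kind.transpose_mem (X : Kind) {d : Diagram k} (h : d ∈ X.diagrams k) :
    transpose d ∈ X.diagrams k := by
  cases X
  · trivial
  · exact IsBrauer.transpose h
  · exact IsRookBrauer.transpose h
  · exact IsRook.transpose h
  · exact ⟨IsBrauer.transpose h.1, IsPlanar.transpose h.2⟩
  · exact ⟨IsRookBrauer.transpose h.1, IsPlanar.transpose h.2⟩
  · exact ⟨IsRook.transpose h.1, IsPlanar.transpose h.2⟩

/-- The diagram of the permutation `σ` of the first `m` of `k` vertices: the vertex `j'` of the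
bottom row is joined to the vertex `σ(j)` of the top row, and `j'` is joined to `j` for the
remaining `j`. -/
@[reducible] def permDiagram (k : ℕ) {m : ℕ} (σ : Equiv.Perm (Fin m)) : Diagram k :=
  Setoid.ker (Sum.elim (fun i => (i : ℕ)) fun j => if h : (j : ℕ) < m then (σ ⟨j, h⟩ : ℕ) else j)

/-- The diagram with blocks `{i, i'}` for the first `m` vertices and singletons otherwise. -/
@[reducible] def isolatedDiagram (k m : ℕ) : Diagram k :=
  Setoid.ker (Sum.elim (fun i => ((i : ℕ), 0)) fun i => if (i : ℕ) < m then ((i : ℕ), 0) else (i, 1))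

/-- The diagram with blocks `{i, i'}` for the first `m` vertices, in which the remaining vertices
of each row are paired with their neighbours: the first with the second, and so on. -/
@[reducible] def pairedDiagram (k m : ℕ) : Diagram k :=
  Setoid.ker (Sum.elim
    (fun i => if (i : ℕ) < m then ((i : ℕ), 0) else ((i - m) / 2, 1))
    (fun i => if (i : ℕ) < m then ((i : ℕ), 0) else ((i - m) / 2, 2)))

/-- The diagram of `e_m`. -/
@[reducible] def Kind.idempotentDiagram (X : Kind) (k m : ℕ) : Diagram k :=
  if X.matching then pairedDiagram k m else isolatedDiagram k m

theorem isBrauer_ker {α : Type*} {f g : Fin k → α} (hf : Function.Injective f)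
    (hg : Function.Injective g) (hfg : ∀ i, ∃ j, f i = g j) (hgf : ∀ j, ∃ i, g j = f i) :
    IsBrauer (Setoid.ker (Sum.elim f g)) := by
  rw [isBrauer_iff]
  constructor
  · rintro (x | x) (y | y) (z | z) hy hz hxy hxz <;>
      simp only [Setoid.ker_def, Sum.elim_inl, Sum.elim_inr] at hy hz
    · exact absurd (congrArg _ (hf hy)) hxy
    · exact absurd (congrArg _ (hf hy)) hxy
    · exact absurd (congrArg _ (hf hz)) hxz
    · rw [hg (hy.symm.trans hz)]
    · rw [hf (hy.symm.trans hz)]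
    · exact absurd (congrArg _ (hg hz)) hxz
    · exact absurd (congrArg _ (hg hy)) hxy
    · exact absurd (congrArg _ (hg hy)) hxy
  · rintro (x | x)
    · obtain ⟨j, hj⟩ := hfg x
      exact ⟨Sum.inr j, by simp, hj⟩
    · obtain ⟨j, hj⟩ := hgf x
      exact ⟨Sum.inl j, by simp, hj⟩

theorem isRook_ker {α : Type*} {f g : Fin k → α} (hf : Function.Injective f)
    (hg : Function.Injective g) : IsRook (Setoid.ker (Sum.elim f g)) := by
  rw [isRook_iff]
  exact ⟨fun i j h => hf h, fun i j h => hg h⟩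

theorem IsRook.isRookBrauer {d : Diagram k} (h : IsRook d) : IsRookBrauer d := by
  rw [isRook_iff] at h
  rw [isRookBrauer_iff]
  rintro (x | x) (y | y) (z | z) hy hz hxy hxz
  · exact absurd (congrArg _ (h.1 _ _ hy)) hxy
  · exact absurd (congrArg _ (h.1 _ _ hy)) hxy
  · exact absurd (congrArg _ (h.1 _ _ hz)) hxz
  · rw [h.2 _ _ (d.trans' (d.symm' hy) hz)]
  · rw [h.1 _ _ (d.trans' (d.symm' hy) hz)]
  · exact absurd (congrArg _ (h.2 _ _ hz)) hxz
  · exact absurd (congrArg _ (h.2 _ _ hy)) hxy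
  · exact absurd (congrArg _ (h.2 _ _ hy)) hxy

theorem isPlanar_of_chords {d : Diagram k} (h : ∀ x y, d x y → pos x < pos y →
    pos x + pos y = 2 * k - 1 ∨ pos y = pos x + 1) : IsPlanar d := by
  intro a b c e hab hbc hce hac hbe
  have h1 := h _ _ hac (by omega)
  have h2 := h _ _ hbe (by omega)
  omega

theorem isPlanar_idDiagram : IsPlanar (idDiagram k) := by
  refine isPlanar_of_chords ?_
  rintro (a | a) (b | b) h hlt <;>
    simp only [pos, Sum.elim_inl, Sum.elim_inr, Setoid.ker_def, id_eq] at h hlt ⊢ <;>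
    subst h <;> omega

theorem Kind.idDiagram_mem (X : Kind) : idDiagram k ∈ X.diagrams k := by
  have hb : IsBrauer (idDiagram k) :=
    isBrauer_ker Function.injective_id Function.injective_id (fun i => ⟨i, rfl⟩)
      (fun i => ⟨i, rfl⟩)
  have hr : IsRook (idDiagram k) := isRook_ker Function.injective_id Function.injective_id
  cases X
  · trivial
  · exact hb
  · exact hb.isRookBrauer
  · exact hr
  · exact ⟨hb, isPlanar_idDiagram⟩
  · exact ⟨hb.isRookBrauer, isPlanar_idDiagram⟩
  · exact ⟨hr, isPlanar_idDiagram⟩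

theorem Kind.permDiagram_mem (X : Kind) (hX : X.planar = false) {m : ℕ} (hm : m ≤ k)
    (σ : Equiv.Perm (Fin m)) : permDiagram k σ ∈ X.diagrams k := by
  have hf : Function.Injective fun i : Fin k => (i : ℕ) := Fin.val_injective
  have hg : Function.Injective fun j : Fin k =>
      if h : (j : ℕ) < m then (σ ⟨j, h⟩ : ℕ) else (j : ℕ) := by
    intro i j hij
    dsimp only at hij
    split_ifs at hij with h1 h2 h2
    · have := σ.injective (Fin.val_injective hij)
      simpa [Fin.ext_iff] using this
    · have := (σ ⟨i, h1⟩).2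
      omega
    · have := (σ ⟨j, h2⟩).2
      omega
    · exact Fin.ext hij
  have hb : IsBrauer (permDiagram k σ) := by
    refine isBrauer_ker hf hg (fun i => ?_) (fun j => ?_)
    · by_cases h : (i : ℕ) < m
      · have h2 := (σ.symm ⟨i, h⟩).2
        refine ⟨⟨σ.symm ⟨i, h⟩, by omega⟩, ?_⟩
        simp
      · exact ⟨i, by simp [h]⟩
    · by_cases h : (j : ℕ) < m
      · have h2 := (σ ⟨j, h⟩).2
        exact ⟨⟨σ ⟨j, h⟩, by omega⟩, by simp [h]⟩
      · exact ⟨j, by simp [h]⟩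
  cases X
  · trivial
  · exact hb
  · exact hb.isRookBrauer
  · exact isRook_ker hf hg
  all_goals simp [Kind.planar] at hX

theorem Kind.idempotentDiagram_mem (X : Kind) {m : ℕ}
    (hX : X.matching = true → Even (k - m)) : X.idempotentDiagram k m ∈ X.diagrams k := by
  have key1 : IsRook (isolatedDiagram k m) ∧ IsPlanar (isolatedDiagram k m) := by
    constructor
    · apply isRook_ker
      · intro i j hij
        simpa [Fin.ext_iff] using hij
      · intro i j hij
        dsimp only at hij
        split_ifs at hij <;> simp only [Prod.mk.injEq] at hij <;> omega
    · refine isPlanar_of_chords ?_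
      rintro (a | a) (b | b) h hlt <;>
        simp only [pos, Sum.elim_inl, Sum.elim_inr, Setoid.ker_def] at h hlt ⊢ <;>
        (try split_ifs at h) <;> simp only [Prod.mk.injEq] at h <;> omega
  have key2 : Even (k - m) → IsBrauer (pairedDiagram k m) ∧ IsPlanar (pairedDiagram k m) := by
    rintro ⟨l, hl⟩
    constructor
    · rw [isBrauer_iff]
      constructor
      · rintro (a | a) (b | b) (c | c) h1 h2 h3 h4 <;>
          simp only [Sum.elim_inl, Sum.elim_inr, Setoid.ker_def, ne_eq, Sum.inl.injEq,
            Sum.inr.injEq, Fin.ext_iff, reduceCtorEq, not_false_eq_true] at h1 h2 h3 h4 ⊢ <;>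
          split_ifs at h1 h2 <;> simp only [Prod.mk.injEq] at h1 h2 <;> omega
      · have hn : ∀ a : Fin k, ¬ (a : ℕ) < m → ∃ b : Fin k, a ≠ b ∧ ¬ (b : ℕ) < m ∧
            ((a : ℕ) - m) / 2 = (b - m) / 2 := by
          intro a ha
          rcases Nat.even_or_odd' ((a : ℕ) - m) with ⟨c, hc | hc⟩
          · refine ⟨⟨a + 1, by omega⟩, ?_, ?_, ?_⟩
            · simp [Fin.ext_iff]
            · simp only; omega
            · simp only; omega
          · refine ⟨⟨a - 1, by omega⟩, ?_, ?_, ?_⟩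
            · simp only [ne_eq, Fin.ext_iff]; omega
            · simp only; omega
            · simp only; omega
        rintro (a | a)
        · by_cases ha : (a : ℕ) < m
          · exact ⟨Sum.inr a, by simp, by simp [Setoid.ker_def, ha]⟩
          · obtain ⟨b, hab, hb, h⟩ := hn a ha
            exact ⟨Sum.inl b, by simpa using hab, by simp [Setoid.ker_def, ha, hb, h]⟩
        · by_cases ha : (a : ℕ) < m
          · exact ⟨Sum.inl a, by simp, by simp [Setoid.ker_def, ha]⟩
          · obtain ⟨b, hab, hb, h⟩ := hn a ha
            exact ⟨Sum.inr b, by simpa using hab, by simp [Setoid.ker_def, ha, hb, h]⟩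
    · refine isPlanar_of_chords ?_
      rintro (a | a) (b | b) h hlt <;>
        simp only [pos, Sum.elim_inl, Sum.elim_inr, Setoid.ker_def] at h hlt ⊢ <;>
        (try split_ifs at h) <;> simp only [Prod.mk.injEq] at h <;> omega
  cases X
  · trivial
  · exact (key2 (hX rfl)).1
  · exact key1.1.isRookBrauer
  · exact key1.1
  · exact key2 (hX rfl)
  · exact ⟨key1.1.isRookBrauer, key1.2⟩
  · exact key1

/-- The diagram algebra `A_k ⊆ P_k(n)`: the span of the diagrams in `𝒜_k`. -/
noncomputable def Kind.algebra (X : Kind) (k : ℕ) (n : ℂ) :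
    Subalgebra ℂ (PartitionAlgebra k n) where
  carrier := Submodule.span ℂ (diag n '' X.diagrams k)
  add_mem' := fun ha hb => Submodule.add_mem _ ha hb
  mul_mem' := by
    intro a b ha hb
    refine Submodule.span_induction₂ (p := fun a b _ _ =>
      a * b ∈ Submodule.span ℂ (diag n '' X.diagrams k)) ?_ ?_ ?_ ?_ ?_ ?_ ?_ ha hb
    · rintro _ _ ⟨d₁, h₁, rfl⟩ ⟨d₂, h₂, rfl⟩
      rw [diag_mul_diag]
      exact Submodule.smul_mem _ _ (Submodule.subset_span ⟨_, X.comp_mem h₁ h₂, rfl⟩)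
    · intro y _
      rw [zero_mul]
      exact Submodule.zero_mem _
    · intro y _
      rw [mul_zero]
      exact Submodule.zero_mem _
    · intro x y z _ _ _ h h'
      rw [add_mul]
      exact Submodule.add_mem _ h h'
    · intro x y z _ _ _ h h'
      rw [mul_add]
      exact Submodule.add_mem _ h h'
    · intro r x y _ _ h
      rw [smul_mul_assoc]
      exact Submodule.smul_mem _ _ h
    · intro r x y _ _ h
      rw [mul_smul_comm]
      exact Submodule.smul_mem _ _ h
  algebraMap_mem' := fun r => by
    rw [Algebra.algebraMap_eq_smul_one]
    exact Submodule.smul_mem _ _ (Submodule.subset_span ⟨_, X.idDiagram_mem, rfl⟩)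

theorem Kind.diag_mem (X : Kind) {d : Diagram k} (hd : d ∈ X.diagrams k) :
    diag n d ∈ X.algebra k n := Submodule.subset_span ⟨d, hd, rfl⟩

/-! ### Rank and the ideals -/

/-- The rank (propagating number): the number of blocks that meet both rows. -/
noncomputable def rank (d : Diagram k) : ℕ :=
  Nat.card {c : Quotient d //
    (∃ i, Quotient.mk d (Sum.inl i) = c) ∧ ∃ j, Quotient.mk d (Sum.inr j) = c}

theorem exists_bottom_of_comp {d₁ d₂ : Diagram k} {i j : Fin k}
    (h : comp d₁ d₂ (Sum.inl i) (Sum.inr j)) : ∃ y, d₂ (Sum.inl y) (Sum.inr j) := by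
  by_contra hn
  push Not at hn
  -- otherwise the component of `j'` is the block of `j'` in `d₂`
  have hle := stack_le (d₁ := d₁) (d₂ := d₂) (s := Setoid.ker
    (Sum.elim (fun _ => False) (fun x => d₂ x (Sum.inr j)) : Fin k ⊕ (Fin k ⊕ Fin k) → Prop))
    ?_ ?_ h
  · have h1 : False = d₂ (Sum.inr j) (Sum.inr j) := hle
    exact h1 ▸ d₂.refl' _
  · have h1 : ∀ a : Fin k ⊕ Fin k, (Sum.elim (fun _ => False) (fun x => d₂ x (Sum.inr j)) :
        Fin k ⊕ (Fin k ⊕ Fin k) → Prop) (upper a) = False := by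
      rintro (a | a)
      · rfl
      · exact eq_false (hn a)
    intro a b _
    rw [Setoid.ker_def, h1, h1]
  · intro a b hab
    exact propext ⟨fun h => d₂.trans' (d₂.symm' hab) h, fun h => d₂.trans' hab h⟩

theorem rank_comp_le_right (d₁ d₂ : Diagram k) : rank (comp d₁ d₂) ≤ rank d₂ := by
  refine Nat.card_le_card_of_injective
    (fun c => ⟨Quotient.mk d₂ (Sum.inr c.2.2.choose), ?_, ⟨_, rfl⟩⟩) ?_
  · obtain ⟨i, hi⟩ := c.2.1
    obtain ⟨y, hy⟩ := exists_bottom_of_comp (Quotient.exact (hi.trans c.2.2.choose_spec.symm))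
    exact ⟨y, Quotient.sound hy⟩
  · intro c c' h
    have h1 := Quotient.exact (congrArg Subtype.val h)
    apply Subtype.ext
    rw [← c.2.2.choose_spec, ← c'.2.2.choose_spec]
    exact Quotient.sound (s := comp d₁ d₂) (stack_lower h1)

/-- The ideal `J_{m-1}` of `A_k`: the span of the diagrams in `𝒜_k` of rank at most `m - 1`, that
is, less than `m` (so it is zero for `m = 0`). It is a left ideal, hence an `A_k`-submodule. -/
noncomputable def Kind.ideal (X : Kind) (k : ℕ) (n : ℂ) (m : ℕ) : Ideal (X.algebra k n) where
  carrier := {a | (a : PartitionAlgebra k n) ∈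
    Submodule.span ℂ (diag n '' {d | d ∈ X.diagrams k ∧ rank d < m})}
  zero_mem' := Submodule.zero_mem
    (Submodule.span ℂ (diag n '' {d | d ∈ X.diagrams k ∧ rank d < m}))
  add_mem' := fun ha hb => Submodule.add_mem
    (Submodule.span ℂ (diag n '' {d | d ∈ X.diagrams k ∧ rank d < m})) ha hb
  smul_mem' := by
    rintro ⟨a, ha⟩ ⟨b, hb'⟩ hb
    change a * b ∈ Submodule.span ℂ (diag n '' {d | d ∈ X.diagrams k ∧ rank d < m})
    refine Submodule.span_induction₂ (p := fun a b _ _ =>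
      a * b ∈ Submodule.span ℂ (diag n '' {d | d ∈ X.diagrams k ∧ rank d < m}))
      ?_ ?_ ?_ ?_ ?_ ?_ ?_ ha hb
    · rintro _ _ ⟨d₁, h₁, rfl⟩ ⟨d₂, ⟨h₂, h₃⟩, rfl⟩
      rw [diag_mul_diag]
      exact Submodule.smul_mem _ _ (Submodule.subset_span
        ⟨_, ⟨X.comp_mem h₁ h₂, (rank_comp_le_right d₁ d₂).trans_lt h₃⟩, rfl⟩)
    · intro y _
      rw [zero_mul]
      exact Submodule.zero_mem _
    · intro y _
      rw [mul_zero]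
      exact Submodule.zero_mem _
    · intro x y z _ _ _ h h'
      rw [add_mul]
      exact Submodule.add_mem _ h h'
    · intro x y z _ _ _ h h'
      rw [mul_add]
      exact Submodule.add_mem _ h h'
    · intro r x y _ _ h
      rw [smul_mul_assoc]
      exact Submodule.smul_mem _ _ h
    · intro r x y _ _ h
      rw [mul_smul_comm]
      exact Submodule.smul_mem _ _ h

/-! ### Symmetric diagrams and conjugation -/

/-- The maximal entries, in the top row, of the propagating blocks. -/
noncomputable def propMax (d : Diagram k) : Finset (Fin k) :=
  open Classical in Finset.univ.filter fun i =>
    (∃ j, d (Sum.inl i) (Sum.inr j)) ∧ ∀ j, d (Sum.inl i) (Sum.inl j) → j ≤ i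

theorem mem_propMax {d : Diagram k} {i : Fin k} : i ∈ propMax d ↔
    (∃ j, d (Sum.inl i) (Sum.inr j)) ∧ ∀ j, d (Sum.inl i) (Sum.inl j) → j ≤ i := by
  simp [propMax]

theorem exists_propMax {d : Diagram k} {i j : Fin k} (h : d (Sum.inl i) (Sum.inr j)) :
    ∃ l ∈ propMax d, d (Sum.inl l) (Sum.inl i) := by
  classical
  have hne : (Finset.univ.filter fun l => d (Sum.inl i) (Sum.inl l)).Nonempty :=
    ⟨i, by simp⟩
  obtain ⟨l, hl, hmax⟩ := Finset.exists_max_image _ id hne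
  simp only [Finset.mem_filter, Finset.mem_univ, true_and, id_eq] at hl hmax
  exact ⟨l, mem_propMax.2 ⟨⟨j, d.trans' (d.symm' hl) h⟩, fun y hy => hmax y (d.trans' hl hy)⟩,
    d.symm' hl⟩

theorem propMax_unique {d : Diagram k} {i j : Fin k} (hi : i ∈ propMax d) (hj : j ∈ propMax d)
    (h : d (Sum.inl i) (Sum.inl j)) : i = j :=
  le_antisymm ((mem_propMax.1 hj).2 i (d.symm' h)) ((mem_propMax.1 hi).2 j h)

theorem card_propMax (d : Diagram k) : (propMax d).card = rank d := by
  rw [rank, ← Nat.card_eq_finsetCard]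
  refine Nat.card_congr (Equiv.ofBijective (fun i => ⟨Quotient.mk d (Sum.inl i.1), ⟨_, rfl⟩, ?_⟩)
    ⟨?_, ?_⟩)
  · obtain ⟨j, hj⟩ := (mem_propMax.1 i.2).1
    exact ⟨j, Quotient.sound (d.symm' hj)⟩
  · intro i j h
    exact Subtype.ext (propMax_unique i.2 j.2 (Quotient.exact (congrArg Subtype.val h)))
  · rintro ⟨c, ⟨i, hi⟩, ⟨j, hj⟩⟩
    obtain ⟨l, hl, hli⟩ := exists_propMax (Quotient.exact (hi.trans hj.symm))
    exact ⟨⟨l, hl⟩, Subtype.ext ((Quotient.sound hli).trans hi)⟩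

/-- `w` is a symmetric `m`-diagram: it is equal to its reflection, it has rank `m`, and each of its
propagating blocks joins its part in the top row to the mirror image of this part. -/
structure IsSymmetricDiagram (m : ℕ) (w : Diagram k) : Prop where
  symm : transpose w = w
  rank_eq : rank w = m
  mirror : ∀ i j, w (Sum.inl i) (Sum.inr j) → w (Sum.inl i) (Sum.inr i)

/-- The set of the symmetric `m`-diagrams in `𝒜_k`. -/
def Kind.symmetricDiagrams (X : Kind) (k m : ℕ) : Set (Diagram k) :=
  {w | w ∈ X.diagrams k ∧ IsSymmetricDiagram m w}

/-- The conjugate `d ∘ w ∘ dᵀ`. -/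
@[reducible] def conj (d w : Diagram k) : Diagram k := comp (comp d w) (transpose d)

theorem transpose_transpose (d : Diagram k) : transpose (transpose d) = d := by
  ext x y
  change d x.swap.swap y.swap.swap ↔ _
  rw [Sum.swap_swap, Sum.swap_swap]

theorem comp_transpose (d₁ d₂ : Diagram k) :
    transpose (comp d₁ d₂) = comp (transpose d₂) (transpose d₁) := by
  have key : ∀ (d₁ d₂ : Diagram k) x y, comp d₁ d₂ x y →
      comp (transpose d₂) (transpose d₁) x.swap y.swap := by
    intro d₁ d₂ x y h
    -- turn the three rows upside down
    let f : Fin k ⊕ (Fin k ⊕ Fin k) → Fin k ⊕ (Fin k ⊕ Fin k) :=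
      Sum.elim (fun i => Sum.inr (Sum.inr i)) (Sum.elim (fun i => Sum.inr (Sum.inl i)) Sum.inl)
    have h1 := stack_le (s := (stack (transpose d₂) (transpose d₁)).comap f) (d₁ := d₁) (d₂ := d₂)
      ?_ ?_ h
    · rcases x with x | x <;> rcases y with y | y <;> exact h1
    · intro a b hab
      have h2 : transpose d₁ a.swap b.swap := by
        change d₁ a.swap.swap b.swap.swap
        rwa [Sum.swap_swap, Sum.swap_swap]
      have h3 := stack_lower (d₁ := transpose d₂) h2
      rcases a with a | a <;> rcases b with b | b <;> exact h3
    · intro a b hab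
      have h2 : transpose d₂ a.swap b.swap := by
        change d₂ a.swap.swap b.swap.swap
        rwa [Sum.swap_swap, Sum.swap_swap]
      have h3 := stack_upper (d₂ := transpose d₁) h2
      rcases a with a | a <;> rcases b with b | b <;> exact h3
  ext x y
  constructor
  · intro h
    have := key d₁ d₂ _ _ h
    rwa [Sum.swap_swap, Sum.swap_swap] at this
  · intro h
    have := key (transpose d₂) (transpose d₁) _ _ h
    rwa [transpose_transpose, transpose_transpose] at this

theorem exists_top_of_comp {d₁ d₂ : Diagram k} {i j : Fin k}
    (h : comp d₁ d₂ (Sum.inl i) (Sum.inr j)) : ∃ y, d₁ (Sum.inl i) (Sum.inr y) := by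
  have h1 : transpose (comp d₁ d₂) (Sum.inl j) (Sum.inr i) := (comp d₁ d₂).symm' h
  rw [comp_transpose] at h1
  obtain ⟨y, hy⟩ := exists_bottom_of_comp h1
  exact ⟨y, d₁.symm' hy⟩

theorem comp_mono {d₁ d₁' d₂ d₂' : Diagram k} (h₁ : ∀ x y, d₁ x y → d₁' x y)
    (h₂ : ∀ x y, d₂ x y → d₂' x y) {x y} (h : comp d₁ d₂ x y) : comp d₁' d₂' x y :=
  stack_le (s := stack d₁' d₂') (fun a b hab => stack_upper (h₁ a b hab))
    (fun a b hab => stack_lower (h₂ a b hab)) h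

theorem IsSymmetricDiagram.swap {m : ℕ} {w : Diagram k} (hw : IsSymmetricDiagram m w) {x y}
    (h : w x y) : w x.swap y.swap := by
  rw [← hw.symm]
  change w x.swap.swap y.swap.swap
  rwa [Sum.swap_swap, Sum.swap_swap]

theorem IsSymmetricDiagram.comp_self {m : ℕ} {w : Diagram k} (hw : IsSymmetricDiagram m w) {x y}
    (h : comp w w x y) : w x y := by
  have h1 := stack_le (s := w.comap (Sum.elim Sum.inl id)) (d₁ := w) (d₂ := w) ?_ ?_ h
  · rcases x with x | x <;> rcases y with y | y <;> exact h1
  · have hfold : ∀ i j, w (Sum.inl i) (Sum.inr j) → w (Sum.inl i) (Sum.inl j) := by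
      intro i j hij
      exact w.trans' (hw.mirror i j hij) (hw.swap hij)
    rintro (a | a) (b | b) hab
    · exact hab
    · exact hfold a b hab
    · exact w.symm' (hfold b a (w.symm' hab))
    · exact hw.swap hab
  · intro a b hab
    exact hab

theorem conj_symm {m : ℕ} {d w : Diagram k} (hw : IsSymmetricDiagram m w) :
    transpose (conj d w) = conj d w := by
  rw [comp_transpose, comp_transpose, transpose_transpose, hw.symm, conj, comp_assoc]

theorem conj_mirror {m : ℕ} {d w : Diagram k} (hw : IsSymmetricDiagram m w) {i j : Fin k}
    (h : conj d w (Sum.inl i) (Sum.inr j)) : conj d w (Sum.inl i) (Sum.inr i) := by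
  obtain ⟨x, hx⟩ := exists_top_of_comp h
  have h1 : comp (comp d w) (transpose (comp d w)) (Sum.inl i) (Sum.inr i) :=
    (stack _ _).trans' (stack_upper hx)
      (stack_lower (d₁ := comp d w) (d₂ := transpose (comp d w)) (a := Sum.inl x) (b := Sum.inr i)
        ((comp d w).symm' hx))
  rw [comp_transpose, hw.symm, comp_assoc, ← comp_assoc w, ← comp_assoc] at h1
  exact comp_mono (fun x y h => comp_mono (fun _ _ h => h) (fun _ _ h => hw.comp_self h) h)
    (fun _ _ h => h) h1

theorem Kind.conj_mem (X : Kind) {m : ℕ} {d w : Diagram k} (hd : d ∈ X.diagrams k)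
    (hw : w ∈ X.symmetricDiagrams k m) (h : rank (conj d w) = m) :
    conj d w ∈ X.symmetricDiagrams k m :=
  ⟨X.comp_mem (X.comp_mem hd hw.1) (X.transpose_mem hd), conj_symm hw.2, h,
    fun _ _ h => conj_mirror hw.2 h⟩

/-! ### The twist -/

/-- The `i`-th propagating block of a diagram of rank `m`, in max-entry order, represented by its
maximal entry in the top row. -/
noncomputable def blockMax {m : ℕ} (w : Diagram k) (h : rank w = m) : Fin m ↪o Fin k :=
  (propMax w).orderEmbOfFin ((card_propMax w).trans h)

/-- `σ` is the permutation of the propagating blocks of the symmetric diagram `w` induced by `d`: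
the `i`-th propagating block of `w` is sent to the `σ(i)`-th propagating block of `d ∘ w ∘ dᵀ`, that
is, in `d ∘ w` the bottom vertices of the former are connected to the top vertices of the latter. -/
def IsTwist {m : ℕ} (d w : Diagram k) (hw : rank w = m) (h : rank (conj d w) = m)
    (σ : Equiv.Perm (Fin m)) : Prop :=
  ∀ i, comp d w (Sum.inl (blockMax (conj d w) h (σ i))) (Sum.inr (blockMax w hw i))

theorem exists_isTwist {m : ℕ} {d w : Diagram k} (hw : IsSymmetricDiagram m w)
    (h : rank (conj d w) = m) : ∃ σ, IsTwist d w hw.rank_eq h σ := by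
  have hex : ∀ j : Fin m, ∃ i : Fin m, comp d w (Sum.inl (blockMax (conj d w) h j))
      (Sum.inr (blockMax w hw.rank_eq i)) := by
    intro j
    have hj := Finset.orderEmbOfFin_mem (propMax (conj d w)) ((card_propMax _).trans h) j
    obtain ⟨y, hy⟩ := (mem_propMax.1 hj).1
    obtain ⟨x, hx⟩ := exists_top_of_comp hy
    obtain ⟨z, hz⟩ := exists_bottom_of_comp hx
    have hx1 : w (Sum.inl x) (Sum.inr z) := hw.swap (w.symm' hz)
    obtain ⟨l, hl, hlx⟩ := exists_propMax hx1
    have hl' : l ∈ Set.range (blockMax w hw.rank_eq) := by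
      rw [blockMax, Finset.range_orderEmbOfFin]
      exact hl
    obtain ⟨i, rfl⟩ := hl'
    exact ⟨i, (comp d w).trans' hx (stack_lower (hw.swap (w.symm' hlx)))⟩
  choose τ hτ using hex
  have hinj : Function.Injective τ := by
    intro j j' hjj
    have h1 := hτ j
    rw [hjj] at h1
    have h2 : conj d w (Sum.inl (blockMax (conj d w) h j)) (Sum.inl (blockMax (conj d w) h j')) :=
      stack_upper ((comp d w).trans' h1 ((comp d w).symm' (hτ j')))
    exact (blockMax (conj d w) h).injective (propMax_unique (Finset.orderEmbOfFin_mem _ _ j)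
      (Finset.orderEmbOfFin_mem _ _ j') h2)
  refine ⟨(Equiv.ofBijective τ (Finite.injective_iff_bijective.1 hinj)).symm, fun i => ?_⟩
  have h1 := hτ ((Equiv.ofBijective τ (Finite.injective_iff_bijective.1 hinj)).symm i)
  have h2 := Equiv.apply_symm_apply
    (Equiv.ofBijective τ (Finite.injective_iff_bijective.1 hinj)) i
  rw [Equiv.ofBijective_apply] at h2
  rwa [h2] at h1

/-- The twist `σ_{d,w}` of the conjugation of `w` by `d`. -/
noncomputable def twist {m : ℕ} {d w : Diagram k} (hw : IsSymmetricDiagram m w)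
    (h : rank (conj d w) = m) : Equiv.Perm (Fin m) := (exists_isTwist hw h).choose

theorem isTwist_twist {m : ℕ} {d w : Diagram k} (hw : IsSymmetricDiagram m w)
    (h : rank (conj d w) = m) : IsTwist d w hw.rank_eq h (twist hw h) :=
  (exists_isTwist hw h).choose_spec

theorem IsTwist.eq_twist {m : ℕ} {d w : Diagram k} (hw : IsSymmetricDiagram m w)
    (h : rank (conj d w) = m) {σ : Equiv.Perm (Fin m)} (hσ : IsTwist d w hw.rank_eq h σ) :
    σ = twist hw h := by
  ext1 i
  have h2 : conj d w (Sum.inl (blockMax (conj d w) h (σ i)))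
      (Sum.inl (blockMax (conj d w) h (twist hw h i))) :=
    stack_upper ((comp d w).trans' (hσ i) ((comp d w).symm' (isTwist_twist hw h i)))
  exact (blockMax (conj d w) h).injective (propMax_unique (Finset.orderEmbOfFin_mem _ _ _)
    (Finset.orderEmbOfFin_mem _ _ _) h2)

end DiagramAlgebras

namespace DiagramAlgebras

variable {k : ℕ} {n : ℂ}

/-! ### Partitions, tableaux and Specht modules -/

/-- The partition `λ*` obtained from `λ` by removing its first part. -/
def removeFirstRow (lam : YoungDiagram) : YoungDiagram where
  cells := (lam.cells.filter fun c => 0 < c.1).image fun c => (c.1 - 1, c.2)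
  isLowerSet := by
    rintro ⟨i, j⟩ ⟨i', j'⟩ hle h
    simp only [Finset.coe_image, Finset.coe_filter, Set.mem_image, Set.mem_ofPred_eq,
      Prod.mk.injEq, Prod.exists] at h ⊢
    obtain ⟨a, b, ⟨hab, ha⟩, rfl, rfl⟩ := h
    have h1 := (Prod.mk_le_mk.1 hle).1
    have h2 := (Prod.mk_le_mk.1 hle).2
    exact ⟨i' + 1, j', ⟨lam.up_left_mem (by omega) h2 hab, by omega⟩, by omega, rfl⟩

/-- The set `Λ^{A_k}` of partitions `μ` that label the irreducible `A_k`-modules: the size `m` of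
`μ` is the rank of a diagram in `𝒜_k` and, if `A_k` is planar, `μ = [m]` has at most one row. -/
def Kind.labels (X : Kind) (k : ℕ) : Set YoungDiagram :=
  {μ | μ.card ≤ k ∧ (X.matching = true → Even (k - μ.card)) ∧
    (X.planar = true → ∀ c ∈ μ.cells, c.1 = 0)}

/-- Young tableaux of shape `μ ⊢ m`: fillings of the cells `(row, column)` of `μ` with the numbers
`0, …, m - 1`, each used once. -/
abbrev Tableau (μ : YoungDiagram) : Type := {c // c ∈ μ.cells} ≃ Fin μ.card

/-- A tableau is standard if its entries increase along rows and down columns. -/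
def IsStandard {μ : YoungDiagram} (t : Tableau μ) : Prop :=
  (∀ c c' : {c // c ∈ μ.cells}, c.1.1 = c'.1.1 → c.1.2 < c'.1.2 → t c < t c') ∧
    ∀ c c' : {c // c ∈ μ.cells}, c.1.2 = c'.1.2 → c.1.1 < c'.1.1 → t c < t c'

/-- The column reading order on the cells: by column, then by row. -/
@[reducible] noncomputable def columnOrder (μ : YoungDiagram) :
    LinearOrder {c // c ∈ μ.cells} :=
  LinearOrder.lift' (fun c => toLex (c.1.2, c.1.1)) fun c c' h => by
    have h1 := Prod.mk.injEq _ _ _ _ ▸ toLex_inj.1 h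
    exact Subtype.ext (Prod.ext h1.2 h1.1)

/-- The column-reading tableau `t_c`. -/
noncomputable def columnTableau (μ : YoungDiagram) : Tableau μ :=
  (@monoEquivOfFin {c // c ∈ μ.cells} _ (columnOrder μ) _ (Fintype.card_coe μ.cells)).toEquiv.symm

theorem monoEquivOfFin_symm_lt {α : Type*} [Fintype α] [LinearOrder α] {m : ℕ}
    (h : Fintype.card α = m) (a b : α) :
    (monoEquivOfFin α h).toEquiv.symm a < (monoEquivOfFin α h).toEquiv.symm b ↔ a < b :=
  (monoEquivOfFin α h).symm.lt_iff_lt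

/-- The entries of `t_c` increase down the first column, then down the second column, and so on. -/
theorem columnTableau_lt_iff {μ : YoungDiagram} (c c' : {c // c ∈ μ.cells}) :
    columnTableau μ c < columnTableau μ c' ↔
      c.1.2 < c'.1.2 ∨ c.1.2 = c'.1.2 ∧ c.1.1 < c'.1.1 :=
  (@monoEquivOfFin_symm_lt {c // c ∈ μ.cells} _ (columnOrder μ) _
    (Fintype.card_coe μ.cells) c c').trans Prod.Lex.toLex_lt_toLex

/-- The row group of `t_c`: the permutations that preserve each row. -/
noncomputable def rowGroup (μ : YoungDiagram) : Finset (Equiv.Perm (Fin μ.card)) :=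
  Finset.univ.filter fun ρ =>
    ∀ i, ((columnTableau μ).symm (ρ i)).1.1 = ((columnTableau μ).symm i).1.1

/-- The column group of `t_c`: the permutations that preserve each column. -/
noncomputable def columnGroup (μ : YoungDiagram) : Finset (Equiv.Perm (Fin μ.card)) :=
  Finset.univ.filter fun γ =>
    ∀ i, ((columnTableau μ).symm (γ i)).1.2 = ((columnTableau μ).symm i).1.2

/-- The group algebra `ℂ S_m`. -/
abbrev GroupAlgebra (m : ℕ) : Type := MonoidAlgebra ℂ (Equiv.Perm (Fin m))

/-- The Young symmetrizer `p_μ = ∑ sign(γ) γ ρ`, over `γ` in the column group and `ρ` in the row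
group of `t_c`. -/
noncomputable def youngSymmetrizer (μ : YoungDiagram) : GroupAlgebra μ.card :=
  ∑ γ ∈ columnGroup μ, ∑ ρ ∈ rowGroup μ,
    ((Equiv.Perm.sign γ : ℤ) : ℂ) • MonoidAlgebra.of ℂ _ (γ * ρ)

/-- The irreducible `S_m`-module `S_m^μ`, realized as the left ideal `(ℂ S_m) p_μ`. -/
noncomputable def spechtModule (μ : YoungDiagram) : Ideal (GroupAlgebra μ.card) :=
  Ideal.span {youngSymmetrizer μ}

/-- The permutation `σ_t`, with `σ_t(t_c) = t`. -/
noncomputable def tableauPerm {μ : YoungDiagram} (t : Tableau μ) : Equiv.Perm (Fin μ.card) :=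
  (columnTableau μ).symm.trans t

/-- Young's natural basis vector `n_t = σ_t p_μ`. -/
noncomputable def naturalVector {μ : YoungDiagram} (t : Tableau μ) : spechtModule μ :=
  ⟨MonoidAlgebra.of ℂ _ (tableauPerm t) * youngSymmetrizer μ,
    Ideal.mul_mem_left _ _ (Ideal.subset_span rfl)⟩

/-! ### The module `(A_k e_λ) / J_{m-1}` -/

/-- The image in the partition algebra of an element of `ℂ S_m`. -/
noncomputable def permElement (k : ℕ) (n : ℂ) {m : ℕ} (a : GroupAlgebra m) :
    PartitionAlgebra k n :=
  a.coeff.sum fun σ c => c • diag n (permDiagram k σ)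

/-- The element `p_μ` of `A_k`. For a planar algebra `ℂ S_m` is replaced by its trivial subalgebra
`ℂ 1_m`, in which the idempotent of the trivial module, labelled by `μ = [m]`, is the identity. -/
noncomputable def Kind.youngElement (X : Kind) (k : ℕ) (n : ℂ) (μ : YoungDiagram) :
    PartitionAlgebra k n :=
  if X.planar then 1 else permElement k n (youngSymmetrizer μ)

/-- The element `e_m`: the diagram `p_{m+1} ⋯ p_k` divided by `n ^ (k - m)` or, for the Brauer and
the Temperley-Lieb algebra, `e_{m+1} e_{m+3} ⋯ e_{k-1}` divided by `n ^ ((k - m) / 2)`. -/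
noncomputable def Kind.idempotent (X : Kind) (k : ℕ) (n : ℂ) (m : ℕ) : PartitionAlgebra k n :=
  (n ^ (if X.matching then (k - m) / 2 else k - m))⁻¹ • diag n (X.idempotentDiagram k m)

theorem Kind.youngElement_mem (X : Kind) {μ : YoungDiagram} (hμ : μ ∈ X.labels k) :
    X.youngElement k n μ ∈ X.algebra k n := by
  rw [Kind.youngElement]
  split_ifs with hX
  · exact one_mem _
  · exact sum_mem fun σ _ => Subalgebra.smul_mem _
      (X.diag_mem (X.permDiagram_mem (by simpa using hX) hμ.1 σ)) _

theorem Kind.idempotent_mem (X : Kind) {μ : YoungDiagram} (hμ : μ ∈ X.labels k) :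
    X.idempotent k n μ.card ∈ X.algebra k n :=
  Subalgebra.smul_mem _ (X.diag_mem (X.idempotentDiagram_mem hμ.2.1)) _

/-- The element `e_λ = p_{λ*} e_m` of `A_k`, where `μ = λ*` has size `m`. -/
noncomputable def Kind.labelElement (X : Kind) (k : ℕ) (n : ℂ) {μ : YoungDiagram}
    (hμ : μ ∈ X.labels k) : X.algebra k n :=
  ⟨X.youngElement k n μ, X.youngElement_mem hμ⟩ * ⟨X.idempotent k n μ.card, X.idempotent_mem hμ⟩

/-- The `A_k`-module `(A_k e_λ) / J_{m-1}`: the image of the left ideal `A_k e_λ` under the quotient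
map `A_k → A_k / J_{m-1}`, where `μ = λ*` has size `m`. -/
noncomputable def Kind.quotientModule (X : Kind) (k : ℕ) (n : ℂ) {μ : YoungDiagram}
    (hμ : μ ∈ X.labels k) :
    Submodule (X.algebra k n) (X.algebra k n ⧸ X.ideal k n μ.card) :=
  Submodule.map (X.ideal k n μ.card).mkQ (Ideal.span {X.labelElement k n hμ})

noncomputable instance (X : Kind) {μ : YoungDiagram} (hμ : μ ∈ X.labels k) :
    Module (X.algebra k n) (X.quotientModule k n hμ) := Submodule.module _

noncomputable instance (X : Kind) {μ : YoungDiagram} (hμ : μ ∈ X.labels k) :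
    SMul (X.algebra k n) (X.quotientModule k n hμ) := Submodule.smul _

/-! ### The module `A_k^λ` -/

/-- The vector space `A_k^λ = W^m ⊗ S_m^{λ*}`, where `W^m` has the symmetric `m`-diagrams in `𝒜_k`
as a basis and `μ = λ*` has size `m`. -/
abbrev Kind.twistedModule (X : Kind) (k : ℕ) (μ : YoungDiagram) : Type :=
  TensorProduct ℂ (X.symmetricDiagrams k μ.card →₀ ℂ) (spechtModule μ)

/-- The action on `A_k^λ` of a diagram `d` in `𝒜_k`:
`d · (w ⊗ v) = n ^ ℓ(d, w) • (d ∘ w ∘ dᵀ) ⊗ σ_{d,w} · v` if `d ∘ w ∘ dᵀ` has rank `m`, and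
`d · (w ⊗ v) = 0` otherwise. -/
noncomputable def Kind.twistedAction (X : Kind) (k : ℕ) (n : ℂ) (μ : YoungDiagram)
    (d : X.diagrams k) : X.twistedModule k μ →ₗ[ℂ] X.twistedModule k μ :=
  TensorProduct.lift <| Finsupp.lift _ ℂ _ fun w =>
    if h : rank (conj d.1 w.1) = μ.card then
      n ^ loops d.1 w.1 •
        (TensorProduct.mk ℂ _ _ (Finsupp.single ⟨conj d.1 w.1, X.conj_mem d.2 w.2 h⟩ 1) ∘ₗ
          Algebra.lsmul ℂ ℂ _ (MonoidAlgebra.of ℂ _ (twist w.2.2 h)))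
    else 0

/-! ### Noncrossing factors -/

/-- `ω` is a noncrossing `m`-factor: it has rank `m`, the first `m` bottom vertices propagate, the
remaining bottom vertices are isolated or (Brauer and Temperley-Lieb) paired with their neighbours,
and the propagating edges do not cross when drawn to the rightmost vertex of their block in the top
row. -/
structure IsNoncrossingFactor (X : Kind) (m : ℕ) (ω : Diagram k) : Prop where
  rank_eq : rank ω = m
  propagating : ∀ j : Fin k, (j : ℕ) < m → ∃ i, ω (Sum.inl i) (Sum.inr j)
  isolated : X.matching = false → ∀ (j : Fin k) x, m ≤ (j : ℕ) → ω (Sum.inr j) x → x = Sum.inr j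
  paired : X.matching = true → ∀ j j' : Fin k, m ≤ (j : ℕ) → Even ((j : ℕ) - m) →
    (j' : ℕ) = j + 1 → ∀ x, ω (Sum.inr j) x ↔ x = Sum.inr j ∨ x = Sum.inr j'
  noncrossing : ∀ j j' : Fin k, j < j' → (j' : ℕ) < m → ∀ i ∈ propMax ω, ∀ i' ∈ propMax ω,
    ω (Sum.inl i) (Sum.inr j) → ω (Sum.inl i') (Sum.inr j') → i < i'

/-- The set of the noncrossing `m`-factors in `𝒜_k`. -/
def Kind.noncrossingFactors (X : Kind) (k m : ℕ) : Set (Diagram k) :=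
  {ω | ω ∈ X.diagrams k ∧ IsNoncrossingFactor X m ω}

/-- Two diagrams have the same set partition on the top row and the same propagating blocks there. -/
def SameTop (ω w : Diagram k) : Prop :=
  (∀ i j, ω (Sum.inl i) (Sum.inl j) ↔ w (Sum.inl i) (Sum.inl j)) ∧
    ∀ i, (∃ j, ω (Sum.inl i) (Sum.inr j)) ↔ ∃ j, w (Sum.inl i) (Sum.inr j)

end DiagramAlgebras

open DiagramAlgebras
open scoped TensorProduct

namespace DiagramAlgebras

variable {k : ℕ}

/-! ### Concatenation in terms of the upper diagram and the top row of the lower one -/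

/-! The vector `w ⊗ v` is sent to the class of `ω v`, where `ω` is the noncrossing factor with the
same top as `w` and `v ∈ ℂ S_m` is read as a combination of permutation diagrams placed below `ω`.
The theorem amounts to saying that this linear map is injective, that it turns twisted conjugation
into left multiplication, and that its image is `(A_k e_λ) / J_{m-1}`.

The guiding principle is that placing `d` on top of a diagram only feels the top of that diagram.
The components of the stack are those of `d` with its bottom vertices joined as in the top row of
the lower diagram (`capped`), together with the bottom blocks that do not propagate. Hence the top
of `d ∘ ω`, and the number of loops (`loops_congr`), depend only on the top of `ω`, and one may pass
freely between `ω` and `w`. A symmetric diagram is determined by its top, and so is a noncrossing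
factor; each is rebuilt from the other without leaving the family (`Kind.factorOf_mem`), which gives
the bijection `Kind.factorEquiv`. Since `w ∘ w = w = wᵀ`, the conjugate `d ∘ w ∘ dᵀ` equals `(d ∘ w)
∘ (d ∘ w)ᵀ`, so it has the same top as `d ∘ w` and as `d ∘ ω`.

If the rank stays `m`, then `d ∘ ω = ω' ∘ σ_{d,w}`, where `ω'` is the factor of `d ∘ w ∘ dᵀ`
(`comp_eq_comp_twist`); if it drops, then `d ω` lies in `J_{m-1}`. This is the equivariance
`Kind.quotientMap_twistedAction`. Injectivity holds because the diagrams `ω ∘ σ` are pairwise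
distinct and all have rank `m`, whereas `J_{m-1}` is spanned by diagrams of smaller rank. For the
image, `e_m` commutes with the permutations and acts on factors from the right as a nonzero scalar.

In the planar case only the identity permutation is available. There `v` is replaced by its
coefficient at the identity, which loses nothing: the Specht module of a one-row shape consists of
elements with constant coefficients, and all twists are trivial (`twist_eq_one`).

The module axioms of the twisted action are never verified by hand. The module structure is
transported from the quotient along the linear bijection, and equivariance shows that it is given by
the stated formula. -/

/-- The partition of the top row of `ω`, on the bottom row of a diagram placed above it. -/
@[reducible] def cap (ω : Diagram k) : Diagram k :=
  Setoid.ker (Sum.elim Sum.inl fun i => Sum.inr (Quotient.mk ω (Sum.inl i)) :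
    Fin k ⊕ Fin k → Fin k ⊕ Quotient ω)

theorem cap_inr {ω : Diagram k} {i j : Fin k} :
    cap ω (Sum.inr i) (Sum.inr j) ↔ ω (Sum.inl i) (Sum.inl j) := by
  rw [cap, Setoid.ker_def]
  simp only [Sum.elim_inr, Sum.inr.injEq]
  exact Quotient.eq

theorem cap_le {ω s : Diagram k} (h : ∀ i j, ω (Sum.inl i) (Sum.inl j) → s (Sum.inr i) (Sum.inr j)) :
    cap ω ≤ s := by
  rintro (i | i) (j | j) hij
  · obtain rfl : i = j := Sum.inl_injective hij
    exact s.refl' _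
  · exact absurd hij Sum.inl_ne_inr
  · exact absurd hij Sum.inr_ne_inl
  · exact h i j (cap_inr.1 hij)

/-- The components of the upper diagram `d` after connecting the bottom vertices that are joined in
the top row of `ω`. -/
@[reducible] def capped (d ω : Diagram k) : Diagram k := d ⊔ cap ω

theorem le_capped {d ω : Diagram k} {a b} (h : d a b) : capped d ω a b :=
  (le_sup_left : d ≤ d ⊔ cap ω) h

theorem capped_inr {d ω : Diagram k} {i j : Fin k} (h : ω (Sum.inl i) (Sum.inl j)) :
    capped d ω (Sum.inr i) (Sum.inr j) :=
  (le_sup_right : cap ω ≤ d ⊔ cap ω) (cap_inr.2 h)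

theorem capped_le {d ω s : Diagram k} (hd : ∀ a b, d a b → s a b)
    (hω : ∀ i j, ω (Sum.inl i) (Sum.inl j) → s (Sum.inr i) (Sum.inr j)) {a b}
    (h : capped d ω a b) : s a b :=
  (sup_le (fun a b => hd a b) (cap_le hω) : d ⊔ cap ω ≤ s) h

theorem capped_eq_self {d ω : Diagram k}
    (hω : ∀ i j, ω (Sum.inl i) (Sum.inl j) → d (Sum.inr i) (Sum.inr j)) : capped d ω = d :=
  sup_eq_left.2 (cap_le hω)

theorem cap_congr {ω w : Diagram k} (h : SameTop ω w) : cap ω = cap w :=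
  le_antisymm (cap_le fun i j hij => cap_inr.2 ((h.1 i j).1 hij))
    (cap_le fun i j hij => cap_inr.2 ((h.1 i j).2 hij))

theorem capped_congr {d ω w : Diagram k} (h : SameTop ω w) : capped d ω = capped d w := by
  rw [capped, capped, cap_congr h]

open Classical in
/-- The component of a vertex of the stack: a component of the capped upper diagram, or else a
block of the lower diagram that does not meet its top row. -/
noncomputable def stackMap (d ω : Diagram k) :
    Fin k ⊕ (Fin k ⊕ Fin k) → Quotient (capped d ω) ⊕ Quotient ω :=
  Sum.elim (fun i => Sum.inl (Quotient.mk _ (Sum.inl i)))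
    (Sum.elim (fun i => Sum.inl (Quotient.mk _ (Sum.inr i))) fun j =>
      if h : ∃ i, ω (Sum.inl i) (Sum.inr j) then Sum.inl (Quotient.mk _ (Sum.inr h.choose))
      else Sum.inr (Quotient.mk _ (Sum.inr j)))

theorem stackMap_upper (d ω : Diagram k) (a : Fin k ⊕ Fin k) :
    stackMap d ω (upper a) = Sum.inl (Quotient.mk _ a) := by
  rcases a with a | a <;> rfl

/-- The arbitrary choice in `stackMap` is harmless: two top vertices joined to the same bottom
vertex are joined to each other in `ω`, hence in the capped diagram. -/
theorem stackMap_bottom {d ω : Diagram k} {i j : Fin k} (h : ω (Sum.inl i) (Sum.inr j)) :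
    stackMap d ω (Sum.inr (Sum.inr j)) = Sum.inl (Quotient.mk _ (Sum.inr i)) := by
  have hex : ∃ i, ω (Sum.inl i) (Sum.inr j) := ⟨i, h⟩
  rw [stackMap, Sum.elim_inr, Sum.elim_inr, dif_pos hex]
  exact congrArg _ (Quotient.sound (capped_inr (ω.trans' hex.choose_spec (ω.symm' h))))

theorem stackMap_bottom_of_not {d ω : Diagram k} {j : Fin k} (h : ¬ ∃ i, ω (Sum.inl i) (Sum.inr j)) :
    stackMap d ω (Sum.inr (Sum.inr j)) = Sum.inr (Quotient.mk _ (Sum.inr j)) := by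
  rw [stackMap, Sum.elim_inr, Sum.elim_inr, dif_neg h]

/-- It suffices to check the edges coming from `d` and those coming from `ω`. With this invariant,
components of the stack can be told apart without following paths through the middle row. -/
theorem stackMap_eq {d ω : Diagram k} {x y} (h : stack d ω x y) :
    stackMap d ω x = stackMap d ω y := by
  refine stack_le (s := Setoid.ker (stackMap d ω)) ?_ ?_ h
  · intro a b hab
    rw [Setoid.ker_def, stackMap_upper, stackMap_upper]
    exact congrArg _ (Quotient.sound (le_capped hab))
  · have hmid : ∀ i, stackMap d ω (Sum.inr (Sum.inl i)) = Sum.inl (Quotient.mk _ (Sum.inr i)) :=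
      fun i => rfl
    rintro (a | a) (b | b) hab <;> rw [Setoid.ker_def]
    · rw [hmid, hmid]
      exact congrArg _ (Quotient.sound (capped_inr hab))
    · rw [hmid, stackMap_bottom hab]
    · rw [hmid, stackMap_bottom (ω.symm' hab)]
    · by_cases ha : ∃ i, ω (Sum.inl i) (Sum.inr a)
      · obtain ⟨i, hi⟩ := ha
        rw [stackMap_bottom hi, stackMap_bottom (ω.trans' hi hab)]
      · have hb : ¬ ∃ i, ω (Sum.inl i) (Sum.inr b) :=
          fun ⟨i, hi⟩ => ha ⟨i, ω.trans' hi (ω.symm' hab)⟩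
        rw [stackMap_bottom_of_not ha, stackMap_bottom_of_not hb]
        exact congrArg _ (Quotient.sound hab)

/-- The invariant `stackMap` shows that the stack joins no more than the capped diagram does; the
converse is the minimality of the supremum. -/
theorem stack_upper_iff {d ω : Diagram k} {a b : Fin k ⊕ Fin k} :
    stack d ω (upper a) (upper b) ↔ capped d ω a b := by
  constructor
  · intro h
    have h1 := stackMap_eq h
    rw [stackMap_upper, stackMap_upper] at h1
    exact Quotient.exact (Sum.inl_injective h1)
  · exact capped_le (s := (stack d ω).comap upper) (fun a b => stack_upper)
      fun i j => stack_lower (a := Sum.inl i) (b := Sum.inl j)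

theorem stack_bottom_iff {d ω : Diagram k} {a : Fin k ⊕ Fin k} {j : Fin k} :
    stack d ω (upper a) (Sum.inr (Sum.inr j)) ↔
      ∃ i, ω (Sum.inl i) (Sum.inr j) ∧ capped d ω a (Sum.inr i) := by
  constructor
  · intro h
    have h1 := stackMap_eq h
    rw [stackMap_upper] at h1
    by_cases hj : ∃ i, ω (Sum.inl i) (Sum.inr j)
    · obtain ⟨i, hi⟩ := hj
      rw [stackMap_bottom hi] at h1
      exact ⟨i, hi, Quotient.exact (Sum.inl_injective h1)⟩
    · rw [stackMap_bottom_of_not hj] at h1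
      simp at h1
  · rintro ⟨i, hi, h⟩
    exact (stack d ω).trans' (stack_upper_iff.2 h) (stack_lower hi)

theorem comp_top_iff {d ω : Diagram k} {i j : Fin k} :
    comp d ω (Sum.inl i) (Sum.inl j) ↔ capped d ω (Sum.inl i) (Sum.inl j) :=
  stack_upper_iff (a := Sum.inl i) (b := Sum.inl j)

theorem comp_top_bottom_iff {d ω : Diagram k} {i j : Fin k} :
    comp d ω (Sum.inl i) (Sum.inr j) ↔
      ∃ y, ω (Sum.inl y) (Sum.inr j) ∧ capped d ω (Sum.inl i) (Sum.inr y) :=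
  stack_bottom_iff (a := Sum.inl i)

/-- A bottom block of the lower diagram that does not propagate is out of reach of `d`: the
invariant `stackMap` takes its value in the second summand. -/
theorem comp_bottom_iff_of_not {d ω : Diagram k} {i j : Fin k}
    (hi : ¬ ∃ y, ω (Sum.inl y) (Sum.inr i)) :
    comp d ω (Sum.inr i) (Sum.inr j) ↔ ω (Sum.inr i) (Sum.inr j) := by
  refine ⟨fun h => ?_, fun h => stack_lower h⟩
  have h1 := stackMap_eq (d := d) (ω := ω) (x := Sum.inr (Sum.inr i)) (y := Sum.inr (Sum.inr j)) h
  rw [stackMap_bottom_of_not hi] at h1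
  by_cases hj : ∃ y, ω (Sum.inl y) (Sum.inr j)
  · obtain ⟨y, hy⟩ := hj
    rw [stackMap_bottom hy] at h1
    simp at h1
  · rw [stackMap_bottom_of_not hj] at h1
    exact Quotient.exact (Sum.inr_injective h1)

/-- The right-hand side involves only the top of `ω`: its top row and the set of its propagating top
vertices. This is why `loops` cannot distinguish `ω` from `w`. -/
theorem loops_eq (d ω : Diagram k) :
    loops d ω = Nat.card {c : Quotient (capped d ω) // ∀ a, Quotient.mk _ a = c →
      ∃ i, a = Sum.inr i ∧ ¬ ∃ j, ω (Sum.inl i) (Sum.inr j)} := by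
  symm
  rw [loops]
  refine Nat.card_congr (Equiv.ofBijective (fun c =>
    ⟨Quotient.map upper (fun a b h => stack_upper_iff.2 h) c.1, ?_⟩) ⟨?_, ?_⟩)
  · obtain ⟨c, hc⟩ := c
    obtain ⟨a, rfl⟩ := Quotient.exists_rep c
    intro x hx
    have hx : stack d ω x (upper a) := Quotient.exact hx
    rcases x with x | x | x
    · obtain ⟨i, hi, -⟩ := hc (Sum.inl x)
        (Quotient.sound ((stack_upper_iff (a := Sum.inl x)).1 hx))
      simp at hi
    · exact ⟨x, rfl⟩
    · obtain ⟨i, hi, h⟩ := stack_bottom_iff.1 ((stack d ω).symm' hx)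
      obtain ⟨i', hi', h'⟩ := hc (Sum.inr i) (Quotient.sound ((capped d ω).symm' h))
      obtain rfl := Sum.inr_injective hi'
      exact absurd ⟨x, hi⟩ h'
  · rintro ⟨c, hc⟩ ⟨c', hc'⟩ h
    obtain ⟨a, rfl⟩ := Quotient.exists_rep c
    obtain ⟨b, rfl⟩ := Quotient.exists_rep c'
    have h1 : stack d ω (upper a) (upper b) := Quotient.exact (congrArg Subtype.val h)
    exact Subtype.ext (Quotient.sound (stack_upper_iff.1 h1))
  · rintro ⟨c, hc⟩
    obtain ⟨x, rfl⟩ := Quotient.exists_rep c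
    obtain ⟨i, rfl⟩ := hc x rfl
    -- A loop contains a middle vertex `i`. Its class in the capped diagram meets neither the top
    -- row nor a propagating block of `ω`, since the loop would then reach an outer row.
    refine ⟨⟨Quotient.mk _ (Sum.inr i), fun a ha => ?_⟩, rfl⟩
    have ha : stack d ω (upper a) (upper (Sum.inr i)) := stack_upper_iff.2 (Quotient.exact ha)
    obtain ⟨j, hj⟩ := hc _ (Quotient.sound ha)
    rcases a with a | a
    · simp [upper] at hj
    · refine ⟨a, rfl, fun ⟨l, hl⟩ => ?_⟩
      obtain ⟨j', hj'⟩ := hc (Sum.inr (Sum.inr l)) (Quotient.sound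
        ((stack d ω).trans' (stack_lower (ω.symm' hl)) ha))
      simp at hj'

theorem loops_congr {d ω w : Diagram k} (h : SameTop ω w) : loops d ω = loops d w := by
  rw [loops_eq, loops_eq, capped_congr h]
  simp only [h.2]

theorem loops_eq_zero {d ω : Diagram k} (h : ∀ i, ∃ j, ω (Sum.inl i) (Sum.inr j)) :
    loops d ω = 0 := by
  rw [loops_eq, Nat.card_eq_zero]
  left
  constructor
  rintro ⟨c, hc⟩
  obtain ⟨a, rfl⟩ := Quotient.exists_rep c
  obtain ⟨i, -, hi⟩ := hc a rfl
  exact hi (h i)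

/-! ### Diagrams with the same top -/

theorem SameTop.symm {ω w : Diagram k} (h : SameTop ω w) : SameTop w ω :=
  ⟨fun i j => (h.1 i j).symm, fun i => (h.2 i).symm⟩

theorem SameTop.trans {u v w : Diagram k} (h : SameTop u v) (h' : SameTop v w) : SameTop u w :=
  ⟨fun i j => (h.1 i j).trans (h'.1 i j), fun i => (h.2 i).trans (h'.2 i)⟩

theorem SameTop.propMax_eq {ω w : Diagram k} (h : SameTop ω w) : propMax ω = propMax w := by
  ext i
  rw [mem_propMax, mem_propMax, h.2 i]
  simp only [h.1]

theorem SameTop.rank_eq {ω w : Diagram k} (h : SameTop ω w) : rank ω = rank w := by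
  rw [← card_propMax, ← card_propMax, h.propMax_eq]

theorem SameTop.blockMax_eq {ω w : Diagram k} (h : SameTop ω w) {m : ℕ} (hω : rank ω = m)
    (hw : rank w = m) : blockMax ω hω = blockMax w hw := by
  simp only [blockMax, h.propMax_eq]

/-- The top of the concatenation is read off from the capped diagram and the propagating top
vertices of the lower diagram, and these agree for `ω` and `w`. -/
theorem SameTop.comp {d ω w : Diagram k} (h : SameTop ω w) : SameTop (comp d ω) (comp d w) := by
  have hc := capped_congr (d := d) h
  refine ⟨fun i j => ?_, fun i => ?_⟩
  · rw [comp_top_iff, comp_top_iff, hc]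
  · simp only [comp_top_bottom_iff]
    rw [hc]
    constructor
    · rintro ⟨j, y, hy, hiy⟩
      obtain ⟨j', hj'⟩ := (h.2 y).1 ⟨j, hy⟩
      exact ⟨j', y, hj', hiy⟩
    · rintro ⟨j, y, hy, hiy⟩
      obtain ⟨j', hj'⟩ := (h.2 y).2 ⟨j, hy⟩
      exact ⟨j', y, hj', hiy⟩

/-- The top row of `uᵀ` is the bottom row of `u`, so capping `u` with it joins nothing new. This
construction turns a factor into a symmetric diagram. -/
theorem sameTop_mirror (u : Diagram k) : SameTop u (comp u (transpose u)) := by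
  refine ⟨fun i j => ?_, fun i => ?_⟩
  · rw [comp_top_iff, capped_eq_self]
    exact fun i j h => h
  · constructor
    · rintro ⟨j, hj⟩
      exact ⟨i, comp_top_bottom_iff.2 ⟨j, u.symm' hj, le_capped hj⟩⟩
    · rintro ⟨j, hj⟩
      exact exists_top_of_comp hj

theorem isSymmetricDiagram_mirror {m : ℕ} {u : Diagram k} (h : rank u = m) :
    IsSymmetricDiagram m (comp u (transpose u)) := by
  refine ⟨by rw [comp_transpose, transpose_transpose], (sameTop_mirror u).rank_eq ▸ h, ?_⟩
  intro i j hij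
  obtain ⟨y, hy⟩ := exists_top_of_comp hij
  exact comp_top_bottom_iff.2 ⟨y, u.symm' hy, le_capped hy⟩

theorem IsSymmetricDiagram.inr_inr {m : ℕ} {w : Diagram k} (hw : IsSymmetricDiagram m w)
    {i j : Fin k} : w (Sum.inr i) (Sum.inr j) ↔ w (Sum.inl i) (Sum.inl j) :=
  ⟨fun h => hw.swap h, fun h => hw.swap h⟩

theorem IsSymmetricDiagram.inl_inr {m : ℕ} {w : Diagram k} (hw : IsSymmetricDiagram m w)
    {i j : Fin k} : w (Sum.inl i) (Sum.inr j) ↔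
      w (Sum.inl i) (Sum.inl j) ∧ ∃ l, w (Sum.inl i) (Sum.inr l) := by
  constructor
  · exact fun h => ⟨hw.inr_inr.1 (w.trans' (w.symm' (hw.mirror i j h)) h), j, h⟩
  · rintro ⟨h, l, hl⟩
    exact w.trans' (hw.mirror i l hl) (hw.inr_inr.2 h)

theorem diagram_ext {d d' : Diagram k}
    (h₁ : ∀ i j, d (Sum.inl i) (Sum.inl j) ↔ d' (Sum.inl i) (Sum.inl j))
    (h₂ : ∀ i j, d (Sum.inl i) (Sum.inr j) ↔ d' (Sum.inl i) (Sum.inr j))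
    (h₃ : ∀ i j, d (Sum.inr i) (Sum.inr j) ↔ d' (Sum.inr i) (Sum.inr j)) : d = d' := by
  ext x y
  rcases x with x | x <;> rcases y with y | y
  · exact h₁ x y
  · exact h₂ x y
  · exact ⟨fun h => d'.symm' ((h₂ y x).1 (d.symm' h)), fun h => d.symm' ((h₂ y x).2 (d'.symm' h))⟩
  · exact h₃ x y

/-- The bottom row is the reflection of the top row, and a propagating block joins its top part to
the mirror image of that part, so the top determines everything. -/
theorem IsSymmetricDiagram.eq_of_sameTop {m m' : ℕ} {w w' : Diagram k}
    (hw : IsSymmetricDiagram m w) (hw' : IsSymmetricDiagram m' w') (h : SameTop w w') : w = w' := by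
  refine diagram_ext h.1 (fun i j => ?_) fun i j => ?_
  · rw [hw.inl_inr, hw'.inl_inr, h.1, h.2]
  · rw [hw.inr_inr, hw'.inr_inr, h.1]

theorem IsSymmetricDiagram.comp_self_eq {m : ℕ} {w : Diagram k} (hw : IsSymmetricDiagram m w) :
    comp w w = w := by
  have h := isSymmetricDiagram_mirror hw.rank_eq
  have h' := sameTop_mirror w
  rw [hw.symm] at h h'
  exact (hw.eq_of_sameTop h h').symm

/-- Insert `w = w ∘ w` between `d` and `dᵀ` and use `wᵀ = w`. -/
theorem conj_eq_mirror {m : ℕ} {d w : Diagram k} (hw : IsSymmetricDiagram m w) :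
    conj d w = comp (comp d w) (transpose (comp d w)) := by
  rw [comp_transpose, hw.symm, comp_assoc d w, ← comp_assoc w w, hw.comp_self_eq, conj, comp_assoc]

theorem sameTop_conj {m : ℕ} {d w : Diagram k} (hw : IsSymmetricDiagram m w) :
    SameTop (comp d w) (conj d w) := conj_eq_mirror (d := d) hw ▸ sameTop_mirror (comp d w)

/-- The diagrams `d` and `d ∘ dᵀ` have the same top, hence the same rank, and the rank of the latter
is bounded by that of its lower factor. -/
theorem rank_transpose_le (d : Diagram k) : rank d ≤ rank (transpose d) := by
  rw [(sameTop_mirror d).rank_eq]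
  exact rank_comp_le_right _ _

theorem rank_comp_le_left (d₁ d₂ : Diagram k) : rank (comp d₁ d₂) ≤ rank d₁ := by
  refine (rank_transpose_le _).trans ?_
  rw [comp_transpose]
  refine (rank_comp_le_right _ _).trans ((rank_transpose_le _).trans ?_)
  rw [transpose_transpose]

end DiagramAlgebras

namespace DiagramAlgebras

variable {k m : ℕ}

/-! ### The diagram of `e_m` -/

theorem idempotentDiagram_inl_inr {X : Kind} {i j : Fin k} :
    X.idempotentDiagram k m (Sum.inl i) (Sum.inr j) ↔ i = j ∧ (j : ℕ) < m := by
  by_cases hX : X.matching = true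
  all_goals
    first | rw [Kind.idempotentDiagram, if_pos hX] | rw [Kind.idempotentDiagram, if_neg hX]
    simp only [Setoid.ker_def, Sum.elim_inl, Sum.elim_inr, Fin.ext_iff]
    split_ifs <;> simp only [Prod.mk.injEq, and_true] <;> omega

theorem idempotentDiagram_inr_inr_of_lt {X : Kind} {i j : Fin k} (hi : (i : ℕ) < m) :
    X.idempotentDiagram k m (Sum.inr i) (Sum.inr j) ↔ i = j := by
  by_cases hX : X.matching = true
  all_goals
    first | rw [Kind.idempotentDiagram, if_pos hX] | rw [Kind.idempotentDiagram, if_neg hX]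
    simp only [Setoid.ker_def, Sum.elim_inr, Fin.ext_iff, hi, if_true]
    split_ifs <;> simp only [Prod.mk.injEq, and_true] <;> omega

theorem idempotentDiagram_inl_inl {X : Kind} {i j : Fin k} :
    X.idempotentDiagram k m (Sum.inl i) (Sum.inl j) ↔
      X.idempotentDiagram k m (Sum.inr i) (Sum.inr j) := by
  by_cases hX : X.matching = true
  all_goals
    first | rw [Kind.idempotentDiagram, if_pos hX] | rw [Kind.idempotentDiagram, if_neg hX]
    simp only [Setoid.ker_def, Sum.elim_inr, Sum.elim_inl]
    split_ifs <;> simp only [Prod.mk.injEq, and_true] <;> omega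

theorem idempotentDiagram_isolated {X : Kind} (hX : X.matching = false) (j : Fin k) (x)
    (hj : m ≤ (j : ℕ)) (h : X.idempotentDiagram k m (Sum.inr j) x) : x = Sum.inr j := by
  rw [Kind.idempotentDiagram, if_neg (by simp [hX])] at h
  rcases x with x | x <;> simp only [Setoid.ker_def, Sum.elim_inr, Sum.elim_inl, Sum.inr.injEq,
    Fin.ext_iff] at h ⊢ <;> split_ifs at h <;> simp only [Prod.mk.injEq] at h <;> omega

theorem idempotentDiagram_paired {X : Kind} (hX : X.matching = true) (j j' : Fin k)
    (hj : m ≤ (j : ℕ)) (he : Even ((j : ℕ) - m)) (hj' : (j' : ℕ) = j + 1) (x) :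
    X.idempotentDiagram k m (Sum.inr j) x ↔ x = Sum.inr j ∨ x = Sum.inr j' := by
  rw [Kind.idempotentDiagram, if_pos hX]
  rw [Nat.even_iff] at he
  rcases x with x | x <;> simp only [Setoid.ker_def, Sum.elim_inr, Sum.elim_inl, Sum.inr.injEq,
    Fin.ext_iff] <;> split_ifs <;>
    simp only [Prod.mk.injEq, reduceCtorEq, and_true, and_false, or_self, false_iff, iff_false] <;>
    omega

/-! ### Diagrams of rank `m` whose bottom row is that of `e_m` -/

/-- The bottom row of `ω` is partitioned as that of `e_m`, and its first `m` vertices propagate. -/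
structure IsFactor (X : Kind) (m : ℕ) (ω : Diagram k) : Prop where
  bottom : ∀ i j, ω (Sum.inr i) (Sum.inr j) ↔ X.idempotentDiagram k m (Sum.inr i) (Sum.inr j)
  propagates : ∀ j : Fin k, (∃ i, ω (Sum.inl i) (Sum.inr j)) ↔ (j : ℕ) < m

theorem isFactor_idempotentDiagram (X : Kind) : IsFactor X m (X.idempotentDiagram k m) := by
  refine ⟨fun _ _ => Iff.rfl, fun j => ?_⟩
  simp [idempotentDiagram_inl_inr]

theorem IsFactor.eq_of_bottom {X : Kind} {ω : Diagram k} (hω : IsFactor X m ω) {i j : Fin k}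
    (hi : (i : ℕ) < m) (h : ω (Sum.inr i) (Sum.inr j)) : i = j :=
  (idempotentDiagram_inr_inr_of_lt hi).1 ((hω.bottom i j).1 h)

theorem IsFactor.rank_eq {X : Kind} {ω : Diagram k} (hω : IsFactor X m ω) (hm : m ≤ k) :
    rank ω = m := by
  rw [rank, ← Nat.card_fin m]
  symm
  refine Nat.card_congr (Equiv.ofBijective (fun j =>
    ⟨Quotient.mk ω (Sum.inr (Fin.castLE hm j)), ?_, ⟨_, rfl⟩⟩) ⟨?_, ?_⟩)
  · obtain ⟨i, hi⟩ := (hω.propagates (Fin.castLE hm j)).2 j.2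
    exact ⟨i, Quotient.sound hi⟩
  · intro j j' h
    exact Fin.castLE_injective hm
      (hω.eq_of_bottom (i := Fin.castLE hm j) j.2 (Quotient.exact (congrArg Subtype.val h)))
  · rintro ⟨c, ⟨i, hi⟩, ⟨j, rfl⟩⟩
    exact ⟨⟨j, (hω.propagates j).1 ⟨i, Quotient.exact hi⟩⟩, rfl⟩

/-- If only the first `m` bottom vertices propagate in a diagram of rank `m`, then they do so in
different blocks. -/
theorem propagates_of_rank_eq {ω : Diagram k} (hr : rank ω = m)
    (h : ∀ j : Fin k, (∃ i, ω (Sum.inl i) (Sum.inr j)) → (j : ℕ) < m) :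
    (∀ j : Fin k, (j : ℕ) < m → ∃ i, ω (Sum.inl i) (Sum.inr j)) ∧
      ∀ j j' : Fin k, (j : ℕ) < m → (j' : ℕ) < m → ω (Sum.inr j) (Sum.inr j') → j = j' := by
  let B := {c : Quotient ω //
    (∃ i, Quotient.mk ω (Sum.inl i) = c) ∧ ∃ j, Quotient.mk ω (Sum.inr j) = c}
  -- Each propagating block is sent to one of its bottom vertices. This is an injection between two
  -- sets of size `m`, hence a bijection, which gives both claims.
  let f : B → Fin m := fun c => ⟨c.2.2.choose, h _ (by
    obtain ⟨i, hi⟩ := c.2.1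
    exact ⟨i, Quotient.exact (hi.trans c.2.2.choose_spec.symm)⟩)⟩
  have hf : ∀ c : B, ∀ j : Fin k, (f c : ℕ) = j → Quotient.mk ω (Sum.inr j) = c.1 := by
    intro c j hj
    obtain rfl : c.2.2.choose = j := Fin.ext hj
    exact c.2.2.choose_spec
  have hinj : Function.Injective f := by
    intro c c' hc
    apply Subtype.ext
    rw [← hf c c.2.2.choose rfl]
    exact hf c' _ (congrArg Fin.val hc.symm)
  have hsurj : Function.Surjective f :=
    ((Nat.bijective_iff_injective_and_card f).2 ⟨hinj, hr.trans (Nat.card_fin m).symm⟩).2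
  refine ⟨fun j hj => ?_, fun j j' hj hj' hjj => ?_⟩
  · obtain ⟨c, hc⟩ := hsurj ⟨j, hj⟩
    obtain ⟨i, hi⟩ := c.2.1
    exact ⟨i, Quotient.exact (hi.trans (hf c j (congrArg Fin.val hc)).symm)⟩
  · obtain ⟨c, hc⟩ := hsurj ⟨j, hj⟩
    obtain ⟨c', hc'⟩ := hsurj ⟨j', hj'⟩
    have h1 : c = c' := Subtype.ext (((hf c j (congrArg Fin.val hc)).symm.trans
      (Quotient.sound hjj)).trans (hf c' j' (congrArg Fin.val hc')))
    rw [← h1, hc] at hc'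
    exact Fin.ext (Fin.mk.inj hc')

/-- By counting, the rank takes care of the first `m` bottom vertices, so the partition of the
bottom row has to be compared only beyond them. -/
theorem isFactor_of_rank_eq {X : Kind} {ω : Diagram k} (hr : rank ω = m)
    (h : ∀ j : Fin k, (∃ i, ω (Sum.inl i) (Sum.inr j)) → (j : ℕ) < m)
    (h' : ∀ i j : Fin k, m ≤ (i : ℕ) → (ω (Sum.inr i) (Sum.inr j) ↔
      X.idempotentDiagram k m (Sum.inr i) (Sum.inr j))) : IsFactor X m ω := by
  obtain ⟨h1, h2⟩ := propagates_of_rank_eq hr h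
  refine ⟨fun i j => ?_, fun j => ⟨h j, h1 j⟩⟩
  rcases lt_or_ge (i : ℕ) m with hi | hi
  · rw [idempotentDiagram_inr_inr_of_lt hi]
    constructor
    · intro hij
      obtain ⟨l, hl⟩ := h1 i hi
      exact h2 i j hi (h j ⟨l, ω.trans' hl hij⟩) hij
    · rintro rfl
      exact ω.refl' _
  · exact h' i j hi

/-- A diagram placed above creates no new propagating bottom vertices and leaves the nonpropagating
bottom blocks alone. The rank then forces the first `m` bottom vertices to propagate in distinct
blocks. -/
theorem IsFactor.comp {X : Kind} {d ω : Diagram k} (hω : IsFactor X m ω)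
    (hr : rank (comp d ω) = m) : IsFactor X m (comp d ω) := by
  refine isFactor_of_rank_eq hr (fun j ⟨i, hi⟩ => ?_) fun i j hi => ?_
  · exact (hω.propagates j).1 (exists_bottom_of_comp hi)
  · rw [comp_bottom_iff_of_not, hω.bottom]
    rw [hω.propagates]
    omega

theorem IsFactor.ext {X : Kind} {ω ω' : Diagram k} (hω : IsFactor X m ω) (hω' : IsFactor X m ω')
    (h₁ : ∀ i j, ω (Sum.inl i) (Sum.inl j) ↔ ω' (Sum.inl i) (Sum.inl j))
    (h₂ : ∀ i j : Fin k, (j : ℕ) < m → (ω (Sum.inl i) (Sum.inr j) ↔ ω' (Sum.inl i) (Sum.inr j))) :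
    ω = ω' := by
  refine diagram_ext h₁ (fun i j => ?_) fun i j => (hω.bottom i j).trans (hω'.bottom i j).symm
  by_cases hj : (j : ℕ) < m
  · exact h₂ i j hj
  · exact ⟨fun h => absurd ((hω.propagates j).1 ⟨i, h⟩) hj,
      fun h => absurd ((hω'.propagates j).1 ⟨i, h⟩) hj⟩

/-! ### Noncrossing factors -/

/-- The hypothesis describes only the blocks of vertices at even distance from `m`, and only if a
right neighbour exists. The parity of `k - m` provides the neighbour, and a vertex at odd distance
lies in the block of its left neighbour. -/
theorem eq_block_of_paired {X : Kind} (hX : X.matching = true) (he : Even (k - m)) {ω : Diagram k}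
    (h : ∀ j j' : Fin k, m ≤ (j : ℕ) → Even ((j : ℕ) - m) →
      (j' : ℕ) = j + 1 → ∀ x, ω (Sum.inr j) x ↔ x = Sum.inr j ∨ x = Sum.inr j')
    (j : Fin k) (hj : m ≤ (j : ℕ)) (x) :
    ω (Sum.inr j) x ↔ X.idempotentDiagram k m (Sum.inr j) x := by
  rw [Nat.even_iff] at he
  rcases Nat.even_or_odd ((j : ℕ) - m) with h2 | h2
  · have h3 := Nat.even_iff.1 h2
    have hlt : (j : ℕ) + 1 < k := by omega
    rw [h j ⟨j + 1, hlt⟩ hj h2 rfl, idempotentDiagram_paired hX j ⟨j + 1, hlt⟩ hj h2 rfl]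
  · have h3 := Nat.odd_iff.1 h2
    have hlt : (j : ℕ) - 1 < k := by omega
    have h4 : Even (((⟨j - 1, hlt⟩ : Fin k) : ℕ) - m) := by
      rw [Nat.even_iff]
      dsimp only
      omega
    have h5 : (j : ℕ) = ((⟨j - 1, hlt⟩ : Fin k) : ℕ) + 1 := by dsimp only; omega
    have h6 : m ≤ ((⟨j - 1, hlt⟩ : Fin k) : ℕ) := by dsimp only; omega
    have g1 := h _ j h6 h4 h5
    have g2 := idempotentDiagram_paired hX _ j h6 h4 h5
    have e1 := (g1 (Sum.inr j)).2 (Or.inr rfl)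
    have e2 := (g2 (Sum.inr j)).2 (Or.inr rfl)
    rw [show ω (Sum.inr j) x ↔ ω (Sum.inr ⟨j - 1, hlt⟩) x from
      ⟨fun h => ω.trans' e1 h, fun h => ω.trans' (ω.symm' e1) h⟩, g1, ← g2]
    exact ⟨fun h => Setoid.trans' _ (Setoid.symm' _ e2) h, fun h => Setoid.trans' _ e2 h⟩

/-- The blocks of the bottom vertices beyond the first `m` are exactly those in the diagram of
`e_m`, where they do not propagate. -/
theorem IsNoncrossingFactor.isFactor {X : Kind} (he : X.matching = true → Even (k - m))
    {ω : Diagram k} (hω : IsNoncrossingFactor X m ω) : IsFactor X m ω := by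
  have key : ∀ (j : Fin k), m ≤ (j : ℕ) → ∀ x, ω (Sum.inr j) x ↔
      X.idempotentDiagram k m (Sum.inr j) x := by
    intro j hj x
    rcases hX : X.matching
    · constructor
      · intro h
        rw [hω.isolated hX j x hj h]
      · intro h
        rw [idempotentDiagram_isolated hX j x hj h]
    · exact eq_block_of_paired hX (he hX) (hω.paired hX) j hj x
  refine isFactor_of_rank_eq hω.rank_eq (fun j ⟨i, hi⟩ => ?_) fun i j hi => key i hi _
  by_contra hj
  exact hj (idempotentDiagram_inl_inr.1
    (Setoid.symm' _ ((key j (not_lt.1 hj) _).1 (ω.symm' hi)))).2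

theorem IsFactor.block {X : Kind} {ω : Diagram k} (hω : IsFactor X m ω) (j : Fin k)
    (hj : m ≤ (j : ℕ)) (x) : ω (Sum.inr j) x ↔ X.idempotentDiagram k m (Sum.inr j) x := by
  rcases x with x | x
  · constructor
    · intro h
      have := (hω.propagates j).1 ⟨x, ω.symm' h⟩
      omega
    · intro h
      have := (idempotentDiagram_inl_inr.1 (Setoid.symm' _ h)).2
      omega
  · exact hω.bottom j x

theorem IsFactor.isNoncrossingFactor {X : Kind} (hm : m ≤ k) {ω : Diagram k}
    (hω : IsFactor X m ω) (h : ∀ j j' : Fin k, j < j' → (j' : ℕ) < m → ∀ i ∈ propMax ω,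
      ∀ i' ∈ propMax ω, ω (Sum.inl i) (Sum.inr j) → ω (Sum.inl i') (Sum.inr j') → i < i') :
    IsNoncrossingFactor X m ω where
  rank_eq := hω.rank_eq hm
  propagating j hj := (hω.propagates j).2 hj
  isolated hX j x hj hx := idempotentDiagram_isolated hX j x hj ((hω.block j hj x).1 hx)
  paired hX j j' hj he hj' x := by rw [hω.block j hj, idempotentDiagram_paired hX j j' hj he hj']
  noncrossing := h

/-- The propagating edges of a planar diagram do not cross. -/
theorem IsFactor.isNoncrossingFactor_of_isPlanar {X : Kind} (hm : m ≤ k) {ω : Diagram k}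
    (hω : IsFactor X m ω) (hp : IsPlanar ω) : IsNoncrossingFactor X m ω := by
  refine hω.isNoncrossingFactor hm fun j j' hjj hj' i hi i' hi' hij hij' => ?_
  by_contra hlt
  have hne : i ≠ i' := by
    rintro rfl
    exact hjj.ne' (hω.eq_of_bottom hj' (ω.trans' (ω.symm' hij') hij))
  have h1 : i' < i := lt_of_le_of_ne (not_lt.1 hlt) hne.symm
  -- If `i' < i`, the clockwise order on the boundary is `i, i'` swapped against the bottom row:
  -- `i'` in the top row, then `i`, then the bottom vertices `j'` and `j`. The two blocks interlace,
  -- so planarity merges them.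
  refine hne (propMax_unique hi hi' (ω.symm' (hp (Sum.inl i') (Sum.inl i) (Sum.inr j') (Sum.inr j)
    ?_ ?_ ?_ hij' hij))) <;> simp only [pos, Sum.elim_inl, Sum.elim_inr] <;> omega

theorem mem_propMax_blockMax {w : Diagram k} (h : rank w = m) (i : Fin m) :
    blockMax w h i ∈ propMax w := Finset.orderEmbOfFin_mem _ _ i

theorem exists_blockMax {w : Diagram k} (h : rank w = m) {i j : Fin k}
    (hij : w (Sum.inl i) (Sum.inr j)) : ∃ l, w (Sum.inl (blockMax w h l)) (Sum.inl i) := by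
  obtain ⟨l, hl, hli⟩ := exists_propMax hij
  have hl' : l ∈ Set.range (blockMax w h) := by
    rw [blockMax, Finset.range_orderEmbOfFin]
    exact hl
  obtain ⟨x, rfl⟩ := hl'
  exact ⟨x, hli⟩

/-- The `j`-th bottom vertex of a noncrossing factor belongs to the `j`-th propagating block. -/
theorem IsNoncrossingFactor.blockMax_inr {X : Kind} (hm : m ≤ k) {ω : Diagram k} (hω : IsNoncrossingFactor X m ω) (j : Fin m) :
    ω (Sum.inl (blockMax ω hω.rank_eq j)) (Sum.inr (Fin.castLE hm j)) := by
  have hex : ∀ j : Fin m, ∃ l ∈ propMax ω, ω (Sum.inl l) (Sum.inr (Fin.castLE hm j)) := by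
    intro j
    obtain ⟨i, hi⟩ := hω.propagating (Fin.castLE hm j) j.2
    obtain ⟨l, hl, hli⟩ := exists_propMax hi
    exact ⟨l, hl, ω.trans' hli hi⟩
  choose f hf hf' using hex
  -- The noncrossing condition makes the maximal top entries attached to the successive bottom
  -- vertices an increasing enumeration of `propMax ω`, and there is only one such enumeration.
  have hmono : StrictMono f := fun j j' h => hω.noncrossing _ _
    (show Fin.castLE hm j < Fin.castLE hm j' from h) j'.2 _ (hf j) _ (hf j') (hf' j) (hf' j')
  rw [blockMax, ← Finset.orderEmbOfFin_unique ((card_propMax ω).trans hω.rank_eq) hf hmono]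
  exact hf' j

theorem IsNoncrossingFactor.inl_inr {X : Kind} (hm : m ≤ k) {ω : Diagram k} (hω : IsNoncrossingFactor X m ω) (i : Fin k) (j : Fin m) :
    ω (Sum.inl i) (Sum.inr (Fin.castLE hm j)) ↔
      ω (Sum.inl i) (Sum.inl (blockMax ω hω.rank_eq j)) :=
  ⟨fun h => ω.trans' h (ω.symm' (hω.blockMax_inr hm j)),
    fun h => ω.trans' h (hω.blockMax_inr hm j)⟩

/-- The bottom row is prescribed, and the `j`-th bottom vertex must be attached to the `j`-th
propagating block; no freedom is left below the top row. -/
theorem IsNoncrossingFactor.eq_of_sameTop {X : Kind} (he : X.matching = true → Even (k - m))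
    (hm : m ≤ k) {ω ω' : Diagram k} (hω : IsNoncrossingFactor X m ω)
    (hω' : IsNoncrossingFactor X m ω') (h : SameTop ω ω') : ω = ω' := by
  refine (hω.isFactor he).ext (hω'.isFactor he) h.1 fun i j hj => ?_
  have h1 := hω.inl_inr hm i ⟨j, hj⟩
  have h2 := hω'.inl_inr hm i ⟨j, hj⟩
  rw [← h.1, ← h.blockMax_eq hω.rank_eq hω'.rank_eq] at h2
  exact h1.trans h2.symm

/-! ### From symmetric diagrams to noncrossing factors -/

open Classical in
/-- The noncrossing factor with the same top as the symmetric diagram `w`. -/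
@[reducible] noncomputable def factorOf (X : Kind) (w : Diagram k) (h : rank w = m) : Diagram k :=
  Setoid.ker (Sum.elim (fun i => Sum.inl (Quotient.mk w (Sum.inl i))) (fun j =>
    if hj : (j : ℕ) < m then Sum.inl (Quotient.mk w (Sum.inl (blockMax w h ⟨j, hj⟩)))
    else Sum.inr (Quotient.mk _ (Sum.inr j))) :
      Fin k ⊕ Fin k → Quotient w ⊕ Quotient (X.idempotentDiagram k m))

theorem factorOf_inl_inl {X : Kind} {w : Diagram k} {h : rank w = m} {i j : Fin k} :
    factorOf X w h (Sum.inl i) (Sum.inl j) ↔ w (Sum.inl i) (Sum.inl j) := by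
  rw [Setoid.ker_def]
  simp only [Sum.elim_inl, Sum.inl.injEq]
  exact Quotient.eq

theorem factorOf_inl_inr {X : Kind} {w : Diagram k} {h : rank w = m} {i j : Fin k} :
    factorOf X w h (Sum.inl i) (Sum.inr j) ↔
      ∃ hj : (j : ℕ) < m, w (Sum.inl i) (Sum.inl (blockMax w h ⟨j, hj⟩)) := by
  rw [Setoid.ker_def, Sum.elim_inl, Sum.elim_inr]
  by_cases hj : (j : ℕ) < m
  · rw [dif_pos hj]
    exact ⟨fun h => ⟨hj, Quotient.exact (Sum.inl_injective h)⟩,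
      fun ⟨_, h⟩ => congrArg _ (Quotient.sound h)⟩
  · rw [dif_neg hj]
    simp [hj]

/-- The first `m` bottom vertices stay apart because different entries of `propMax w` lie in
different blocks of `w`. -/
theorem factorOf_inr_inr {X : Kind} {w : Diagram k} {h : rank w = m} {i j : Fin k} :
    factorOf X w h (Sum.inr i) (Sum.inr j) ↔
      X.idempotentDiagram k m (Sum.inr i) (Sum.inr j) := by
  rw [Setoid.ker_def, Sum.elim_inr, Sum.elim_inr]
  by_cases hi : (i : ℕ) < m <;> by_cases hj : (j : ℕ) < m
  · rw [dif_pos hi, dif_pos hj, idempotentDiagram_inr_inr_of_lt hi]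
    constructor
    · intro h1
      have := (blockMax w h).injective (propMax_unique (mem_propMax_blockMax h _)
        (mem_propMax_blockMax h _) (Quotient.exact (Sum.inl_injective h1)))
      exact Fin.ext (Fin.mk.inj this)
    · rintro rfl
      rfl
  · rw [dif_pos hi, dif_neg hj, idempotentDiagram_inr_inr_of_lt hi]
    refine ⟨fun h => absurd h Sum.inl_ne_inr, ?_⟩
    rintro rfl
    exact absurd hi hj
  · rw [dif_neg hi, dif_pos hj]
    refine ⟨fun h => absurd h Sum.inr_ne_inl, fun h1 => ?_⟩
    have := (idempotentDiagram_inr_inr_of_lt hj).1 (Setoid.symm' _ h1)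
    exact absurd (this ▸ hj) hi
  · rw [dif_neg hi, dif_neg hj]
    exact ⟨fun h => Quotient.exact (Sum.inr_injective h),
      fun h => congrArg _ (Quotient.sound h)⟩

theorem sameTop_factorOf (X : Kind) (hm : m ≤ k) {w : Diagram k} (h : rank w = m) :
    SameTop (factorOf X w h) w := by
  refine ⟨fun i j => factorOf_inl_inl, fun i => ?_⟩
  constructor
  · rintro ⟨j, hj⟩
    obtain ⟨hj, h1⟩ := factorOf_inl_inr.1 hj
    obtain ⟨l, hl⟩ := (mem_propMax.1 (mem_propMax_blockMax h ⟨j, hj⟩)).1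
    exact ⟨l, w.trans' h1 hl⟩
  · rintro ⟨j, hj⟩
    obtain ⟨l, hl⟩ := exists_blockMax h hj
    exact ⟨Fin.castLE hm l, factorOf_inl_inr.2 ⟨l.2, w.symm' hl⟩⟩

/-- The bottom vertices are attached to the propagating blocks through `blockMax`, which is
increasing. -/
theorem isNoncrossingFactor_factorOf (X : Kind) (hm : m ≤ k) {w : Diagram k} (h : rank w = m) :
    IsNoncrossingFactor X m (factorOf X w h) := by
  have hst := sameTop_factorOf X hm h
  have hfac : IsFactor X m (factorOf X w h) := by
    refine ⟨fun i j => factorOf_inr_inr, fun j => ⟨?_, fun hj => ?_⟩⟩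
    · rintro ⟨i, hi⟩
      exact (factorOf_inl_inr.1 hi).1
    · exact ⟨_, factorOf_inl_inr.2 ⟨hj, w.refl' _⟩⟩
  refine hfac.isNoncrossingFactor hm fun j j' hjj hj' i hi i' hi' hij hij' => ?_
  obtain ⟨hj, h1⟩ := factorOf_inl_inr.1 hij
  obtain ⟨hj', h1'⟩ := factorOf_inl_inr.1 hij'
  rw [hst.propMax_eq] at hi hi'
  rw [propMax_unique hi (mem_propMax_blockMax h _) h1,
    propMax_unique hi' (mem_propMax_blockMax h _) h1']
  exact (blockMax w h).strictMono hjj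

/-- If the blocks of a symmetric diagram have at most two vertices, then a propagating block has
only one top vertex. -/
theorem IsSymmetricDiagram.eq_of_isRookBrauer {w : Diagram k} (hw : IsSymmetricDiagram m w)
    (hr : IsRookBrauer w) {i j l : Fin k} (h : w (Sum.inl i) (Sum.inr l))
    (hij : w (Sum.inl i) (Sum.inl j)) : i = j := by
  by_contra hne
  exact absurd (isRookBrauer_iff.1 hr _ _ _ hij (hw.mirror i l h) (by simpa using hne) (by simp))
    (by simp)

/-- A propagating block of `w` contains its top part and the mirror image of that part, so with at
most two vertices it has only one on top. Attaching a single bottom vertex gives a block of size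
two. -/
theorem isRookBrauer_factorOf {X : Kind} {w : Diagram k} (hw : IsSymmetricDiagram m w)
    (hr : IsRookBrauer w) (hE : IsRookBrauer (X.idempotentDiagram k m)) :
    IsRookBrauer (factorOf X w hw.rank_eq) := by
  have hprop : ∀ j : Fin m, ∃ l, w (Sum.inl (blockMax w hw.rank_eq j)) (Sum.inr l) :=
    fun j => (mem_propMax.1 (mem_propMax_blockMax hw.rank_eq j)).1
  have key : ∀ {i j : Fin k} (hj : (j : ℕ) < m),
      w (Sum.inl i) (Sum.inl (blockMax w hw.rank_eq ⟨j, hj⟩)) →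
        i = blockMax w hw.rank_eq ⟨j, hj⟩ := by
    intro i j hj h
    obtain ⟨l, hl⟩ := hprop ⟨j, hj⟩
    exact (hw.eq_of_isRookBrauer hr hl (w.symm' h)).symm
  have keyE : ∀ {i j : Fin k}, (i : ℕ) < m → factorOf X w hw.rank_eq (Sum.inr i) (Sum.inr j) →
      i = j := fun hi h => (idempotentDiagram_inr_inr_of_lt hi).1 (factorOf_inr_inr.1 h)
  rw [isRookBrauer_iff] at hr hE ⊢
  have hs : ∀ {x y}, factorOf X w hw.rank_eq x y → factorOf X w hw.rank_eq y x :=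
    fun h => Setoid.symm' _ h
  have ht : ∀ {x y z}, factorOf X w hw.rank_eq x y → factorOf X w hw.rank_eq y z →
      factorOf X w hw.rank_eq x z := fun h h' => Setoid.trans' _ h h'
  rintro (x | x) (y | y) (z | z) hy hz hxy hxz
  · exact hr _ _ _ (factorOf_inl_inl.1 hy) (factorOf_inl_inl.1 hz) hxy hxz
  · obtain ⟨hj, h1⟩ := factorOf_inl_inr.1 hz
    obtain ⟨hj', h2⟩ := factorOf_inl_inr.1 (ht (hs hy) hz)
    exact absurd (congrArg Sum.inl ((key hj h1).trans (key hj' h2).symm)) hxy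
  · obtain ⟨hj, h1⟩ := factorOf_inl_inr.1 hy
    obtain ⟨hj', h2⟩ := factorOf_inl_inr.1 (ht (hs hz) hy)
    exact absurd (congrArg Sum.inl ((key hj h1).trans (key hj' h2).symm)) hxz
  · obtain ⟨hj, -⟩ := factorOf_inl_inr.1 hy
    rw [keyE hj (ht (hs hy) hz)]
  · obtain ⟨hj, h1⟩ := factorOf_inl_inr.1 (hs hy)
    obtain ⟨hj', h2⟩ := factorOf_inl_inr.1 (hs hz)
    rw [key hj h1, key hj' h2]
  · obtain ⟨hj, -⟩ := factorOf_inl_inr.1 (hs hy)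
    exact absurd (congrArg Sum.inr (keyE hj hz)) hxz
  · obtain ⟨hj, -⟩ := factorOf_inl_inr.1 (hs hz)
    exact absurd (congrArg Sum.inr (keyE hj hy)) hxy
  · exact hE _ _ _ (factorOf_inr_inr.1 hy) (factorOf_inr_inr.1 hz) hxy hxz

theorem isRook_factorOf {X : Kind} {w : Diagram k} (hw : IsSymmetricDiagram m w)
    (hr : IsRook w) (hE : IsRook (X.idempotentDiagram k m)) :
    IsRook (factorOf X w hw.rank_eq) := by
  rw [isRook_iff] at hr hE ⊢
  exact ⟨fun i j h => hr.1 i j (factorOf_inl_inl.1 h), fun i j h => hE.2 i j (factorOf_inr_inr.1 h)⟩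

/-- Only the existence of partners is new. A top vertex that does not propagate keeps its partner
from `w`, and a bottom vertex beyond the first `m` takes its partner from `e_m`. -/
theorem isBrauer_factorOf {X : Kind} (hm : m ≤ k) {w : Diagram k} (hw : IsSymmetricDiagram m w)
    (hr : IsBrauer w) (hE : IsBrauer (X.idempotentDiagram k m)) :
    IsBrauer (factorOf X w hw.rank_eq) := by
  have h1 := isRookBrauer_factorOf hw hr.isRookBrauer hE.isRookBrauer
  rw [isRookBrauer_iff] at h1
  rw [isBrauer_iff] at hr hE ⊢
  refine ⟨h1, ?_⟩
  rintro (x | x)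
  · by_cases hx : ∃ j, factorOf X w hw.rank_eq (Sum.inl x) (Sum.inr j)
    · obtain ⟨j, hj⟩ := hx
      exact ⟨Sum.inr j, by simp, hj⟩
    · obtain ⟨y | y, hxy, h⟩ := hr.2 (Sum.inl x)
      · exact ⟨Sum.inl y, hxy, factorOf_inl_inl.2 h⟩
      · exact absurd (((sameTop_factorOf X hm hw.rank_eq).2 x).2 ⟨y, h⟩) hx
  · by_cases hx : (x : ℕ) < m
    · exact ⟨Sum.inl _, by simp, Setoid.symm' _ (factorOf_inl_inr.2 ⟨hx, w.refl' _⟩)⟩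
    · obtain ⟨y | y, hxy, h⟩ := hE.2 (Sum.inr x)
      · exact absurd (idempotentDiagram_inl_inr.1 (Setoid.symm' _ h)).2 hx
      · exact ⟨Sum.inr y, hxy, factorOf_inr_inr.2 h⟩

/-- A crossing is carried back to `w` or to `e_m`. An edge to the bottom row is replaced by a
vertical edge of `w`, which exists because `w` is symmetric. -/
theorem isPlanar_factorOf {X : Kind} {w : Diagram k} (hw : IsSymmetricDiagram m w)
    (hp : IsPlanar w) (hE : IsPlanar (X.idempotentDiagram k m)) :
    IsPlanar (factorOf X w hw.rank_eq) := by
  have hmir : ∀ j : Fin m, w (Sum.inl (blockMax w hw.rank_eq j))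
      (Sum.inr (blockMax w hw.rank_eq j)) := by
    intro j
    obtain ⟨l, hl⟩ := (mem_propMax.1 (mem_propMax_blockMax hw.rank_eq j)).1
    exact hw.mirror _ l hl
  -- Clockwise, every top vertex precedes every bottom vertex. Five of the sixteen distributions
  -- over the two rows survive, according to how many of the four vertices are on top.
  rintro (a | a) (b | b) (c | c) (e | e) hab hbc hce hac hbe <;>
    simp only [pos, Sum.elim_inl, Sum.elim_inr] at hab hbc hce <;> try omega
  · exact factorOf_inl_inl.2 (hp (Sum.inl a) (Sum.inl b) (Sum.inl c) (Sum.inl e) hab hbc hce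
      (factorOf_inl_inl.1 hac) (factorOf_inl_inl.1 hbe))
  -- Three vertices on top: `b` propagates in `w`, so its mirror image can replace the bottom vertex
  -- `e`.
  · obtain ⟨he, h1⟩ := factorOf_inl_inr.1 hbe
    have h2 := hw.mirror b _ (w.trans' h1 (hmir ⟨e, he⟩))
    refine factorOf_inl_inl.2 (hp (Sum.inl a) (Sum.inl b) (Sum.inl c) (Sum.inr b) ?_ ?_ ?_
      (factorOf_inl_inl.1 hac) h2) <;> simp only [pos, Sum.elim_inl, Sum.elim_inr] <;> omega
  -- Two on top: with `A` and `B` the maximal top entries of the blocks attached to `c` and `e`, one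
  -- has `a < b ≤ B < A`. The chord from `a` to `A` then crosses the vertical edge at `B`, so
  -- planarity of `w` merges the blocks.
  · obtain ⟨hc, h1⟩ := factorOf_inl_inr.1 hac
    obtain ⟨he, h2⟩ := factorOf_inl_inr.1 hbe
    have hlt : blockMax w hw.rank_eq ⟨e, he⟩ < blockMax w hw.rank_eq ⟨c, hc⟩ :=
      (blockMax w hw.rank_eq).strictMono (show (e : ℕ) < c by omega)
    have hle : b ≤ blockMax w hw.rank_eq ⟨e, he⟩ :=
      (mem_propMax.1 (mem_propMax_blockMax hw.rank_eq ⟨e, he⟩)).2 b (w.symm' h2)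
    have h3 := hmir ⟨e, he⟩
    generalize blockMax w hw.rank_eq ⟨e, he⟩ = B at *
    generalize blockMax w hw.rank_eq ⟨c, hc⟩ = A at *
    refine factorOf_inl_inl.2 (w.trans' (hp (Sum.inl a) (Sum.inl B) (Sum.inl A) (Sum.inr B) ?_ ?_ ?_
      h1 h3) (w.symm' h2)) <;> simp only [pos, Sum.elim_inl, Sum.elim_inr] <;> omega
  -- One on top: `c` is among the first `m` bottom vertices, hence so is `e`, which lies to its
  -- left. But then `e` cannot share its block with another bottom vertex.
  · obtain ⟨hc, -⟩ := factorOf_inl_inr.1 hac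
    have := (idempotentDiagram_inr_inr_of_lt (show (e : ℕ) < m by omega)).1
      (Setoid.symm' _ (factorOf_inr_inr.1 hbe))
    subst this
    omega
  · refine factorOf_inr_inr.2 (hE _ _ (Sum.inr c) (Sum.inr e) ?_ ?_ ?_ (factorOf_inr_inr.1 hac)
      (factorOf_inr_inr.1 hbe)) <;> simp only [pos, Sum.elim_inr] <;> omega

theorem Kind.factorOf_mem (X : Kind) (hm : m ≤ k) (he : X.matching = true → Even (k - m))
    {w : Diagram k} (hw : w ∈ X.symmetricDiagrams k m) :
    factorOf X w hw.2.rank_eq ∈ X.noncrossingFactors k m := by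
  refine ⟨?_, isNoncrossingFactor_factorOf X hm hw.2.rank_eq⟩
  have hE := X.idempotentDiagram_mem he
  obtain ⟨hX, hw⟩ := hw
  cases X
  · trivial
  · exact isBrauer_factorOf hm hw hX hE
  · exact isRookBrauer_factorOf hw hX hE
  · exact isRook_factorOf hw hX hE
  · exact ⟨isBrauer_factorOf hm hw hX.1 hE.1, isPlanar_factorOf hw hX.2 hE.2⟩
  · exact ⟨isRookBrauer_factorOf hw hX.1 hE.1, isPlanar_factorOf hw hX.2 hE.2⟩
  · exact ⟨isRook_factorOf hw hX.1 hE.1, isPlanar_factorOf hw hX.2 hE.2⟩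

/-- The symmetric diagram with the same top as a noncrossing factor. -/
def Kind.mirror (X : Kind) (ω : X.noncrossingFactors k m) : X.symmetricDiagrams k m :=
  ⟨comp ω.1 (transpose ω.1), X.comp_mem ω.2.1 (X.transpose_mem ω.2.1),
    isSymmetricDiagram_mirror ω.2.2.rank_eq⟩

theorem Kind.sameTop_mirror (X : Kind) (ω : X.noncrossingFactors k m) :
    SameTop ω.1 (X.mirror ω).1 := DiagramAlgebras.sameTop_mirror ω.1

/-- The bijection between noncrossing factors and symmetric diagrams with the same top. -/
noncomputable def Kind.factorEquiv (X : Kind) (hm : m ≤ k) (he : X.matching = true → Even (k - m)) :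
    X.noncrossingFactors k m ≃ X.symmetricDiagrams k m where
  toFun := X.mirror
  invFun w := ⟨factorOf X w.1 w.2.2.rank_eq, X.factorOf_mem hm he w.2⟩
  left_inv ω := Subtype.ext ((X.factorOf_mem hm he (X.mirror ω).2).2.eq_of_sameTop he hm ω.2.2
    ((sameTop_factorOf X hm _).trans (X.sameTop_mirror ω).symm))
  right_inv w := Subtype.ext ((X.mirror _).2.2.eq_of_sameTop w.2.2
    ((X.sameTop_mirror _).symm.trans (sameTop_factorOf X hm w.2.2.rank_eq)))

theorem Kind.sameTop_factorEquiv (X : Kind) (hm : m ≤ k) (he : X.matching = true → Even (k - m))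
    (ω : X.noncrossingFactors k m) : SameTop ω.1 (X.factorEquiv hm he ω).1 :=
  X.sameTop_mirror ω

end DiagramAlgebras

namespace DiagramAlgebras

variable {k m : ℕ} {n : ℂ}

/-! ### Permutation diagrams -/

/-- The diagram joining `j'` to `e(j)`, for a permutation `e` of all vertices. -/
@[reducible] def equivDiagram (e : Equiv.Perm (Fin k)) : Diagram k := Setoid.ker (Sum.elim id e)

theorem equivDiagram_inl_inr {e : Equiv.Perm (Fin k)} {i j : Fin k} :
    equivDiagram e (Sum.inl i) (Sum.inr j) ↔ i = e j := Iff.rfl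

/-- The top row of a permutation diagram consists of separate vertices, so capping changes nothing,
and the bottom vertex `j` takes over the role of the bottom vertex `e j` of `d`. -/
theorem comp_equivDiagram (d : Diagram k) (e : Equiv.Perm (Fin k)) :
    comp d (equivDiagram e) = d.comap (Sum.map id e) := by
  have hc : capped d (equivDiagram e) = d := capped_eq_self fun i j h => by
    obtain rfl : i = j := h
    exact d.refl' _
  refine diagram_ext (fun i j => ?_) (fun i j => ?_) fun i j => ?_
  · rw [comp_top_iff, hc]
    rfl
  · rw [comp_top_bottom_iff, hc]
    constructor
    · rintro ⟨y, hy, h⟩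
      rw [equivDiagram_inl_inr.1 hy] at h
      exact h
    · exact fun h => ⟨e j, rfl, h⟩
  · have h1 : ∀ i, stack d (equivDiagram e) (Sum.inr (Sum.inr i)) (upper (Sum.inr (e i))) :=
      fun i => stack_lower (a := Sum.inr i) (b := Sum.inl (e i)) rfl
    constructor
    · intro h
      have h2 := (stack d (equivDiagram e)).trans' ((stack d (equivDiagram e)).symm' (h1 i))
        ((stack d (equivDiagram e)).trans' h (h1 j))
      rw [stack_upper_iff, hc] at h2
      exact h2
    · intro h
      have h2 : stack d (equivDiagram e) (upper (Sum.inr (e i))) (upper (Sum.inr (e j))) :=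
        stack_upper h
      exact (stack d (equivDiagram e)).trans' (h1 i) ((stack d (equivDiagram e)).trans' h2
        ((stack d (equivDiagram e)).symm' (h1 j)))

theorem transpose_equivDiagram (e : Equiv.Perm (Fin k)) :
    transpose (equivDiagram e) = equivDiagram e⁻¹ := by
  refine diagram_ext (fun i j => ?_) (fun i j => ?_) fun i j => ?_
  · exact e.injective.eq_iff
  · change e i = j ↔ i = e.symm j
    exact e.eq_symm_apply.symm
  · change i = j ↔ e.symm i = e.symm j
    exact e.symm.injective.eq_iff.symm

theorem equivDiagram_comp (d : Diagram k) (e : Equiv.Perm (Fin k)) :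
    comp (equivDiagram e) d = d.comap (Sum.map e.symm id) := by
  rw [← transpose_transpose (comp _ _), comp_transpose, transpose_equivDiagram, comp_equivDiagram]
  ext x y
  rcases x with x | x <;> rcases y with y | y <;> rfl

theorem loops_equivDiagram_right (d : Diagram k) (e : Equiv.Perm (Fin k)) :
    loops d (equivDiagram e) = 0 := loops_eq_zero fun i => ⟨e.symm i, (e.apply_symm_apply i).symm⟩

theorem loops_equivDiagram_left (d : Diagram k) (e : Equiv.Perm (Fin k)) :
    loops (equivDiagram e) d = 0 := by
  rw [loops, Nat.card_eq_zero]
  left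
  constructor
  rintro ⟨c, hc⟩
  obtain ⟨x, rfl⟩ := Quotient.exists_rep c
  obtain ⟨j, rfl⟩ := hc x rfl
  obtain ⟨i, hi⟩ := hc (Sum.inl (e j)) (Quotient.sound
    (stack_upper (a := Sum.inl (e j)) (b := Sum.inr j) rfl))
  simp at hi

/-- A permutation of the first `m` vertices, extended by the identity. -/
noncomputable def extendPerm (hm : m ≤ k) : Equiv.Perm (Fin m) →* Equiv.Perm (Fin k) :=
  Equiv.Perm.viaEmbeddingHom (Fin.castLEEmb hm)

theorem extendPerm_castLE (hm : m ≤ k) (σ : Equiv.Perm (Fin m)) (j : Fin m) :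
    extendPerm hm σ (Fin.castLE hm j) = Fin.castLE hm (σ j) :=
  Equiv.Perm.viaEmbedding_apply σ (Fin.castLEEmb hm) j

theorem extendPerm_of_le (hm : m ≤ k) (σ : Equiv.Perm (Fin m)) {j : Fin k} (hj : m ≤ (j : ℕ)) :
    extendPerm hm σ j = j := by
  refine Equiv.Perm.viaEmbedding_apply_of_notMem σ (Fin.castLEEmb hm) j ?_
  rintro ⟨i, rfl⟩
  exact absurd i.2 (not_lt.2 hj)

theorem extendPerm_lt_iff (hm : m ≤ k) (σ : Equiv.Perm (Fin m)) {j : Fin k} :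
    (extendPerm hm σ j : ℕ) < m ↔ (j : ℕ) < m := by
  rcases lt_or_ge (j : ℕ) m with hj | hj
  · have h := extendPerm_castLE hm σ ⟨j, hj⟩
    rw [show Fin.castLE hm ⟨j, hj⟩ = j from rfl] at h
    rw [h]
    simp [hj]
  · rw [extendPerm_of_le hm σ hj]

theorem permDiagram_eq (hm : m ≤ k) (σ : Equiv.Perm (Fin m)) :
    permDiagram k σ = equivDiagram (extendPerm hm σ) := by
  have hval : ∀ j : Fin k, (if h : (j : ℕ) < m then (σ ⟨j, h⟩ : ℕ) else j) =
      (extendPerm hm σ j : ℕ) := by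
    intro j
    split_ifs with hj
    · exact congrArg Fin.val (extendPerm_castLE hm σ ⟨j, hj⟩).symm
    · rw [extendPerm_of_le hm σ (not_lt.1 hj)]
  refine diagram_ext (fun i j => ?_) (fun i j => ?_) fun i j => ?_ <;>
    rw [Setoid.ker_def, Setoid.ker_def] <;>
    simp only [Sum.elim_inl, Sum.elim_inr, hval, id_eq, Fin.ext_iff]

theorem diag_mul_permDiagram (hm : m ≤ k) (d : Diagram k) (σ : Equiv.Perm (Fin m)) :
    diag n d * diag n (permDiagram k σ) = diag n (comp d (permDiagram k σ)) := by
  rw [diag_mul_diag, permDiagram_eq hm, loops_equivDiagram_right, pow_zero, one_smul]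

theorem permDiagram_mul_diag (hm : m ≤ k) (d : Diagram k) (σ : Equiv.Perm (Fin m)) :
    diag n (permDiagram k σ) * diag n d = diag n (comp (permDiagram k σ) d) := by
  rw [diag_mul_diag, permDiagram_eq hm, loops_equivDiagram_left, pow_zero, one_smul]

theorem permDiagram_one (k m : ℕ) : permDiagram k (1 : Equiv.Perm (Fin m)) = idDiagram k := by
  refine diagram_ext (fun i j => ?_) (fun i j => ?_) fun i j => ?_ <;>
    rw [Setoid.ker_def, Setoid.ker_def] <;>
    simp [Fin.ext_iff]

theorem permDiagram_mul (hm : m ≤ k) (σ τ : Equiv.Perm (Fin m)) :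
    diag n (permDiagram k (σ * τ)) = diag n (permDiagram k σ) * diag n (permDiagram k τ) := by
  rw [diag_mul_permDiagram hm]
  congr 1
  rw [permDiagram_eq hm, permDiagram_eq hm, permDiagram_eq hm, comp_equivDiagram, map_mul]
  ext x y
  rcases x with x | x <;> rcases y with y | y <;> rfl

/-- The permutation moves only the first `m` vertices, which are alone among the bottom vertices of
their blocks, and fixes all others. -/
theorem idempotentDiagram_extendPerm {X : Kind} (hm : m ≤ k) (σ : Equiv.Perm (Fin m))
    {i j : Fin k} :
    X.idempotentDiagram k m (Sum.inr (extendPerm hm σ i)) (Sum.inr (extendPerm hm σ j)) ↔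
      X.idempotentDiagram k m (Sum.inr i) (Sum.inr j) := by
  have key : ∀ i j : Fin k, (i : ℕ) < m →
      (X.idempotentDiagram k m (Sum.inr (extendPerm hm σ i)) (Sum.inr (extendPerm hm σ j)) ↔
        X.idempotentDiagram k m (Sum.inr i) (Sum.inr j)) := by
    intro i j hi
    rw [idempotentDiagram_inr_inr_of_lt hi,
      idempotentDiagram_inr_inr_of_lt ((extendPerm_lt_iff hm σ).2 hi)]
    exact (extendPerm hm σ).injective.eq_iff
  rcases lt_or_ge (i : ℕ) m with hi | hi
  · exact key i j hi
  · rcases lt_or_ge (j : ℕ) m with hj | hj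
    · exact ⟨fun h => Setoid.symm' _ ((key j i hj).1 (Setoid.symm' _ h)),
        fun h => Setoid.symm' _ ((key j i hj).2 (Setoid.symm' _ h))⟩
    · rw [extendPerm_of_le hm σ hi, extendPerm_of_le hm σ hj]

theorem comp_permDiagram_inl_inr (hm : m ≤ k) {ω : Diagram k} {σ : Equiv.Perm (Fin m)}
    {i j : Fin k} : comp ω (permDiagram k σ) (Sum.inl i) (Sum.inr j) ↔
      ω (Sum.inl i) (Sum.inr (extendPerm hm σ j)) := by
  rw [permDiagram_eq hm, comp_equivDiagram]
  rfl

theorem comp_permDiagram_inl_inl (hm : m ≤ k) {ω : Diagram k} {σ : Equiv.Perm (Fin m)}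
    {i j : Fin k} : comp ω (permDiagram k σ) (Sum.inl i) (Sum.inl j) ↔
      ω (Sum.inl i) (Sum.inl j) := by
  rw [permDiagram_eq hm, comp_equivDiagram]
  rfl

theorem comp_permDiagram_inr_inr (hm : m ≤ k) {ω : Diagram k} {σ : Equiv.Perm (Fin m)}
    {i j : Fin k} : comp ω (permDiagram k σ) (Sum.inr i) (Sum.inr j) ↔
      ω (Sum.inr (extendPerm hm σ i)) (Sum.inr (extendPerm hm σ j)) := by
  rw [permDiagram_eq hm, comp_equivDiagram]
  rfl

/-- This allows `p e_m` to be rewritten as `e_m p`, with the permutations below the factor as in `ω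
v`. -/
theorem comp_permDiagram_idempotentDiagram (X : Kind) (hm : m ≤ k) (σ : Equiv.Perm (Fin m)) :
    comp (permDiagram k σ) (X.idempotentDiagram k m) =
      comp (X.idempotentDiagram k m) (permDiagram k σ) := by
  have hs : ∀ i, (extendPerm hm σ).symm i = extendPerm hm σ⁻¹ i := by
    intro i
    rw [map_inv]
    rfl
  rw [permDiagram_eq hm, equivDiagram_comp, comp_equivDiagram]
  refine diagram_ext (fun i j => ?_) (fun i j => ?_) fun i j => ?_ <;>
    simp only [Setoid.comap_rel, Sum.map_inl, Sum.map_inr, id_eq]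
  · rw [hs, hs, idempotentDiagram_inl_inl, idempotentDiagram_inl_inl, idempotentDiagram_extendPerm]
  · rw [idempotentDiagram_inl_inr, idempotentDiagram_inl_inr, extendPerm_lt_iff,
      Equiv.symm_apply_eq]
  · rw [idempotentDiagram_extendPerm]

theorem sameTop_comp_permDiagram (hm : m ≤ k) (ω : Diagram k) (σ : Equiv.Perm (Fin m)) :
    SameTop (comp ω (permDiagram k σ)) ω := by
  refine ⟨fun i j => comp_permDiagram_inl_inl hm, fun i => ?_⟩
  simp only [comp_permDiagram_inl_inr hm]
  constructor
  · rintro ⟨j, hj⟩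
    exact ⟨_, hj⟩
  · rintro ⟨j, hj⟩
    exact ⟨(extendPerm hm σ).symm j, by rwa [Equiv.apply_symm_apply]⟩

theorem IsFactor.comp_permDiagram {X : Kind} (hm : m ≤ k) {ω : Diagram k} (hω : IsFactor X m ω)
    (σ : Equiv.Perm (Fin m)) : IsFactor X m (DiagramAlgebras.comp ω (permDiagram k σ)) := by
  refine ⟨fun i j => ?_, fun j => ?_⟩
  · rw [comp_permDiagram_inr_inr hm, hω.bottom, idempotentDiagram_extendPerm]
  · simp only [comp_permDiagram_inl_inr hm]
    rw [hω.propagates, extendPerm_lt_iff]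

/-- A factorization into a noncrossing factor and a permutation is unique. -/
theorem IsNoncrossingFactor.comp_permDiagram_inj {X : Kind} (hm : m ≤ k)
    (he : X.matching = true → Even (k - m)) {ω ω' : Diagram k} (hω : IsNoncrossingFactor X m ω)
    (hω' : IsNoncrossingFactor X m ω') {σ σ' : Equiv.Perm (Fin m)}
    (h : comp ω (permDiagram k σ) = comp ω' (permDiagram k σ')) : ω = ω' ∧ σ = σ' := by
  have h1 : ω = ω' := by
    refine hω.eq_of_sameTop he hm hω' ((sameTop_comp_permDiagram hm ω σ).symm.trans ?_)
    rw [h]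
    exact sameTop_comp_permDiagram hm ω' σ'
  subst h1
  refine ⟨rfl, ?_⟩
  ext1 j
  obtain ⟨i, hi⟩ := hω.propagating (Fin.castLE hm (σ j)) (σ j).2
  rw [← extendPerm_castLE, ← comp_permDiagram_inl_inr hm, h, comp_permDiagram_inl_inr hm,
    extendPerm_castLE] at hi
  -- The top vertex `i'` is joined in `ω` to the bottom vertices `σ j` and `σ' j`; these coincide,
  -- because the first `m` bottom vertices of a factor lie in different blocks.
  obtain ⟨i', hi'⟩ := hω.propagating (Fin.castLE hm (σ j)) (σ j).2
  have hi'' := hi'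
  rw [← extendPerm_castLE, ← comp_permDiagram_inl_inr hm, h, comp_permDiagram_inl_inr hm,
    extendPerm_castLE] at hi''
  exact Fin.castLE_injective hm ((hω.isFactor he).eq_of_bottom (i := Fin.castLE hm (σ j)) (σ j).2
    (ω.trans' (ω.symm' hi') hi''))

/-! ### The action of a diagram on a noncrossing factor -/

theorem rank_comp_eq {d ω w : Diagram k} (hw : IsSymmetricDiagram m w) (h : SameTop ω w) :
    rank (comp d ω) = rank (conj d w) :=
  (h.comp.trans (sameTop_conj hw)).rank_eq

/-- If `d ∘ w ∘ dᵀ` has rank `m` then `d ∘ ω` is the noncrossing factor of `d ∘ w ∘ dᵀ`, twisted. -/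
theorem comp_eq_comp_twist {X : Kind} (hm : m ≤ k) (he : X.matching = true → Even (k - m))
    {d ω ω' w : Diagram k} (hω : IsNoncrossingFactor X m ω) (hω' : IsNoncrossingFactor X m ω')
    (hw : IsSymmetricDiagram m w) (h : SameTop ω w) (hr : rank (conj d w) = m)
    (h' : SameTop ω' (conj d w)) : comp d ω = comp ω' (permDiagram k (twist hw hr)) := by
  have hst : SameTop (comp d ω) ω' := (h.comp.trans (sameTop_conj hw)).trans h'.symm
  have hc := capped_congr (d := d) h
  refine ((hω.isFactor he).comp ((rank_comp_eq hw h).trans hr)).ext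
    ((hω'.isFactor he).comp_permDiagram hm _) (fun i j => ?_) fun i j hj => ?_
  · rw [hst.1, comp_permDiagram_inl_inl hm]
  · have hj' : j = Fin.castLE hm ⟨j, hj⟩ := rfl
    generalize (⟨j, hj⟩ : Fin m) = l at hj'
    subst hj'
    rw [comp_permDiagram_inl_inr hm, extendPerm_castLE, hω'.inl_inr hm,
      h'.blockMax_eq hω'.rank_eq hr, ← hst.1, comp_top_iff, comp_top_bottom_iff, hc]
    -- The twist is defined through bottom vertices of `d ∘ w`. Translated to the capped diagram,
    -- the maximal entry of the `l`-th block of `w` is joined to the block of the conjugate with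
    -- number `σ_{d,w}(l)`. Both sides of the goal then say that `i` is joined to this block.
    obtain ⟨y, hy, hty⟩ := comp_top_bottom_iff.1 (isTwist_twist hw hr l)
    have h1 : capped d w (Sum.inl (blockMax (conj d w) hr (twist hw hr l)))
        (Sum.inr (blockMax w hw.rank_eq l)) :=
      (capped d w).trans' hty (capped_inr (hw.inl_inr.1 hy).1)
    constructor
    · rintro ⟨z, hz, hiz⟩
      rw [hω.inl_inr hm, h.1, h.blockMax_eq hω.rank_eq hw.rank_eq] at hz
      exact (capped d w).trans' hiz ((capped d w).trans' (capped_inr hz)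
        ((capped d w).symm' h1))
    · intro h2
      refine ⟨blockMax w hw.rank_eq l, ?_, (capped d w).trans' h2 h1⟩
      rw [hω.inl_inr hm, h.1, h.blockMax_eq hω.rank_eq hw.rank_eq]

theorem Kind.isPlanar_of_mem {X : Kind} (hX : X.planar = true) {d : Diagram k}
    (hd : d ∈ X.diagrams k) : IsPlanar d := by
  cases X
  all_goals first | exact hd.2 | simp [Kind.planar] at hX

/-- Planar diagrams do not permute the propagating blocks. -/
theorem twist_eq_one {X : Kind} (hX : X.planar = true) (hm : m ≤ k)
    (he : X.matching = true → Even (k - m)) {d : Diagram k} (hd : d ∈ X.diagrams k)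
    {w : Diagram k} (hw : w ∈ X.symmetricDiagrams k m) (hr : rank (conj d w) = m) :
    twist hw.2 hr = 1 := by
  have hω := X.factorOf_mem hm he hw
  have h := sameTop_factorOf X hm hw.2.rank_eq
  have hω' := X.factorOf_mem hm he (X.conj_mem hd hw hr)
  have h' := sameTop_factorOf X hm hr
  have key := comp_eq_comp_twist hm he hω.2 hω'.2 hw.2 h hr h'
  have hfac := (hω.2.isFactor he).comp ((rank_comp_eq hw.2 h).trans hr)
  have hnc := hfac.isNoncrossingFactor_of_isPlanar hm
    (X.isPlanar_of_mem hX (X.comp_mem hd hω.1))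
  -- The diagram `d ∘ ω` is planar, hence itself a noncrossing factor with trivial permutation. The
  -- factorization with the twist must be this one.
  refine (hnc.comp_permDiagram_inj hm he hω'.2 (σ := 1) ?_).2.symm
  rw [permDiagram_one, comp_idDiagram, key]

/-! ### Right multiplication of factors by the diagram of `e_m` -/

theorem isNoncrossingFactor_idempotentDiagram (X : Kind) (hm : m ≤ k) :
    IsNoncrossingFactor X m (X.idempotentDiagram k m) := by
  refine (isFactor_idempotentDiagram X).isNoncrossingFactor hm ?_
  intro j j' hjj _ i _ i' _ hij hij'
  rw [(idempotentDiagram_inl_inr.1 hij).1, (idempotentDiagram_inl_inr.1 hij').1]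
  exact hjj

/-- The bottom row of a factor is already partitioned as the top row of `e_m`, so capping joins
nothing. In the algebra, right multiplication by the diagram of `e_m` is therefore a power of `n` on
factors. -/
theorem IsFactor.comp_idempotentDiagram {X : Kind} {ω : Diagram k} (hω : IsFactor X m ω) :
    DiagramAlgebras.comp ω (X.idempotentDiagram k m) = ω := by
  have hc : capped ω (X.idempotentDiagram k m) = ω := capped_eq_self fun i j h =>
    (hω.bottom i j).2 (idempotentDiagram_inl_inl.1 h)
  refine diagram_ext (fun i j => by rw [comp_top_iff, hc]) (fun i j => ?_) fun i j => ?_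
  · rw [comp_top_bottom_iff, hc]
    constructor
    · rintro ⟨y, hy, h⟩
      rwa [(idempotentDiagram_inl_inr.1 hy).1] at h
    · exact fun h => ⟨j, idempotentDiagram_inl_inr.2 ⟨rfl, (hω.propagates j).1 ⟨i, h⟩⟩, h⟩
  · rcases lt_or_ge (i : ℕ) m with hi | hi
    · have hii : stack ω (X.idempotentDiagram k m) (Sum.inr (Sum.inr i)) (upper (Sum.inr i)) :=
        stack_lower (a := Sum.inr i) (b := Sum.inl i)
          (Setoid.symm' _ (idempotentDiagram_inl_inr.2 ⟨rfl, hi⟩))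
      constructor
      · intro h
        obtain ⟨y, hy, h1⟩ := stack_bottom_iff.1
          ((stack ω (X.idempotentDiagram k m)).trans' ((stack _ _).symm' hii) h)
        rw [hc] at h1
        rwa [(idempotentDiagram_inl_inr.1 hy).1] at h1
      · exact fun h => stack_lower ((hω.bottom i j).1 h)
    · rw [comp_bottom_iff_of_not, hω.bottom]
      simp only [idempotentDiagram_inl_inr]
      rintro ⟨y, rfl, hy⟩
      omega

/-- For `m = k` the parameter may be zero, so the exponent of `n` itself has to vanish. -/
theorem loops_idempotentDiagram {X : Kind} (d : Diagram k) (hmk : m = k) :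
    loops d (X.idempotentDiagram k m) = 0 :=
  loops_eq_zero fun i => ⟨i, idempotentDiagram_inl_inr.2 ⟨rfl, hmk ▸ i.2⟩⟩

end DiagramAlgebras

namespace DiagramAlgebras

variable {k m : ℕ} {n : ℂ}

/-! ### The permutations in `A_k` -/

open Classical in
/-- The permutations of the propagating blocks that occur in `A_k`: all of them, or only the
identity if `A_k` is planar. -/
noncomputable def Kind.perms (X : Kind) (m : ℕ) : Finset (Equiv.Perm (Fin m)) :=
  Finset.univ.filter fun σ => X.planar = true → σ = 1

theorem Kind.mem_perms {X : Kind} {σ : Equiv.Perm (Fin m)} :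
    σ ∈ X.perms m ↔ (X.planar = true → σ = 1) := by
  simp [Kind.perms]

theorem Kind.inv_mul_mem_perms {X : Kind} {σ τ : Equiv.Perm (Fin m)} (hσ : σ ∈ X.perms m)
    (hτ : τ ∈ X.perms m) : σ⁻¹ * τ ∈ X.perms m := by
  rw [Kind.mem_perms] at *
  intro h
  rw [hσ h, hτ h, inv_one, one_mul]

theorem Kind.mul_mem_perms {X : Kind} {σ τ : Equiv.Perm (Fin m)} (hσ : σ ∈ X.perms m)
    (hτ : τ ∈ X.perms m) : σ * τ ∈ X.perms m := by
  rw [Kind.mem_perms] at *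
  intro h
  rw [hσ h, hτ h, one_mul]

theorem Kind.permDiagram_mem_of_mem_perms (X : Kind) (hm : m ≤ k) {σ : Equiv.Perm (Fin m)}
    (hσ : σ ∈ X.perms m) : permDiagram k σ ∈ X.diagrams k := by
  by_cases hX : X.planar = true
  · rw [Kind.mem_perms.1 hσ hX, permDiagram_one]
    exact X.idDiagram_mem
  · exact X.permDiagram_mem (by simpa using hX) hm σ

/-- The image in `A_k` of an element of `ℂ S_m`, omitting the permutations that do not occur. -/
noncomputable def Kind.weight (X : Kind) (k : ℕ) (n : ℂ) (m : ℕ) :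
    GroupAlgebra m →ₗ[ℂ] PartitionAlgebra k n :=
  ∑ σ ∈ X.perms m, (Finsupp.lapply σ ∘ₗ
    (MonoidAlgebra.coeffLinearEquiv ℂ).toLinearMap).smulRight (diag n (permDiagram k σ))

theorem Kind.weight_apply (X : Kind) (v : GroupAlgebra m) :
    X.weight k n m v = ∑ σ ∈ X.perms m, v.coeff σ • diag n (permDiagram k σ) := by
  simp only [Kind.weight, LinearMap.sum_apply, LinearMap.smulRight_apply]
  rfl

theorem Kind.weight_mem (X : Kind) (hm : m ≤ k) (v : GroupAlgebra m) :
    X.weight k n m v ∈ X.algebra k n := by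
  rw [Kind.weight_apply]
  exact sum_mem fun σ hσ => Subalgebra.smul_mem _
    (X.diag_mem (X.permDiagram_mem_of_mem_perms hm hσ)) _

/-- The permutations that occur are closed under products and quotients, so the sum can be reindexed
by left translation with `τ`. For planar algebras this requires `τ = 1`. -/
theorem Kind.weight_of_mul {X : Kind} (hm : m ≤ k) {τ : Equiv.Perm (Fin m)} (hτ : τ ∈ X.perms m)
    (v : GroupAlgebra m) : X.weight k n m (MonoidAlgebra.of ℂ _ τ * v) =
      diag n (permDiagram k τ) * X.weight k n m v := by
  rw [Kind.weight_apply, Kind.weight_apply, Finset.mul_sum]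
  refine Finset.sum_nbij' (τ⁻¹ * ·) (τ * ·) (fun σ hσ => Kind.inv_mul_mem_perms hτ hσ)
    (fun σ hσ => Kind.mul_mem_perms hτ hσ) (fun σ _ => by simp) (fun σ _ => by simp) ?_
  intro σ _
  rw [mul_smul_comm, ← permDiagram_mul hm, mul_inv_cancel_left, MonoidAlgebra.of_apply,
    MonoidAlgebra.coeff_single_mul_apply, one_mul]

theorem Kind.weight_mul_idempotentDiagram (X : Kind) (hm : m ≤ k) (v : GroupAlgebra m) :
    X.weight k n m v * diag n (X.idempotentDiagram k m) =
      diag n (X.idempotentDiagram k m) * X.weight k n m v := by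
  rw [Kind.weight_apply, Finset.mul_sum, Finset.sum_mul]
  refine Finset.sum_congr rfl fun σ _ => ?_
  rw [smul_mul_assoc, mul_smul_comm, permDiagram_mul_diag hm, diag_mul_permDiagram hm,
    comp_permDiagram_idempotentDiagram X hm]

theorem Kind.weight_of_not_planar {X : Kind} (hX : ¬ X.planar = true) (v : GroupAlgebra m) :
    X.weight k n m v = permElement k n v := by
  rw [Kind.weight_apply, permElement, Finsupp.sum_fintype _ _ (by simp)]
  refine Finset.sum_subset (Finset.subset_univ _) fun σ _ hσ => ?_
  exact absurd (Kind.mem_perms.2 fun h => absurd h hX) hσ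

theorem Kind.weight_of_planar {X : Kind} (hX : X.planar = true) (v : GroupAlgebra m) :
    X.weight k n m v = v.coeff 1 • 1 := by
  have h : X.perms m = {1} := by
    ext σ
    simp [Kind.mem_perms, hX]
  rw [Kind.weight_apply, h, Finset.sum_singleton, permDiagram_one, one_eq]

/-! ### The Young symmetrizer of a partition with one row -/

/-- With a single row the column group is trivial and the row group is everything. -/
theorem youngSymmetrizer_of_row {μ : YoungDiagram} (hμ : ∀ c ∈ μ.cells, c.1 = 0) :
    youngSymmetrizer μ = ∑ ρ, MonoidAlgebra.of ℂ (Equiv.Perm (Fin μ.card)) ρ := by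
  have hrow : rowGroup μ = Finset.univ := by
    rw [rowGroup, Finset.filter_true_of_mem]
    intro ρ _ i
    rw [hμ _ ((columnTableau μ).symm (ρ i)).2, hμ _ ((columnTableau μ).symm i).2]
  have hcol : columnGroup μ = {1} := by
    ext γ
    simp only [columnGroup, Finset.mem_filter, Finset.mem_univ, true_and, Finset.mem_singleton]
    constructor
    · intro h
      ext1 i
      refine (columnTableau μ).symm.injective (Subtype.ext (Prod.ext ?_ (h i)))
      rw [hμ _ ((columnTableau μ).symm (γ i)).2]
      exact (hμ _ ((columnTableau μ).symm i).2).symm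
    · rintro rfl i
      rfl
  simp [youngSymmetrizer, hrow, hcol]

theorem coeff_youngSymmetrizer_of_row {μ : YoungDiagram} (hμ : ∀ c ∈ μ.cells, c.1 = 0)
    (σ : Equiv.Perm (Fin μ.card)) : (youngSymmetrizer μ).coeff σ = 1 := by
  rw [youngSymmetrizer_of_row hμ, MonoidAlgebra.coeff_sum, Finsupp.finsetSum_apply]
  simp only [MonoidAlgebra.of_apply, MonoidAlgebra.coeff_single]
  rw [Finset.sum_eq_single σ]
  · simp
  · intro τ _ h
    simp [h]
  · simp

/-- Left translation fixes the sum of all permutations, so the left ideal generated by it contains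
only its multiples. -/
theorem coeff_spechtModule_of_row {μ : YoungDiagram} (hμ : ∀ c ∈ μ.cells, c.1 = 0)
    (v : spechtModule μ) (σ : Equiv.Perm (Fin μ.card)) : v.1.coeff σ = v.1.coeff 1 := by
  obtain ⟨v, hv⟩ := v
  obtain ⟨a, rfl⟩ := Ideal.mem_span_singleton'.1 hv
  dsimp only
  clear hv
  induction a using MonoidAlgebra.induction_on with
  | of τ =>
    rw [MonoidAlgebra.of_apply, MonoidAlgebra.coeff_single_mul_apply,
      MonoidAlgebra.coeff_single_mul_apply, coeff_youngSymmetrizer_of_row hμ,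
      coeff_youngSymmetrizer_of_row hμ]
  | add x y hx hy =>
    rw [add_mul, MonoidAlgebra.coeff_add, Finsupp.add_apply, Finsupp.add_apply, hx, hy]
  | smul r x hx =>
    rw [smul_mul_assoc, MonoidAlgebra.coeff_smul, Finsupp.smul_apply, Finsupp.smul_apply, hx]

/-- A standard filling of one row is increasing, and an increasing bijection of a finite chain is
the identity. -/
theorem tableauPerm_of_row {μ : YoungDiagram} (hμ : ∀ c ∈ μ.cells, c.1 = 0) {t : Tableau μ}
    (ht : IsStandard t) : tableauPerm t = 1 := by
  have hmono : StrictMono (tableauPerm t) := by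
    intro i j hij
    refine ht.1 _ _ ?_ ?_
    · rw [hμ _ ((columnTableau μ).symm i).2, hμ _ ((columnTableau μ).symm j).2]
    · have h := columnTableau_lt_iff ((columnTableau μ).symm i) ((columnTableau μ).symm j)
      rw [Equiv.apply_symm_apply, Equiv.apply_symm_apply] at h
      rcases h.1 hij with h | h
      · exact h
      · rw [hμ _ ((columnTableau μ).symm i).2, hμ _ ((columnTableau μ).symm j).2] at h
        exact absurd h.2 (lt_irrefl _)
  have h := Subsingleton.elim (hmono.orderIsoOfSurjective _ (tableauPerm t).surjective)
    (OrderIso.refl _)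
  ext1 i
  exact congrArg (fun f : Fin μ.card ≃o Fin μ.card => f i) h

/-- This reconciles the two conventions for `p`: in the planar case the symmetrizer has coefficient
one at the identity, which matches `p = 1`. -/
theorem Kind.weight_youngSymmetrizer {X : Kind} {μ : YoungDiagram} (hμ : μ ∈ X.labels k) :
    X.weight k n μ.card (youngSymmetrizer μ) = X.youngElement k n μ := by
  rw [Kind.youngElement]
  split_ifs with hX
  · rw [Kind.weight_of_planar hX, coeff_youngSymmetrizer_of_row (hμ.2.2 hX), one_smul]
  · rw [Kind.weight_of_not_planar hX]

/-- All permutations occur here, so `weight_of_mul` applies to every basis element and linearity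
does the rest. In the planar case, truncation to the identity coefficient would not be
multiplicative. -/
theorem Kind.weight_mul_youngSymmetrizer {X : Kind} {μ : YoungDiagram} (hμ : μ ∈ X.labels k)
    (hX : ¬ X.planar = true) (a : GroupAlgebra μ.card) :
    X.weight k n μ.card (a * youngSymmetrizer μ) =
      X.weight k n μ.card a * X.youngElement k n μ := by
  rw [← Kind.weight_youngSymmetrizer hμ]
  induction a using MonoidAlgebra.induction_on with
  | of τ =>
    have hτ : τ ∈ X.perms μ.card := Kind.mem_perms.2 fun h => absurd h hX
    have h1 := Kind.weight_of_mul (n := n) hμ.1 hτ 1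
    have h2 : X.weight k n μ.card 1 = 1 := by
      rw [Kind.weight_of_not_planar hX, permElement, MonoidAlgebra.one_def,
        MonoidAlgebra.coeff_single, Finsupp.sum_single_index (by simp), one_smul, permDiagram_one,
        one_eq]
    rw [mul_one, h2, mul_one] at h1
    rw [Kind.weight_of_mul hμ.1 hτ, h1]
  | add x y hx hy => rw [add_mul, map_add, map_add, hx, hy, add_mul]
  | smul r x hx => rw [smul_mul_assoc, map_smul, map_smul, hx, smul_mul_assoc]

/-- The image of the Specht module lies in the left ideal of the Young element. -/
theorem Kind.exists_weight_eq {X : Kind} {μ : YoungDiagram} (hμ : μ ∈ X.labels k)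
    (v : spechtModule μ) : ∃ a ∈ X.algebra k n,
      X.weight k n μ.card v.1 = a * X.youngElement k n μ := by
  by_cases hX : X.planar = true
  · refine ⟨v.1.coeff 1 • 1, Subalgebra.smul_mem _ (one_mem _) _, ?_⟩
    rw [Kind.weight_of_planar hX, Kind.youngElement, if_pos hX, mul_one]
  · obtain ⟨v, hv⟩ := v
    obtain ⟨a, rfl⟩ := Ideal.mem_span_singleton'.1 hv
    exact ⟨_, X.weight_mem hμ.1 a, Kind.weight_mul_youngSymmetrizer hμ hX a⟩

/-- Standardness matters in the planar case: it forces the permutation of the tableau to be the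
identity, the only one that occurs. -/
theorem Kind.weight_naturalVector {X : Kind} {μ : YoungDiagram} (hμ : μ ∈ X.labels k)
    {t : Tableau μ} (ht : IsStandard t) : X.weight k n μ.card (naturalVector t).1 =
      diag n (permDiagram k (tableauPerm t)) * X.youngElement k n μ := by
  rw [← Kind.weight_youngSymmetrizer hμ]
  exact Kind.weight_of_mul hμ.1 (Kind.mem_perms.2 fun h => tableauPerm_of_row (hμ.2.2 h) ht) _

/-- An element of the Specht module is determined by the coefficients of the permutations that
occur in `A_k`. -/
theorem Kind.eq_zero_of_coeff {X : Kind} {μ : YoungDiagram} (hμ : μ ∈ X.labels k)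
    (v : spechtModule μ) (h : ∀ σ ∈ X.perms μ.card, v.1.coeff σ = 0) : v = 0 := by
  apply Subtype.ext
  apply MonoidAlgebra.ext
  ext σ
  change v.1.coeff σ = 0
  by_cases hX : X.planar = true
  · rw [coeff_spechtModule_of_row (hμ.2.2 hX)]
    exact h 1 (Kind.mem_perms.2 fun _ => rfl)
  · exact h σ (Kind.mem_perms.2 fun h => absurd h hX)

end DiagramAlgebras

namespace DiagramAlgebras

variable {k m : ℕ} {n : ℂ}

/-! ### The isomorphism -/

/-- The image of `v ∈ ℂ S_m` in `A_k`. -/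
noncomputable def Kind.weightMap (X : Kind) (n : ℂ) (hm : m ≤ k) :
    GroupAlgebra m →ₗ[ℂ] X.algebra k n :=
  (X.weight k n m).codRestrict (Subalgebra.toSubmodule (X.algebra k n)) (X.weight_mem hm)

theorem Kind.coe_weightMap (X : Kind) (hm : m ≤ k) (v : GroupAlgebra m) :
    (X.weightMap n hm v : PartitionAlgebra k n) = X.weight k n m v := rfl

/-- The noncrossing factor with the same top as the symmetric diagram `w`. -/
noncomputable def Kind.factor (X : Kind) {μ : YoungDiagram} (hμ : μ ∈ X.labels k)
    (w : X.symmetricDiagrams k μ.card) : X.noncrossingFactors k μ.card :=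
  (X.factorEquiv hμ.1 hμ.2.1).symm w

theorem Kind.sameTop_factor (X : Kind) {μ : YoungDiagram} (hμ : μ ∈ X.labels k)
    (w : X.symmetricDiagrams k μ.card) : SameTop (X.factor hμ w).1 w.1 := by
  have h := X.sameTop_factorEquiv hμ.1 hμ.2.1 (X.factor hμ w)
  rwa [Kind.factor, Equiv.apply_symm_apply] at h

theorem Kind.factor_injective (X : Kind) {μ : YoungDiagram} (hμ : μ ∈ X.labels k) :
    Function.Injective (X.factor hμ) := Equiv.injective _

/-- A diagram in `𝒜_k` as an element of `A_k`. -/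
noncomputable def Kind.diag (X : Kind) (n : ℂ) {d : Diagram k} (hd : d ∈ X.diagrams k) :
    X.algebra k n := ⟨DiagramAlgebras.diag n d, X.diag_mem hd⟩

/-- The linear map `A_k^λ → A_k` that sends `w ⊗ v` to `ω v`. -/
noncomputable def Kind.liftMap (X : Kind) (n : ℂ) {μ : YoungDiagram} (hμ : μ ∈ X.labels k) :
    X.twistedModule k μ →ₗ[ℂ] X.algebra k n :=
  TensorProduct.lift <| Finsupp.lift _ ℂ _ fun w =>
    LinearMap.mulLeft ℂ (X.diag n (X.factor hμ w).2.1) ∘ₗ X.weightMap n hμ.1 ∘ₗ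
      (spechtModule μ).subtype.restrictScalars ℂ

theorem Kind.liftMap_tmul (X : Kind) {μ : YoungDiagram} (hμ : μ ∈ X.labels k)
    (w : X.symmetricDiagrams k μ.card) (v : spechtModule μ) :
    X.liftMap n hμ (Finsupp.single w 1 ⊗ₜ[ℂ] v) =
      X.diag n (X.factor hμ w).2.1 * X.weightMap n hμ.1 v.1 := by
  rw [Kind.liftMap, TensorProduct.lift.tmul, Finsupp.lift_apply,
    Finsupp.sum_single_index (by simp), one_smul]
  rfl

/-- Scalars are absorbed into the Specht factor, so tensors with a basis diagram suffice. -/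
theorem twistedModule_induction {X : Kind} {μ : YoungDiagram}
    {P : X.twistedModule k μ → Prop} (x : X.twistedModule k μ) (h0 : P 0)
    (hadd : ∀ x y, P x → P y → P (x + y))
    (h : ∀ w v, P (Finsupp.single w 1 ⊗ₜ[ℂ] v)) : P x := by
  induction x using TensorProduct.induction_on with
  | zero => exact h0
  | add x y hx hy => exact hadd x y hx hy
  | tmul f v =>
    induction f using Finsupp.induction_linear with
    | zero => rwa [TensorProduct.zero_tmul]
    | add f g hf hg =>
      rw [TensorProduct.add_tmul]
      exact hadd _ _ hf hg
    | single w r =>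
      have h1 : Finsupp.single w r = r • Finsupp.single w (1 : ℂ) := by simp
      rw [h1, TensorProduct.smul_tmul]
      exact h w _

/-! ### Coefficients and injectivity modulo `J_{m-1}` -/

theorem diagBasis_coord_diag (d d' : Diagram k) [Decidable (d' = d)] :
    (diagBasis k n).coord d (diag n d') = if d' = d then 1 else 0 := by
  rw [← diagBasis_apply, Module.Basis.coord_apply, Module.Basis.repr_self, Finsupp.single_apply]

open Classical in
/-- The coefficients of an element of `A_k^λ` are those of its image in `A_k`. -/
theorem Kind.coord_liftMap (X : Kind) {μ : YoungDiagram} (hμ : μ ∈ X.labels k)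
    (x : X.twistedModule k μ) (w : X.symmetricDiagrams k μ.card) {σ : Equiv.Perm (Fin μ.card)}
    (hσ : σ ∈ X.perms μ.card) :
    (diagBasis k n).coord (comp (X.factor hμ w).1 (permDiagram k σ)) (X.liftMap n hμ x).1 =
      (TensorProduct.finsuppScalarLeft ℂ (spechtModule μ) _ x w).1.coeff σ := by
  induction x using twistedModule_induction with
  | h0 =>
    simp only [map_zero, Finsupp.zero_apply, ZeroMemClass.coe_zero]
    rfl
  | hadd x y hx hy =>
    rw [map_add, map_add, Subalgebra.coe_add, map_add, hx, hy]
    rfl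
  | h w' v =>
    rw [Kind.liftMap_tmul, Subalgebra.coe_mul, Kind.coe_weightMap, Kind.weight_apply,
      Finset.mul_sum, map_sum, TensorProduct.finsuppScalarLeft_apply_tmul,
      Finsupp.sum_single_index (by simp), one_smul]
    simp only [Kind.diag, mul_smul_comm, map_smul, diag_mul_permDiagram hμ.1,
      diagBasis_coord_diag, smul_eq_mul, mul_ite, mul_one, mul_zero]
    -- By uniqueness of the factorization, `ω' ∘ τ` equals `ω ∘ σ` only if both components agree, so
    -- at most one term of the sum survives.
    by_cases hw : w' = w
    · subst hw
      rw [Finset.sum_eq_single σ, if_pos rfl, Finsupp.single_eq_same]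
      · intro τ _ hτ
        rw [if_neg]
        intro h
        exact hτ ((X.factor hμ w').2.2.comp_permDiagram_inj hμ.1 hμ.2.1 (X.factor hμ w').2.2
          h).2
      · exact fun h => absurd hσ h
    · rw [Finset.sum_eq_zero, Finsupp.single_eq_of_ne (Ne.symm hw)]
      · rfl
      · intro τ _
        rw [if_neg]
        intro h
        exact hw (X.factor_injective hμ (Subtype.ext ((X.factor hμ w').2.2.comp_permDiagram_inj
          hμ.1 hμ.2.1 (X.factor hμ w).2.2 h).1))

theorem coord_eq_zero_of_mem_ideal {X : Kind} {a : X.algebra k n} (ha : a ∈ X.ideal k n m)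
    {d : Diagram k} (hd : rank d = m) : (diagBasis k n).coord d a.1 = 0 := by
  classical
  have ha : a.1 ∈ Submodule.span ℂ
    (DiagramAlgebras.diag n '' {d | d ∈ X.diagrams k ∧ rank d < m}) := ha
  refine Submodule.span_le (p := LinearMap.ker ((diagBasis k n).coord d)) |>.2 ?_ ha
  rintro _ ⟨d', ⟨-, hd'⟩, rfl⟩
  rw [SetLike.mem_coe, LinearMap.mem_ker, diagBasis_coord_diag, if_neg]
  rintro rfl
  omega

/-- The linear map `A_k^λ → A_k / J_{m-1}` that sends `w ⊗ v` to the class of `ω v`. -/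
noncomputable def Kind.quotientMap (X : Kind) (n : ℂ) {μ : YoungDiagram} (hμ : μ ∈ X.labels k) :
    X.twistedModule k μ →ₗ[ℂ] X.algebra k n ⧸ X.ideal k n μ.card :=
  (X.ideal k n μ.card).mkQ.restrictScalars ℂ ∘ₗ X.liftMap n hμ

theorem Kind.quotientMap_apply (X : Kind) {μ : YoungDiagram} (hμ : μ ∈ X.labels k)
    (x : X.twistedModule k μ) :
    X.quotientMap n hμ x = (X.ideal k n μ.card).mkQ (X.liftMap n hμ x) := rfl

/-- The coefficient at `ω ∘ σ` is not affected by the ideal, because this diagram has rank `m`. All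
the coefficients that determine an element of `A_k^λ` can be recovered in this way. -/
theorem Kind.quotientMap_injective (X : Kind) {μ : YoungDiagram} (hμ : μ ∈ X.labels k) :
    Function.Injective (X.quotientMap n hμ) := by
  classical
  rw [injective_iff_map_eq_zero]
  intro x hx
  rw [Kind.quotientMap_apply, Submodule.mkQ_apply, Submodule.Quotient.mk_eq_zero] at hx
  apply (TensorProduct.finsuppScalarLeft ℂ (spechtModule μ) _).injective
  rw [map_zero]
  ext1 w
  refine Kind.eq_zero_of_coeff hμ _ fun σ hσ => ?_
  rw [← X.coord_liftMap (n := n) hμ x w hσ]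
  refine coord_eq_zero_of_mem_ideal hx ?_
  rw [(sameTop_comp_permDiagram hμ.1 _ σ).rank_eq]
  exact (X.factor hμ w).2.2.rank_eq

/-- `Kind.ideal` provides a left ideal. Stability on the right is needed because a product `d ω` of
low rank is still multiplied on the right by the image of `v`. -/
theorem Kind.ideal_mul_mem {X : Kind} {a b : X.algebra k n} (ha : a ∈ X.ideal k n m) :
    a * b ∈ X.ideal k n m := by
  obtain ⟨a, ha'⟩ := a
  obtain ⟨b, hb⟩ := b
  have ha : a ∈ Submodule.span ℂ
    (DiagramAlgebras.diag n '' {d | d ∈ X.diagrams k ∧ rank d < m}) := ha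
  change a * b ∈ Submodule.span ℂ
    (DiagramAlgebras.diag n '' {d | d ∈ X.diagrams k ∧ rank d < m})
  refine Submodule.span_induction₂ (p := fun a b _ _ => a * b ∈ Submodule.span ℂ
    (DiagramAlgebras.diag n '' {d | d ∈ X.diagrams k ∧ rank d < m}))
    ?_ ?_ ?_ ?_ ?_ ?_ ?_ ha hb
  · rintro _ _ ⟨d₁, ⟨h₁, h₃⟩, rfl⟩ ⟨d₂, h₂, rfl⟩
    rw [diag_mul_diag]
    exact Submodule.smul_mem _ _ (Submodule.subset_span
      ⟨_, ⟨X.comp_mem h₁ h₂, (rank_comp_le_left d₁ d₂).trans_lt h₃⟩, rfl⟩)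
  · intro y _
    rw [zero_mul]
    exact Submodule.zero_mem _
  · intro y _
    rw [mul_zero]
    exact Submodule.zero_mem _
  · intro x y z _ _ _ h h'
    rw [add_mul]
    exact Submodule.add_mem _ h h'
  · intro x y z _ _ _ h h'
    rw [mul_add]
    exact Submodule.add_mem _ h h'
  · intro r x y _ _ h
    rw [smul_mul_assoc]
    exact Submodule.smul_mem _ _ h
  · intro r x y _ _ h
    rw [mul_smul_comm]
    exact Submodule.smul_mem _ _ h

/-! ### Equivariance -/

theorem Kind.twistedAction_tmul (X : Kind) {μ : YoungDiagram} (d : X.diagrams k)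
    (w : X.symmetricDiagrams k μ.card) (v : spechtModule μ) :
    X.twistedAction k n μ d (Finsupp.single w 1 ⊗ₜ[ℂ] v) =
      if h : rank (conj d.1 w.1) = μ.card then
        n ^ loops d.1 w.1 • (Finsupp.single ⟨conj d.1 w.1, X.conj_mem d.2 w.2 h⟩ 1 ⊗ₜ[ℂ]
          (MonoidAlgebra.of ℂ _ (twist w.2.2 h) • v))
      else 0 := by
  rw [Kind.twistedAction, TensorProduct.lift.tmul, Finsupp.lift_apply,
    Finsupp.sum_single_index (by simp), one_smul]
  split_ifs <;> rfl

theorem Kind.twist_mem_perms {X : Kind} (hm : m ≤ k) (he : X.matching = true → Even (k - m))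
    {d : Diagram k} (hd : d ∈ X.diagrams k) {w : Diagram k} (hw : w ∈ X.symmetricDiagrams k m)
    (hr : rank (conj d w) = m) : twist hw.2 hr ∈ X.perms m :=
  Kind.mem_perms.2 fun hX => twist_eq_one hX hm he hd hw hr

/-- The map to `A_k / J_{m-1}` intertwines the twisted conjugation with the multiplication. -/
theorem Kind.quotientMap_twistedAction (X : Kind) {μ : YoungDiagram} (hμ : μ ∈ X.labels k)
    (d : X.diagrams k) (x : X.twistedModule k μ) :
    X.quotientMap n hμ (X.twistedAction k n μ d x) = X.diag n d.2 • X.quotientMap n hμ x := by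
  induction x using twistedModule_induction with
  | h0 => simp only [map_zero, smul_zero]
  | hadd x y hx hy => simp only [map_add, smul_add, hx, hy]
  | h w v =>
    have h := X.sameTop_factor hμ w
    rw [Kind.quotientMap_apply X hμ (_ ⊗ₜ _), ← map_smul, Kind.liftMap_tmul, smul_eq_mul,
      ← mul_assoc]
    -- The twisted action counts loops with `w` and the product counts them with `ω`; the numbers
    -- agree because the tops do.
    have hmul : X.diag n d.2 * X.diag n (X.factor hμ w).2.1 = n ^ loops d.1 w.1 •
        X.diag n (X.comp_mem d.2 (X.factor hμ w).2.1) := by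
      apply Subtype.ext
      rw [← loops_congr h]
      exact diag_mul_diag _ _
    rw [hmul, smul_mul_assoc, Kind.twistedAction_tmul]
    split_ifs with hr
    · rw [map_smul, Kind.quotientMap_apply, Kind.liftMap_tmul, ← LinearMap.map_smul_of_tower]
      congr 2
      apply Subtype.ext
      have hkey := comp_eq_comp_twist hμ.1 hμ.2.1 (X.factor hμ w).2.2
        (X.factor hμ ⟨conj d.1 w.1, X.conj_mem d.2 w.2 hr⟩).2.2 w.2.2 h hr
        (X.sameTop_factor hμ _)
      change DiagramAlgebras.diag n _ * X.weight k n μ.card (MonoidAlgebra.of ℂ _ _ * v.1) =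
        DiagramAlgebras.diag n (comp d.1 (X.factor hμ w).1) * X.weight k n μ.card v.1
      rw [hkey, Kind.weight_of_mul hμ.1 (Kind.twist_mem_perms hμ.1 hμ.2.1 d.2 w.2 hr), ← mul_assoc,
        diag_mul_permDiagram hμ.1]
    · rw [map_zero, eq_comm, Submodule.mkQ_apply, Submodule.Quotient.mk_eq_zero]
      -- The rank of `d ∘ ω` is at most `m` and equals that of the conjugate, which is not `m`. So
      -- the product is already in the ideal before the image of `v` is multiplied in.
      refine Submodule.smul_of_tower_mem _ _ (Kind.ideal_mul_mem ?_)
      refine Submodule.subset_span ⟨_, ⟨X.comp_mem d.2 (X.factor hμ w).2.1, ?_⟩, rfl⟩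
      refine lt_of_le_of_ne ?_ (by rwa [rank_comp_eq w.2.2 h])
      exact (rank_comp_le_right _ _).trans (X.factor hμ w).2.2.rank_eq.le

/-! ### The image of the map -/

theorem Kind.algebra_induction {X : Kind} {P : X.algebra k n → Prop} (a : X.algebra k n)
    (hd : ∀ (d : Diagram k) (hd : d ∈ X.diagrams k), P (X.diag n hd)) (h0 : P 0)
    (hadd : ∀ a b, P a → P b → P (a + b)) (hsmul : ∀ (r : ℂ) a, P a → P (r • a)) : P a := by
  obtain ⟨a, ha⟩ := a
  refine Submodule.span_induction (p := fun a ha => P ⟨a, ha⟩) ?_ h0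
    (fun a b ha hb => hadd ⟨a, ha⟩ ⟨b, hb⟩) (fun r a ha => hsmul r ⟨a, ha⟩) ha
  rintro _ ⟨d, h, rfl⟩
  exact hd d h

/-- By equivariance the range is stable under diagrams, and these span `A_k`. -/
theorem Kind.smul_mem_range (X : Kind) {μ : YoungDiagram} (hμ : μ ∈ X.labels k)
    (a : X.algebra k n) (x : X.twistedModule k μ) :
    a • X.quotientMap n hμ x ∈ LinearMap.range (X.quotientMap n hμ) := by
  induction a using Kind.algebra_induction with
  | hd d hd => exact ⟨_, X.quotientMap_twistedAction hμ ⟨d, hd⟩ x⟩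
  | h0 =>
    rw [zero_smul]
    exact Submodule.zero_mem _
  | hadd a b ha hb =>
    rw [add_smul]
    exact Submodule.add_mem _ ha hb
  | hsmul r a ha =>
    rw [smul_assoc]
    exact Submodule.smul_mem _ _ ha

/-- The symmetric diagram of the noncrossing factor `e_m`. -/
noncomputable def Kind.baseDiagram (X : Kind) {μ : YoungDiagram} (hμ : μ ∈ X.labels k) :
    X.symmetricDiagrams k μ.card :=
  X.factorEquiv hμ.1 hμ.2.1 ⟨X.idempotentDiagram k μ.card, X.idempotentDiagram_mem hμ.2.1,
    isNoncrossingFactor_idempotentDiagram X hμ.1⟩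

theorem Kind.factor_baseDiagram (X : Kind) {μ : YoungDiagram} (hμ : μ ∈ X.labels k) :
    (X.factor hμ (X.baseDiagram hμ)).1 = X.idempotentDiagram k μ.card := by
  rw [Kind.factor, Kind.baseDiagram, Equiv.symm_apply_apply]

theorem Kind.youngElement_mul_idempotentDiagram {X : Kind} {μ : YoungDiagram}
    (hμ : μ ∈ X.labels k) :
    X.youngElement k n μ * DiagramAlgebras.diag n (X.idempotentDiagram k μ.card) =
      DiagramAlgebras.diag n (X.idempotentDiagram k μ.card) * X.youngElement k n μ := by
  rw [← Kind.weight_youngSymmetrizer hμ, X.weight_mul_idempotentDiagram hμ.1]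

/-- Since `p e_m = e_m p`, and the diagram of `e_m` is itself a noncrossing factor, `e_λ` has the
form `ω v` up to the normalizing scalar of `e_m`. -/
theorem Kind.labelElement_mem_range (X : Kind) {μ : YoungDiagram} (hμ : μ ∈ X.labels k) :
    (X.ideal k n μ.card).mkQ (X.labelElement k n hμ) ∈ LinearMap.range (X.quotientMap n hμ) := by
  refine ⟨(n ^ (if X.matching then (k - μ.card) / 2 else k - μ.card))⁻¹ •
    (Finsupp.single (X.baseDiagram hμ) 1 ⊗ₜ[ℂ] ⟨youngSymmetrizer μ, Ideal.subset_span rfl⟩), ?_⟩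
  rw [Kind.quotientMap_apply, map_smul, Kind.liftMap_tmul]
  congr 1
  apply Subtype.ext
  change _ • (DiagramAlgebras.diag n (X.factor hμ (X.baseDiagram hμ)).1 *
    X.weight k n μ.card (youngSymmetrizer μ)) = X.youngElement k n μ * X.idempotent k n μ.card
  rw [Kind.factor_baseDiagram, Kind.weight_youngSymmetrizer hμ,
    ← Kind.youngElement_mul_idempotentDiagram hμ, Kind.idempotent, mul_smul_comm]

/-- Write the image of `v` as `a p`. Since it commutes with the diagram `E` of `e_m`, one gets `ω a
p E = ω E a p`, which is a power of `n` times `ω a p`. So `ω v` is a scalar multiple of `ω a e_λ`.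
-/
theorem Kind.quotientMap_mem (X : Kind) {μ : YoungDiagram} (hμ : μ ∈ X.labels k)
    (hn : μ.card < k → n ≠ 0) (x : X.twistedModule k μ) :
    X.quotientMap n hμ x ∈ X.quotientModule k n hμ := by
  induction x using twistedModule_induction with
  | h0 =>
    rw [map_zero]
    exact Submodule.zero_mem _
  | hadd x y hx hy =>
    rw [map_add]
    exact Submodule.add_mem _ hx hy
  | h w v =>
    rw [Kind.quotientMap_apply, Kind.liftMap_tmul]
    refine Submodule.mem_map_of_mem (Ideal.mem_span_singleton'.2 ?_)
    obtain ⟨a, ha, hav⟩ := Kind.exists_weight_eq (n := n) hμ v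
    set ω := X.factor hμ w
    set E := X.idempotentDiagram k μ.card
    have hω := ω.2.2.isFactor hμ.2.1
    have h1 : DiagramAlgebras.diag n ω.1 * DiagramAlgebras.diag n E =
        n ^ loops ω.1 E • DiagramAlgebras.diag n ω.1 := by
      rw [diag_mul_diag, hω.comp_idempotentDiagram]
    have hl : n ^ loops ω.1 E ≠ 0 := by
      rcases hμ.1.lt_or_eq with h | h
      · exact pow_ne_zero _ (hn h)
      · rw [loops_idempotentDiagram _ h, pow_zero]
        exact one_ne_zero
    have hc : n ^ (if X.matching then (k - μ.card) / 2 else k - μ.card) ≠ 0 := by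
      rcases hμ.1.lt_or_eq with h | h
      · exact pow_ne_zero _ (hn h)
      · simp [h]
    -- The first factor cancels the normalization of `e_m`, the second the loops between `ω` and
    -- `E`. The number of these loops need not be known; it is enough that the power of `n` is
    -- nonzero.
    refine ⟨(n ^ (if X.matching then (k - μ.card) / 2 else k - μ.card) *
      (n ^ loops ω.1 E)⁻¹) • (X.diag n ω.2.1 * ⟨a, ha⟩), ?_⟩
    apply Subtype.ext
    change _ • (DiagramAlgebras.diag n ω.1 * a) *
      (X.youngElement k n μ * X.idempotent k n μ.card) =
        DiagramAlgebras.diag n ω.1 * X.weight k n μ.card v.1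
    have h2 : DiagramAlgebras.diag n ω.1 * a *
        (X.youngElement k n μ * DiagramAlgebras.diag n E) =
          n ^ loops ω.1 E • (DiagramAlgebras.diag n ω.1 * X.weight k n μ.card v.1) := by
      rw [mul_assoc, ← mul_assoc a, ← hav, X.weight_mul_idempotentDiagram hμ.1, ← mul_assoc, h1,
        smul_mul_assoc]
    rw [Kind.idempotent, mul_smul_comm, mul_smul_comm, smul_mul_assoc, h2, smul_smul, smul_smul]
    convert one_smul ℂ _
    field_simp

/-- The image of `A_k^λ` is `(A_k e_λ) / J_{m-1}`. -/
noncomputable def Kind.quotientEquiv (X : Kind) {μ : YoungDiagram} (hμ : μ ∈ X.labels k)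
    (hn : μ.card < k → n ≠ 0) : X.twistedModule k μ ≃ₗ[ℂ] X.quotientModule k n hμ :=
  LinearEquiv.ofBijective
    { toFun := fun x => ⟨X.quotientMap n hμ x, X.quotientMap_mem hμ hn x⟩
      map_add' := fun x y => Subtype.ext (map_add _ x y)
      map_smul' := fun r x => Subtype.ext (map_smul _ r x) } (by
    constructor
    · intro x y h
      exact X.quotientMap_injective hμ (congrArg Subtype.val h)
    -- An element of the target is the class of some `a e_λ`; the range contains the class of `e_λ`
    -- and is stable under `a`.
    · rintro ⟨y, hy⟩
      obtain ⟨b, hb, rfl⟩ := hy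
      obtain ⟨a, rfl⟩ := Ideal.mem_span_singleton'.1 hb
      obtain ⟨x, hx⟩ := X.labelElement_mem_range (n := n) hμ
      obtain ⟨z, hz⟩ := X.smul_mem_range hμ a x
      refine ⟨z, Subtype.ext (hz.trans ?_)⟩
      rw [hx, ← map_smul, smul_eq_mul])

/-! ### Transport of the module structure to `A_k^λ` -/

instance (X : Kind) {μ : YoungDiagram} (hμ : μ ∈ X.labels k) :
    SMulCommClass (X.algebra k n) ℂ (X.quotientModule k n hμ) :=
  IsScalarTower.to_smulCommClass'

/-- The action of `A_k` on `A_k^λ`. -/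
noncomputable def Kind.representation (X : Kind) {μ : YoungDiagram} (hμ : μ ∈ X.labels k)
    (hn : μ.card < k → n ≠ 0) : X.algebra k n →ₐ[ℂ] Module.End ℂ (X.twistedModule k μ) :=
  ((X.quotientEquiv hμ hn).symm.conjAlgEquiv ℂ).toAlgHom.comp
    (Algebra.lsmul ℂ (A := X.algebra k n) ℂ (X.quotientModule k n hμ))

theorem Kind.quotientEquiv_representation (X : Kind) {μ : YoungDiagram} (hμ : μ ∈ X.labels k)
    (hn : μ.card < k → n ≠ 0) (a : X.algebra k n) (x : X.twistedModule k μ) :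
    X.quotientEquiv hμ hn (X.representation hμ hn a x) = a • X.quotientEquiv hμ hn x :=
  (X.quotientEquiv hμ hn).apply_symm_apply _

/-- After applying the injective map to the quotient, both sides become multiplication by `d`: one
by construction of the representation, the other by equivariance. -/
theorem Kind.representation_diag (X : Kind) {μ : YoungDiagram} (hμ : μ ∈ X.labels k)
    (hn : μ.card < k → n ≠ 0) (d : X.diagrams k) :
    X.representation hμ hn (X.diag n d.2) = X.twistedAction k n μ d := by
  refine LinearMap.ext fun x => ?_
  apply (X.quotientEquiv hμ hn).injective
  rw [Kind.quotientEquiv_representation]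
  exact Subtype.ext (X.quotientMap_twistedAction hμ d x).symm

end DiagramAlgebras

/-- For `A_k` one of the partition, Brauer, rook-Brauer, rook monoid, Temperley-Lieb, Motzkin and
planar rook monoid algebras with parameter `n`, assumed semisimple, and a partition `λ` with
`λ* ∈ Λ^{A_k}` of size `m` (only `λ*` matters), the twisted conjugation makes `A_k^λ` an `A_k`-module
isomorphic to `(A_k e_λ) / J_{m-1}`, by an isomorphism induced by the bijection between noncrossing
`m`-factors and symmetric `m`-diagrams. The hypothesis `hn` says that `e_m` is defined. -/
theorem mainTheorem6 (X : Kind) (k : ℕ) (n : ℂ) (hss : IsSemisimpleRing (X.algebra k n))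
    (lam : YoungDiagram) (hlam : removeFirstRow lam ∈ X.labels k)
    (hn : (removeFirstRow lam).card < k → n ≠ 0) :
    ∃ (β : X.noncrossingFactors k (removeFirstRow lam).card ≃
          X.symmetricDiagrams k (removeFirstRow lam).card)
      (ρ : X.algebra k n →ₐ[ℂ] Module.End ℂ (X.twistedModule k (removeFirstRow lam)))
      (φ : X.twistedModule k (removeFirstRow lam) ≃ₗ[ℂ] X.quotientModule k n hlam),
      (∀ ω, SameTop ω.1 (β ω).1) ∧
      (∀ d : X.diagrams k,
        ρ ⟨diag n d.1, X.diag_mem d.2⟩ = X.twistedAction k n (removeFirstRow lam) d) ∧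
      (∀ a x, φ (ρ a x) = a • φ x) ∧
      ∀ ω (t : Tableau (removeFirstRow lam)), IsStandard t →
        ∃ b : X.algebra k n,
          (b : PartitionAlgebra k n) =
            diag n ω.1 * diag n (permDiagram k (tableauPerm t)) *
              X.youngElement k n (removeFirstRow lam) ∧
          (φ (Finsupp.single (β ω) 1 ⊗ₜ[ℂ] naturalVector t)).1 =
            (X.ideal k n (removeFirstRow lam).card).mkQ b := by
  refine ⟨X.factorEquiv hlam.1 hlam.2.1, X.representation hlam hn, X.quotientEquiv hlam hn,
    X.sameTop_factorEquiv hlam.1 hlam.2.1, X.representation_diag hlam hn,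
    X.quotientEquiv_representation hlam hn, fun ω t ht => ?_⟩
  -- The representative in `A_k` is the lift of `w ⊗ n_t` before passing to the quotient, so the
  -- second condition holds by definition and only its value remains to be computed.
  refine ⟨X.liftMap n hlam (Finsupp.single (X.factorEquiv hlam.1 hlam.2.1 ω) 1 ⊗ₜ[ℂ]
    naturalVector t), ?_, rfl⟩
  rw [Kind.liftMap_tmul, Subalgebra.coe_mul, Kind.coe_weightMap, Kind.weight_naturalVector hlam ht,
    mul_assoc]
  change diag n (X.factor hlam _).1 * _ = _
  rw [Kind.factor, Equiv.symm_apply_apply]
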